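/- Let $2=\{0,1\}$. We consider functions $f:2^n\to 2$ of arities $0<n\le\omega$. A *clone* is a set of such functions that contains all projections $\pi^n_i(x)=x_i$ and is closed under composition $g(f_0,f_1,\dots)$ (with $g$ of arity $n$ and all $f_i$ of one arity $m$). A *finitary clone* is the same notion with only arities $0<n<\omega$. A *Borel clone* is a clone (arities $0<n\le\omega$) consisting of Borel functions. For a class $F$ of functions, $F^{<\omega}$ and $F^{\mathrm B}$ denote the functions in $F$ of finite arity and the Borel functions in $F$; $\langle F\rangle$ is the clone (arities $0<n\le\omega$) generated by $F$. A Borel clone $F$ *lies over* a finitary clone $G$ if $F^{<\omega}=G$. For a set $\mathcal M$ of relations $R\subseteq 2^k$ ($0<k\le\omega$), $\mathrm{Pol}(\mathcal M)$ is the set of all functions preserving every $R\in\mathcal M$, and $\mathrm{Pol}^{\mathrm B}(\mathcal M)=\mathrm{Pol}(\mathcal M)^{\mathrm B}$. *Functions.* $0,1$ are the constant functions, $\wedge,\vee,\neg$ are as usual, $\bigwedge,\bigvee:2^\omega\to2$ are countable conjunction and disjunction, $\liminf x=\bigvee_i\bigwedge_{j\ge i}x_j$, $x\to y=\neg x\vee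 y$, $x\not\to y=x\wedge\neg y$, $(x\,?\,y:z)=(x\wedge y)\vee(\neg x\wedge z)$, $m$ is the 2-out-of-3 median, $+^3$ is the ternary sum mod 2. For $f:2^n\to2$, put $\lceil f\rceil(x_0,x_1,\dots)=x_0\wedge f(x_1,\dots)$, $\lfloor f\rfloor(x_0,x_1,\dots)=x_0\vee f(x_1,\dots)$, and $\beta(f)(x_0,x_1,\dots)$ equals $f(x_1,x_2,\dots)$ if $x_0=0$ and $\neg f(\neg x_1,\neg x_2,\dots)$ if $x_0=1$. *Relations.* $\le$ is the order $0<1$; $0$ and $1$ are the unary relations $\{0\},\{1\}$; $\neg$, $+^3$ stand for the graphs of these functions; $\bigvee{\uparrow}$, $\bigwedge{\downarrow}$, $\lim$ are the graphs of the partial operations $2^\omega\rightharpoonup2$ join of an increasing sequence, meet of a decreasing sequence, limit of a convergent sequence; $(\lim{=}c)\subseteq2^\omega$ is the set of sequences converging to $c$. *Clones.* $\mathsf O$ = all functions, $\mathsf M=\mathrm{Pol}\{\le\}$, $\mathsf T_c=\mathrm{Pol}\{c\}$, $\mathsf L_c=\mathrm{Pol}\{\lim{=}c\}$ ($c=0,1$),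 $\mathsf I=\mathrm{Pol}\{\bigvee{\uparrow}\}$, $\mathsf E=\mathrm{Pol}\{\bigwedge{\downarrow}\}$, $\mathsf D=\mathrm{Pol}\{\neg\}$ (self-dual functions), $\mathsf A=\mathrm{Pol}\{+^3\}$ (affine functions). Juxtaposition denotes intersection. **Theorem.** (a) Over the eight finitary clones $G^{<\omega}$ with $G$ one of $\mathsf O,\mathsf T_0,\mathsf T_1,\mathsf T_0\mathsf T_1,\mathsf M,\mathsf M\mathsf T_0,\mathsf M\mathsf T_1,\mathsf M\mathsf T_0\mathsf T_1$ there lie exactly $2,3,3,5,4,6,6,9$ Borel clones, respectively, namely the following. - Over $\mathsf O^{<\omega}$ (2): $\mathsf O^{\mathrm B}=\mathrm{Pol}^{\mathrm B}\emptyset=\langle\bigvee,\neg\rangle=\langle\bigwedge,\bigvee,0,1,\neg\rangle$; $\langle\mathsf O^{<\omega}\rangle=\mathrm{Pol}^{\mathrm B}\{\lim\}=\langle\vee,\neg\rangle=\langle\wedge,\vee,0,1,\neg\rangle$. - Over $\mathsf T_0^{<\omega}$ (3): $\mathsf T_0^{\mathrm B}=\mathrm{Pol}^{\mathrm B}\{0\}=\langle\bigvee,\not\to\rangle=\langle\bigwedge,\bigvee,0,\not\to\rangle$;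 $\mathsf L_0^{\mathrm B}=\mathrm{Pol}^{\mathrm B}\{\lim{=}0\}=\langle\bigwedge,\vee,\not\to\rangle=\langle\lceil\bigvee\rceil,\vee,\not\to\rangle=\langle\bigwedge,\lceil\bigvee\rceil,\vee,0,\not\to\rangle$; $\langle\mathsf T_0^{<\omega}\rangle=\mathrm{Pol}^{\mathrm B}\{\lim,0\}=\langle\vee,\not\to\rangle=\langle\wedge,\vee,0,\not\to\rangle$. - Over $\mathsf T_1^{<\omega}$ (3): $\mathsf T_1^{\mathrm B}=\mathrm{Pol}^{\mathrm B}\{1\}=\langle\bigwedge,\to\rangle=\langle\bigvee,\bigwedge,1,\to\rangle$; $\mathsf L_1^{\mathrm B}=\mathrm{Pol}^{\mathrm B}\{\lim{=}1\}=\langle\bigvee,\wedge,\to\rangle=\langle\lfloor\bigwedge\rfloor,\wedge,\to\rangle=\langle\bigvee,\lfloor\bigwedge\rfloor,\wedge,1,\to\rangle$; $\langle\mathsf T_1^{<\omega}\rangle=\mathrm{Pol}^{\mathrm B}\{\lim,1\}=\langle\wedge,\to\rangle=\langle\vee,\wedge,1,\to\rangle$. - Over $\mathsf T_0\mathsf T_1^{<\omega}$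 (5): $\mathsf T_0\mathsf T_1^{\mathrm B}=\mathrm{Pol}^{\mathrm B}\{0,1\}=\langle\bigwedge,\bigvee,?{:}\rangle$; $\mathsf T_0\mathsf L_1^{\mathrm B}=\mathrm{Pol}^{\mathrm B}\{0,\lim{=}1\}=\langle\bigvee,?{:}\rangle$; $\mathsf L_0\mathsf T_1^{\mathrm B}=\mathrm{Pol}^{\mathrm B}\{\lim{=}0,1\}=\langle\bigwedge,?{:}\rangle$; $\mathsf L_0\mathsf L_1^{\mathrm B}=\mathrm{Pol}^{\mathrm B}\{\lim{=}0,\lim{=}1\}=\langle\lfloor\bigwedge\rfloor,?{:}\rangle=\langle\lceil\bigvee\rceil,?{:}\rangle$; $\langle\mathsf T_0\mathsf T_1^{<\omega}\rangle=\mathrm{Pol}^{\mathrm B}\{\lim,0,1\}=\langle?{:}\rangle$. - Over $\mathsf M^{<\omega}$ (4): $\mathsf M^{\mathrm B}=\mathrm{Pol}^{\mathrm B}\{\le\}=\langle\bigwedge,\bigvee,0,1\rangle$; $\mathsf I^{\mathrm B}=\mathrm{Pol}^{\mathrm B}\{\bigvee{\uparrow}\}=\langle\wedge,\bigvee,0,1\rangle$;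 $\mathsf E^{\mathrm B}=\mathrm{Pol}^{\mathrm B}\{\bigwedge{\downarrow}\}=\langle\bigwedge,\vee,0,1\rangle$; $\langle\mathsf M^{<\omega}\rangle=\mathrm{Pol}^{\mathrm B}\{\lim,\le\}=\langle\wedge,\vee,0,1\rangle$. - Over $\mathsf M\mathsf T_0^{<\omega}$ (6): $\mathsf M\mathsf T_0^{\mathrm B}=\mathrm{Pol}^{\mathrm B}\{\le,0\}=\langle\bigwedge,\bigvee,0\rangle$; $\mathsf I\mathsf T_0^{\mathrm B}=\mathrm{Pol}^{\mathrm B}\{\bigvee{\uparrow},0\}=\langle\wedge,\bigvee,0\rangle$; $\mathsf M\mathsf L_0^{\mathrm B}=\mathrm{Pol}^{\mathrm B}\{\le,\lim{=}0\}=\langle\bigwedge,\lceil\bigvee\rceil,\vee,0\rangle$; $\mathsf I\mathsf L_0^{\mathrm B}=\mathrm{Pol}^{\mathrm B}\{\bigvee{\uparrow},\lim{=}0\}=\langle\lceil\bigvee\rceil,\vee,0\rangle$; $\mathsf E\mathsf T_0^{\mathrm B}=\mathrm{Pol}^{\mathrm B}\{\bigwedge{\downarrow},0\}=\mathrm{Pol}^{\mathrm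 B}\{\bigwedge{\downarrow},\lim{=}0\}=\langle\bigwedge,\vee,0\rangle$; $\langle\mathsf M\mathsf T_0^{<\omega}\rangle=\mathrm{Pol}^{\mathrm B}\{\le,\lim,0\}=\langle\wedge,\vee,0\rangle$. - Over $\mathsf M\mathsf T_1^{<\omega}$ (6): $\mathsf M\mathsf T_1^{\mathrm B}=\mathrm{Pol}^{\mathrm B}\{\le,1\}=\langle\bigvee,\bigwedge,1\rangle$; $\mathsf E\mathsf T_1^{\mathrm B}=\mathrm{Pol}^{\mathrm B}\{\bigwedge{\downarrow},1\}=\langle\vee,\bigwedge,1\rangle$; $\mathsf M\mathsf L_1^{\mathrm B}=\mathrm{Pol}^{\mathrm B}\{\le,\lim{=}1\}=\langle\bigvee,\lfloor\bigwedge\rfloor,\wedge,1\rangle$; $\mathsf E\mathsf L_1^{\mathrm B}=\mathrm{Pol}^{\mathrm B}\{\bigwedge{\downarrow},\lim{=}1\}=\langle\lfloor\bigwedge\rfloor,\wedge,1\rangle$; $\mathsf I\mathsf T_1^{\mathrm B}=\mathrm{Pol}^{\mathrm B}\{\bigvee{\uparrow},1\}=\mathrm{Pol}^{\mathrm B}\{\bigvee{\uparrow},\lim{=}1\}=\langle\bigvee,\wedge,1\rangle$;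 $\langle\mathsf M\mathsf T_1^{<\omega}\rangle=\mathrm{Pol}^{\mathrm B}\{\le,\lim,1\}=\langle\vee,\wedge,1\rangle$. - Over $\mathsf M\mathsf T_0\mathsf T_1^{<\omega}$ (9): $\mathsf M\mathsf T_0\mathsf T_1^{\mathrm B}=\mathrm{Pol}^{\mathrm B}\{\le,0,1\}=\langle\bigwedge,\bigvee\rangle$; $\mathsf M\mathsf T_0\mathsf L_1^{\mathrm B}=\mathrm{Pol}^{\mathrm B}\{\le,0,\lim{=}1\}=\langle\lfloor\bigwedge\rfloor,\wedge,\bigvee\rangle$; $\mathsf I\mathsf T_0\mathsf T_1^{\mathrm B}=\mathrm{Pol}^{\mathrm B}\{\bigvee{\uparrow},0,1\}=\langle\wedge,\bigvee\rangle$; $\mathsf M\mathsf L_0\mathsf T_1^{\mathrm B}=\mathrm{Pol}^{\mathrm B}\{\le,\lim{=}0,1\}=\langle\bigwedge,\lceil\bigvee\rceil,\vee\rangle$; $\mathsf E\mathsf T_0\mathsf T_1^{\mathrm B}=\mathrm{Pol}^{\mathrm B}\{\bigwedge{\downarrow},0,1\}=\langle\bigwedge,\vee\rangle$; $\mathsf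 M\mathsf L_0\mathsf L_1^{\mathrm B}=\mathrm{Pol}^{\mathrm B}\{\le,\lim{=}0,\lim{=}1\}=\langle\lfloor\bigwedge\rfloor,\lceil\bigvee\rceil\rangle$; $\mathsf I\mathsf L_0\mathsf T_1^{\mathrm B}=\mathrm{Pol}^{\mathrm B}\{\bigvee{\uparrow},\lim{=}0,1\}=\langle\lceil\bigvee\rceil,\vee\rangle$; $\mathsf E\mathsf T_0\mathsf L_1^{\mathrm B}=\mathrm{Pol}^{\mathrm B}\{\bigwedge{\downarrow},0,\lim{=}1\}=\langle\lfloor\bigwedge\rfloor,\wedge\rangle$; $\langle\mathsf M\mathsf T_0\mathsf T_1^{<\omega}\rangle=\mathrm{Pol}^{\mathrm B}\{\le,\lim,0,1\}=\langle\wedge,\vee\rangle$. (b) Over $\mathsf D^{<\omega}$, $\mathsf D\mathsf T_0^{<\omega}=\mathsf D\mathsf T_1^{<\omega}$ and $\mathsf D\mathsf M^{<\omega}$ there lie exactly $2$, $3$ and $3$ Borel clones, respectively, namely the following. - Over $\mathsf D^{<\omega}$: $\mathsf D^{\mathrm B}=\mathrm{Pol}^{\mathrm B}\{\neg\}=\langle\beta(\bigvee),\neg\rangle=\langle\beta(\bigwedge),\neg\rangle$;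 $\langle\mathsf D^{<\omega}\rangle=\mathrm{Pol}^{\mathrm B}\{\lim,\neg\}=\langle m,\neg\rangle$. - Over $\mathsf D\mathsf T_0^{<\omega}$: $\mathsf D\mathsf T_0^{\mathrm B}=\mathsf D\mathsf T_1^{\mathrm B}=\mathrm{Pol}^{\mathrm B}\{\neg,0\}=\langle\beta(\bigvee),+^3\rangle=\langle\beta(\bigvee)\rangle$; $\mathsf D\mathsf L_0^{\mathrm B}=\mathsf D\mathsf L_1^{\mathrm B}=\mathrm{Pol}^{\mathrm B}\{\neg,\lim{=}0\}=\langle\beta(\bigwedge),+^3\rangle$; $\langle\mathsf D\mathsf T_0^{<\omega}\rangle=\langle\mathsf D\mathsf T_1^{<\omega}\rangle=\mathrm{Pol}^{\mathrm B}\{\neg,\lim,0\}=\langle m,+^3\rangle$. - Over $\mathsf D\mathsf M^{<\omega}$: $\mathsf D\mathsf M^{\mathrm B}=\mathrm{Pol}^{\mathrm B}\{\neg,\le\}=\langle\beta(\liminf)\rangle$; $\mathsf D\mathsf M\mathsf L_0^{\mathrm B}=\mathsf D\mathsf M\mathsf L_1^{\mathrm B}=\mathrm{Pol}^{\mathrm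 B}\{\neg,\le,\lim{=}0\}=\langle\beta(\bigwedge)\rangle$; $\langle\mathsf D\mathsf M^{<\omega}\rangle=\mathrm{Pol}^{\mathrm B}\{\neg,\le,\lim\}=\langle m\rangle$. (c) Over a finitary clone $G$ on $2$ there lies exactly one Borel clone if and only if $G\subseteq\mathsf A$. If $G\subseteq\mathsf A$, this unique Borel clone is $\langle G\rangle$, and it equals the set of all Borel functions that are pointwise limits of functions in $\langle G\rangle$ (i.e. lie in the closure of $\langle G\rangle$ for the topology of pointwise convergence, arity by arity). Moreover $\mathsf A^{\mathrm B}=\langle\mathsf A^{<\omega}\rangle$, and every affine Borel function $f:2^n\to2$, $0<n\le\omega$, is continuous. -/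

import Mathlib

open Filter Topology

namespace BorelClone

/-- The arities `0 < n ≤ ω`: `fin k` stands for the positive finite arity `k + 1`,
and `omega` for `ω`. -/
inductive Arity : Type
  | fin (k : ℕ) : Arity
  | omega : Arity

/-- The index set `{i | i < n}` of an arity `n`. -/
abbrev Arity.Idx : Arity → Type
  | .fin k => Fin (k + 1)
  | .omega => ℕ

/-- The arity `1 + n`. -/
abbrev Arity.oneAdd : Arity → Arity
  | .fin k => .fin (k + 1)
  | .omega => .omega

/-- The first index of `1 + n`. -/
def Arity.first : (n : Arity) → n.oneAdd.Idx
  | .fin k => (0 : Fin (k + 2))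
  | .omega => (0 : ℕ)

/-- The index `1 + i` of `1 + n`. -/
def Arity.next : (n : Arity) → n.Idx → n.oneAdd.Idx
  | .fin _, i => Fin.succ i
  | .omega, i => Nat.succ i

/-- The set `2 = {0, 1}` is `Bool`. This is the type of `n`-ary functions `2ⁿ → 2`. -/
abbrev Arity.Fn (n : Arity) : Type := (n.Idx → Bool) → Bool

/-- Functions `2ⁿ → 2` of any arity `0 < n ≤ ω` (a disjoint union over `n`). -/
abbrev Op : Type := Σ n : Arity, n.Fn

/-- Relations on `2` of any arity `0 < k ≤ ω`. -/
abbrev Rel : Type := Σ k : Arity, Set (k.Idx → Bool)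

/-! ### Clones -/

/-- The set of finite arities. -/
def finiteArities : Set Arity := Set.range Arity.fin

/-- `N`-ary clones: sets of `N`-ary functions that contain all `N`-ary projections and are
closed under composition. -/
structure IsCloneOn (N : Set Arity) (F : Set Op) : Prop where
  arity_mem : ∀ f ∈ F, f.1 ∈ N
  proj_mem : ∀ n ∈ N, ∀ i : n.Idx, (⟨n, fun x => x i⟩ : Op) ∈ F
  comp_mem : ∀ m ∈ N, ∀ n ∈ N, ∀ (g : n.Fn) (f : n.Idx → m.Fn),
    (⟨n, g⟩ : Op) ∈ F → (∀ i, (⟨m, f i⟩ : Op) ∈ F) →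
      (⟨m, fun x => g (fun i => f i x)⟩ : Op) ∈ F

/-- The functions of finite arity. -/
def finitaryOps : Set Op := {f | f.1 ∈ finiteArities}

/-- The Borel functions (`2ⁿ` carries the product σ-algebra, which is its Borel σ-algebra). -/
def borelOps : Set Op := {f | Measurable f.2}

/-- The finitary restriction of a class of functions. -/
def finPart (F : Set Op) : Set Op := F ∩ finitaryOps

/-- The Borel functions in a class of functions. -/
def borelPart (F : Set Op) : Set Op := F ∩ borelOps

/-- Finitary clones on `2`, the elements of Post's lattice. -/
def IsFinitaryClone (F : Set Op) : Prop := IsCloneOn finiteArities F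

/-- Borel clones on `2`: clones of Borel functions of countable arity. -/
def IsBorelClone (F : Set Op) : Prop := IsCloneOn Set.univ F ∧ F ⊆ borelOps

/-- The Borel clones whose finitary restriction is `G`. -/
def fiber (G : Set Op) : Set (Set Op) := {F | IsBorelClone F ∧ finPart F = G}

/-- The countable-arity clone generated by `F`. -/
def gen (F : Set Op) : Set Op := ⋂₀ {G | IsCloneOn Set.univ G ∧ F ⊆ G}

/-- The functions that are pointwise limits of functions of the same arity in `F`. -/
def pointwiseClosure (F : Set Op) : Set Op :=
  {f | f.2 ∈ closure {g : f.1.Fn | (⟨f.1, g⟩ : Op) ∈ F}}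

/-! ### Polymorphisms -/

/-- `f` preserves `R`: for every `k × n` matrix whose columns all lie in `R`, the column obtained
by applying `f` to each row lies in `R`. -/
def Preserves (f : Op) (R : Rel) : Prop :=
  ∀ x : R.1.Idx → f.1.Idx → Bool,
    (∀ j, (fun i => x i j) ∈ R.2) → (fun i => f.2 (x i)) ∈ R.2

/-- All polymorphisms of a set of relations. -/
def Pol (M : Set Rel) : Set Op := {f | ∀ R ∈ M, Preserves f R}

/-- The Borel polymorphisms of a set of relations. -/
def PolB (M : Set Rel) : Set Op := borelPart (Pol M)

/-- There are exactly `n` Borel clones with finitary restriction `G`, and they are listed in the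
table `T`. A row `(C, Ms, Gs)` of the table stands for a Borel clone `C` that consists of the Borel
polymorphisms of each of the sets of relations in the list `Ms` and that is generated by each of the
sets of functions in the list `Gs`. -/
def Classified (G : Set Op) (n : ℕ)
    (T : List (Set Op × List (Set Rel) × List (Set Op))) : Prop :=
  (fiber G).encard = n ∧
  (∀ F : Set Op, F ∈ fiber G ↔ ∃ t ∈ T, t.1 = F) ∧
  ∀ t ∈ T, (∀ M ∈ t.2.1, t.1 = PolB M) ∧ ∀ S ∈ t.2.2, t.1 = gen S

/-! ### Functions on `2` -/

def opNot : Op := ⟨.fin 0, fun x : Fin 1 → Bool => !x 0⟩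
/-- The unary constant function `0`. -/
def opZero : Op := ⟨.fin 0, fun _ => false⟩
/-- The unary constant function `1`. -/
def opOne : Op := ⟨.fin 0, fun _ => true⟩
def opAnd : Op := ⟨.fin 1, fun x : Fin 2 → Bool => x 0 && x 1⟩
def opOr : Op := ⟨.fin 1, fun x : Fin 2 → Bool => x 0 || x 1⟩
/-- Implication `x → y`. -/
def opImp : Op := ⟨.fin 1, fun x : Fin 2 → Bool => !x 0 || x 1⟩
/-- Non-implication `x ∧ ¬ y`. -/
def opNimp : Op := ⟨.fin 1, fun x : Fin 2 → Bool => x 0 && !x 1⟩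
/-- The conditional `x ? y : z`. -/
def opIte : Op := ⟨.fin 2, fun x : Fin 3 → Bool => (x 0 && x 1) || (!x 0 && x 2)⟩
/-- The 2-out-of-3 median. -/
def opMedian : Op :=
  ⟨.fin 2, fun x : Fin 3 → Bool => (x 0 && x 1) || (x 0 && x 2) || (x 1 && x 2)⟩
/-- The ternary sum mod 2. -/
def opXor3 : Op := ⟨.fin 2, fun x : Fin 3 → Bool => ((x 0).xor (x 1)).xor (x 2)⟩

open Classical in
/-- Countable conjunction `2^ω → 2`. -/
noncomputable def opBigAnd : Op := ⟨.omega, fun x : ℕ → Bool => decide (∀ i, x i = true)⟩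

open Classical in
/-- Countable disjunction `2^ω → 2`. -/
noncomputable def opBigOr : Op := ⟨.omega, fun x : ℕ → Bool => decide (∃ i, x i = true)⟩

open Classical in
/-- `liminf : 2^ω → 2`, the join over `i` of the meet of all `x j` with `j ≥ i`. -/
noncomputable def opLiminf : Op :=
  ⟨.omega, fun x : ℕ → Bool => decide (∃ i, ∀ j, i ≤ j → x j = true)⟩

/-- `⌈f⌉ (x₀, x₁, …) = x₀ ∧ f (x₁, …)`. -/
def ceilOp (f : Op) : Op :=
  ⟨f.1.oneAdd, fun x => x f.1.first && f.2 (fun i => x (f.1.next i))⟩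

/-- `⌊f⌋ (x₀, x₁, …) = x₀ ∨ f (x₁, …)`. -/
def floorOp (f : Op) : Op :=
  ⟨f.1.oneAdd, fun x => x f.1.first || f.2 (fun i => x (f.1.next i))⟩

/-- The de Morgan dual `¬ ∘ f ∘ ¬`. -/
def deMorgan (f : Op) : Op := ⟨f.1, fun x => !f.2 (fun i => !x i)⟩

/-- `β(f) (x₀, x) = (x₀ ? δ(f)(x) : f(x))`, where `δ(f)` is the de Morgan dual. -/
def beta (f : Op) : Op :=
  ⟨f.1.oneAdd, fun x =>
    bif x f.1.first then (deMorgan f).2 (fun i => x (f.1.next i))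
    else f.2 (fun i => x (f.1.next i))⟩

/-! ### Relations on `2` -/

/-- The graph of a function, as a `(1 + n)`-ary relation with the value in the first place. -/
def graph (f : Op) : Rel :=
  ⟨f.1.oneAdd, {v | v f.1.first = f.2 (fun i => v (f.1.next i))}⟩

def relLe : Rel := ⟨.fin 1, {v : Fin 2 → Bool | v 0 ≤ v 1}⟩
/-- The unary relation `{0}`. -/
def relZero : Rel := ⟨.fin 0, {v : Fin 1 → Bool | v 0 = false}⟩
/-- The unary relation `{1}`. -/
def relOne : Rel := ⟨.fin 0, {v : Fin 1 → Bool | v 0 = true}⟩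
/-- The graph of negation. -/
def relNot : Rel := graph opNot
/-- The graph of the ternary sum mod 2. -/
def relXor3 : Rel := graph opXor3
/-- The graph of the partial operation "join of an increasing sequence". -/
def relJoinUp : Rel :=
  ⟨.omega, {v : ℕ → Bool | Monotone (fun i => v (i + 1)) ∧
    IsLUB (Set.range fun i => v (i + 1)) (v 0)}⟩
/-- The graph of the partial operation "meet of a decreasing sequence". -/
def relMeetDown : Rel :=
  ⟨.omega, {v : ℕ → Bool | Antitone (fun i => v (i + 1)) ∧
    IsGLB (Set.range fun i => v (i + 1)) (v 0)}⟩
/-- The graph of the partial operation "limit of a convergent sequence". -/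
def relLim : Rel := ⟨.omega, {v : ℕ → Bool | Tendsto (fun i => v (i + 1)) atTop (𝓝 (v 0))}⟩
/-- `lim = 0`: the sequences converging to `0`. -/
def relLimZero : Rel := ⟨.omega, {v : ℕ → Bool | Tendsto v atTop (𝓝 false)}⟩
/-- `lim = 1`: the sequences converging to `1`. -/
def relLimOne : Rel := ⟨.omega, {v : ℕ → Bool | Tendsto v atTop (𝓝 true)}⟩

/-! ### Named clones -/

/-- All functions. -/
def All : Set Op := Set.univ
/-- The functions that are affine over `ℤ/2ℤ`. -/
def Aff : Set Op := Pol {relXor3}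
/-- The self-dual functions. -/
def Dual : Set Op := Pol {relNot}
/-- The monotone functions. -/
def Mono : Set Op := Pol {relLe}
/-- The functions preserving meets of decreasing sequences. -/
def Decr : Set Op := Pol {relMeetDown}
/-- The functions preserving joins of increasing sequences. -/
def Incr : Set Op := Pol {relJoinUp}
/-- The functions preserving the constant `0`. -/
def Cons0 : Set Op := Pol {relZero}
/-- The functions preserving the constant `1`. -/
def Cons1 : Set Op := Pol {relOne}
/-- The functions `f` with `f(0, 0, …) = 0` that are continuous at `(0, 0, …)`. -/
def Lim0 : Set Op := Pol {relLimZero}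
/-- The functions `f` with `f(1, 1, …) = 1` that are continuous at `(1, 1, …)`. -/
def Lim1 : Set Op := Pol {relLimOne}

end BorelClone

open BorelClone

/-!
# Borel clones over finitary clones on `{0, 1}`

A Borel clone `F` over a given finitary clone `G` is determined by which discontinuous functions it
contains. The continuous functions depend on finitely many variables, so the continuous part of `F`
is `gen G` (`mem_gen_finPart`).

**Clones with `∧` and `∨`.** A failure of continuity of some `f ∈ F` is witnessed by a convergent
sequence of points at which `f` has the wrong value. Substituting for the variables of `f` suitable
finitary functions, chosen along the sequence, yields an infinitary connective: `⋁` if `f` is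
discontinuous at `0` (with `f(0) = 0`), the weaker `⌈⋁⌉` if the sequence is elsewhere, and dually `⋀`
and `⌊⋀⌋` (`opBigOr_mem_of_Mono`, `ceil_mem_of_Mono`, `opBigOr_mem_of_opIte`,
`ceil_mem_of_opIte`). Conversely, these four connectives generate everything that is not excluded by
their absence. The starting point is that monotone Borel functions are generated by `⋀` and `⋁`
together with the constants (`positive_induction`, by a separation argument for pairs of disjoint
analytic sets), and that Borel functions need `¬` in addition. Both constants are then removed by
sandwiching a function between functions already available
(`mem_of_Mono_levels`, `mem_of_opIte_levels`). Hence the clones over `G` are told apart, and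
included in each other, according to the memberships of `⌈⋁⌉`, `⋁`, `⌊⋀⌋`, `⋀`
(`subset_of_levels`), and the tables list the consistent combinations.

**Self-dual clones.** `{f | β(f) ∈ F}` is a clone (`betaClone`) from which a self-dual clone `F` is
recovered by intersecting with the self-dual functions. This reduces the clones over the self-dual
functions, and over those preserving `0`, to the tables for all functions and for the functions
preserving `0`. For monotone self-dual functions, discontinuity yields `⌈⋁⌉` in the `β`-clone, whence
`β(⋀) ∈ F`. From `β(⋀)` all functions `m(xᵢ, xⱼ, f)` with `f` monotone, self-dual and Borel are
obtained, and by a Baker–Pixley interpolation (`bakerPixley`) those `f` that are continuous at `0`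
(`mem_of_Dual_Mono_Lim0`). A single function in `F` that is discontinuous at `0` then yields the
remaining ones by a limit (`mem_of_Dual_Mono`).

**Uniqueness.** The Borel clones over `G` lie between `gen G` and the clone `maxExt G` of all Borel
functions whose finite minors belong to `G`. If `G` is affine, then so is `maxExt G`, and affine Borel
functions are continuous because a Borel homomorphism has a kernel of positive Haar measure
(`mem_Cont_of_Aff`); so the two clones coincide. Otherwise `gen G` contains `∧`, `∨` or the median
(`opAnd_or_opOr_or_opMedian_mem`), and `maxExt G` contains `⋀`, `⋁` or `β(⋀)`, respectively, none of
which is continuous.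
-/

namespace BorelClone

/-! ### Clones and generation -/

/-- `Has F f` says that the `n`-ary function `f` belongs to the class `F`. -/
abbrev Has (F : Set Op) {n : Arity} (f : n.Fn) : Prop := (⟨n, f⟩ : Op) ∈ F

/-- Clones of functions of all arities `0 < n ≤ ω`. -/
abbrev IsClone (F : Set Op) : Prop := IsCloneOn Set.univ F

instance (n : Arity) : Countable n.Idx := by cases n <;> dsimp only [Arity.Idx] <;> infer_instance

/-- A distinguished index of each arity. -/
def Arity.zero : (n : Arity) → n.Idx
  | .fin _ => (0 : Fin _)
  | .omega => (0 : ℕ)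

instance (n : Arity) : Nonempty n.Idx := ⟨n.zero⟩

variable {F F' : Set Op} {n m : Arity}

namespace IsCloneOn

theorem proj (hF : IsClone F) (i : n.Idx) : Has F (fun x : n.Idx → Bool => x i) :=
  hF.proj_mem n trivial i

theorem comp (hF : IsClone F) {g : n.Fn} {f : n.Idx → m.Fn} (hg : Has F g)
    (hf : ∀ i, Has F (f i)) : Has F (fun x => g (fun i => f i x)) :=
  hF.comp_mem m trivial n trivial g f hg hf

theorem comp₁ (hF : IsClone F) {g : (Arity.fin 0).Fn} (hg : Has F g) {a : m.Fn}
    (ha : Has F a) : Has F (fun x => g ![a x]) := by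
  have h := hF.comp (f := fun _ => a) hg (fun _ => ha)
  have e : (fun x => g (fun _ => a x)) = fun x => g ![a x] := by
    funext x
    congr 1
    funext i
    have : i = 0 := Subsingleton.elim (α := Fin 1) _ _
    subst this
    rfl
  rwa [e] at h

theorem comp₂ (hF : IsClone F) {g : (Arity.fin 1).Fn} (hg : Has F g) {a b : m.Fn}
    (ha : Has F a) (hb : Has F b) : Has F (fun x => g ![a x, b x]) := by
  have h := hF.comp (f := (![a, b] : Fin 2 → m.Fn)) hg
    (Fin.forall_fin_two.2 ⟨ha, hb⟩)
  have e : (fun x => g (fun i => (![a, b] : Fin 2 → m.Fn) i x)) = fun x => g ![a x, b x] := by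
    funext x
    congr 1
    funext i
    revert i
    exact Fin.forall_fin_two.2 ⟨rfl, rfl⟩
  rwa [e] at h

theorem comp₃ (hF : IsClone F) {g : (Arity.fin 2).Fn} (hg : Has F g) {a b c : m.Fn}
    (ha : Has F a) (hb : Has F b) (hc : Has F c) : Has F (fun x => g ![a x, b x, c x]) := by
  have h := hF.comp (f := (![a, b, c] : Fin 3 → m.Fn)) hg
    (by
      intro i
      revert i
      exact Fin.forall_fin_succ.2 ⟨ha, Fin.forall_fin_two.2 ⟨hb, hc⟩⟩)
  have e : (fun x => g (fun i => (![a, b, c] : Fin 3 → m.Fn) i x)) =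
      fun x => g ![a x, b x, c x] := by
    funext x
    congr 1
    funext i
    revert i
    exact Fin.forall_fin_succ.2 ⟨rfl, Fin.forall_fin_two.2 ⟨rfl, rfl⟩⟩
  rwa [e] at h

theorem not (hF : IsClone F) (h : opNot ∈ F) {a : m.Fn} (ha : Has F a) :
    Has F (fun x => !a x) := hF.comp₁ h ha

theorem and (hF : IsClone F) (h : opAnd ∈ F) {a b : m.Fn} (ha : Has F a) (hb : Has F b) :
    Has F (fun x => a x && b x) := hF.comp₂ h ha hb

theorem or (hF : IsClone F) (h : opOr ∈ F) {a b : m.Fn} (ha : Has F a) (hb : Has F b) :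
    Has F (fun x => a x || b x) := hF.comp₂ h ha hb

theorem nimp (hF : IsClone F) (h : opNimp ∈ F) {a b : m.Fn} (ha : Has F a) (hb : Has F b) :
    Has F (fun x => a x && !b x) := hF.comp₂ h ha hb

theorem imp (hF : IsClone F) (h : opImp ∈ F) {a b : m.Fn} (ha : Has F a) (hb : Has F b) :
    Has F (fun x => !a x || b x) := hF.comp₂ h ha hb

theorem ite (hF : IsClone F) (h : opIte ∈ F) {a b c : m.Fn} (ha : Has F a) (hb : Has F b)
    (hc : Has F c) : Has F (fun x => (a x && b x) || (!a x && c x)) := hF.comp₃ h ha hb hc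

theorem median (hF : IsClone F) (h : opMedian ∈ F) {a b c : m.Fn} (ha : Has F a)
    (hb : Has F b) (hc : Has F c) :
    Has F (fun x => (a x && b x) || (a x && c x) || (b x && c x)) := hF.comp₃ h ha hb hc

theorem xor3 (hF : IsClone F) (h : opXor3 ∈ F) {a b c : m.Fn} (ha : Has F a)
    (hb : Has F b) (hc : Has F c) :
    Has F (fun x => ((a x).xor (b x)).xor (c x)) := hF.comp₃ h ha hb hc

theorem zero (hF : IsClone F) (h : opZero ∈ F) : Has F (fun _ : m.Idx → Bool => false) :=
  hF.comp₁ h (hF.proj m.zero)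

theorem one (hF : IsClone F) (h : opOne ∈ F) : Has F (fun _ : m.Idx → Bool => true) :=
  hF.comp₁ h (hF.proj m.zero)

open Classical in
theorem bigOr (hF : IsClone F) (h : opBigOr ∈ F) {a : ℕ → m.Fn} (ha : ∀ i, Has F (a i)) :
    Has F (fun x => decide (∃ i, a i x = true)) := hF.comp (f := a) h ha

open Classical in
theorem bigAnd (hF : IsClone F) (h : opBigAnd ∈ F) {a : ℕ → m.Fn} (ha : ∀ i, Has F (a i)) :
    Has F (fun x => decide (∀ i, a i x = true)) := hF.comp (f := a) h ha

/-- Composition with a function of arity `1 + n`, whose first argument is treated apart. -/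
theorem comp_oneAdd (hF : IsClone F) {g : n.oneAdd.Fn} (hg : Has F g) {a : m.Fn}
    {f : n.Idx → m.Fn} (ha : Has F a) (hf : ∀ i, Has F (f i)) {h : m.Fn}
    (hh : ∀ x (z : n.oneAdd.Idx → Bool), z n.first = a x → (∀ i, z (n.next i) = f i x) →
      g z = h x) : Has F h := by
  cases n with
  | fin k =>
    have := hF.comp (f := (Fin.cons a f : Fin (k + 2) → m.Fn)) hg
      (Fin.cases ha hf)
    convert! this using 1
    funext x
    exact (hh x _ rfl fun i => rfl).symm
  | omega =>
    have := hF.comp (f := (fun i : ℕ => Nat.casesOn i a f : ℕ → m.Fn)) hg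
      (by
        intro i
        change Has F ((Nat.casesOn i a f : m.Fn))
        cases i
        · exact ha
        · exact hf _)
    convert! this using 1
    funext x
    exact (hh x _ rfl fun i => rfl).symm

open Classical in
theorem ceilBigOr (hF : IsClone F) (h : ceilOp opBigOr ∈ F) {a : m.Fn} {b : ℕ → m.Fn}
    (ha : Has F a) (hb : ∀ i, Has F (b i)) :
    Has F (fun x => a x && decide (∃ i, b i x = true)) := by
  refine hF.comp_oneAdd (n := .omega) h ha hb ?_
  intro x z h0 h1
  change ((z (Arity.first .omega) && decide (∃ i, z (Arity.next .omega i) = true)) = _)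
  simp only [h0, h1]

open Classical in
theorem floorBigAnd (hF : IsClone F) (h : floorOp opBigAnd ∈ F) {a : m.Fn} {b : ℕ → m.Fn}
    (ha : Has F a) (hb : ∀ i, Has F (b i)) :
    Has F (fun x => a x || decide (∀ i, b i x = true)) := by
  refine hF.comp_oneAdd (n := .omega) h ha hb ?_
  intro x z h0 h1
  change ((z (Arity.first .omega) || decide (∀ i, z (Arity.next .omega i) = true)) = _)
  simp only [h0, h1]

theorem beta (hF : IsClone F) {g : n.Fn} (h : beta ⟨n, g⟩ ∈ F) {a : m.Fn} {b : n.Idx → m.Fn}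
    (ha : Has F a) (hb : ∀ i, Has F (b i)) :
    Has F (fun x => bif a x then !g (fun i => !b i x) else g (fun i => b i x)) := by
  refine hF.comp_oneAdd h ha hb ?_
  intro x z h0 h1
  change ((bif z n.first then !g (fun i => !z (n.next i)) else g (fun i => z (n.next i))) = _)
  simp only [h0, h1]

theorem inter {N : Set Arity} (h : IsCloneOn N F) (h' : IsCloneOn N F') :
    IsCloneOn N (F ∩ F') where
  arity_mem f hf := h.arity_mem f hf.1
  proj_mem n hn i := ⟨h.proj_mem n hn i, h'.proj_mem n hn i⟩
  comp_mem m hm n hn g f hg hf :=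
    ⟨h.comp_mem m hm n hn g f hg.1 fun i => (hf i).1,
      h'.comp_mem m hm n hn g f hg.2 fun i => (hf i).2⟩

end IsCloneOn

theorem isClone_Pol (M : Set Rel) : IsClone (Pol M) where
  arity_mem _ _ := trivial
  proj_mem _ _ i _ _ _ h := h i
  comp_mem _ _ _ _ _ _ hg hf R hR x hx := hg R hR _ fun j => hf j R hR x hx

theorem isClone_All : IsClone All := ⟨fun _ _ => trivial, fun _ _ _ => trivial,
  fun _ _ _ _ _ _ _ _ => trivial⟩

theorem isClone_borelOps : IsClone borelOps where
  arity_mem _ _ := trivial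
  proj_mem n _ i := by
    change Measurable fun x : n.Idx → Bool => x i
    exact measurable_pi_apply i
  comp_mem m _ n _ g f hg hf := by
    change Measurable fun x : m.Idx → Bool => g fun i => f i x
    have hg : Measurable g := hg
    have hf : ∀ i, Measurable (f i) := hf
    exact hg.comp (measurable_pi_lambda _ hf)

theorem isClone_gen (S : Set Op) : IsClone (gen S) where
  arity_mem _ _ := trivial
  proj_mem n hn i _ hG := hG.1.proj_mem n hn i
  comp_mem m hm n hn g f hg hf G hG :=
    hG.1.comp_mem m hm n hn g f (hg G hG) fun i => hf i G hG

theorem subset_gen (S : Set Op) : S ⊆ gen S := fun _ hf _ h => h.2 hf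

theorem gen_subset {S : Set Op} (hF : IsClone F) (h : S ⊆ F) : gen S ⊆ F :=
  Set.sInter_subset_of_mem ⟨hF, h⟩

theorem mem_borelOps_of_fin {k : ℕ} (f : (Arity.fin k).Fn) : Has borelOps f :=
  measurable_of_finite (α := Fin (k + 1) → Bool) f

theorem finPart_subset_borelOps : finPart F ⊆ borelOps := by
  rintro ⟨n, f⟩ ⟨-, k, rfl⟩
  exact mem_borelOps_of_fin f

/-! ### Interpolation in the presence of a median -/

/-- The Baker–Pixley argument: in a clone with a median, a function belongs to the clone as soon as
finitely many of its members agree with the function at every pair of points. -/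
theorem bakerPixley (hF : IsClone F) (hm : opMedian ∈ F) {ι : Type*} [Finite ι] {f : n.Fn}
    {g : ι → n.Fn} (hg : ∀ i, Has F (g i)) (h : ∀ x y, ∃ i, g i x = f x ∧ g i y = f y) :
    Has F f := by
  classical
  have key : ∀ (c : ℕ) (S : Finset (n.Idx → Bool)), S.card = c → ∃ p : n.Fn, Has F p ∧
      (∀ x y, (∀ i, g i x = g i y) → p x = p y) ∧ ∀ x ∈ S, p x = f x := by
    intro c
    induction c using Nat.strong_induction_on with
    | _ c ih =>
    intro S hS
    by_cases hc : 2 < S.card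
    · obtain ⟨a, ha, b, hb, d, hd, hab, had, hbd⟩ := Finset.two_lt_card.1 hc
      have he : ∀ e ∈ S, ∃ p : n.Fn, Has F p ∧ (∀ x y, (∀ i, g i x = g i y) → p x = p y) ∧
          ∀ x ∈ S.erase e, p x = f x := fun e he =>
        ih _ (hS ▸ Finset.card_erase_lt_of_mem he) _ rfl
      obtain ⟨p, hp, hp', hpa⟩ := he a ha
      obtain ⟨q, hq, hq', hqb⟩ := he b hb
      obtain ⟨r, hr, hr', hrd⟩ := he d hd
      refine ⟨_, hF.median hm hp hq hr, fun x y hxy => ?_, fun x hx => ?_⟩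
      · simp only [hp' x y hxy, hq' x y hxy, hr' x y hxy]
      · have h1 : x ≠ a → p x = f x := fun h => hpa x (Finset.mem_erase.2 ⟨h, hx⟩)
        have h2 : x ≠ b → q x = f x := fun h => hqb x (Finset.mem_erase.2 ⟨h, hx⟩)
        have h3 : x ≠ d → r x = f x := fun h => hrd x (Finset.mem_erase.2 ⟨h, hx⟩)
        by_cases hxa : x = a
        · subst hxa
          rw [h2 hab, h3 had]
          cases p x <;> cases f x <;> rfl
        · rw [h1 hxa]
          by_cases hxb : x = b
          · subst hxb
            rw [h3 hbd]
            cases q x <;> cases f x <;> rfl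
          · rw [h2 hxb]
            cases r x <;> cases f x <;> rfl
    · have : ∃ a b, ∀ x ∈ S, x = a ∨ x = b := by
        have : S.card = 0 ∨ S.card = 1 ∨ S.card = 2 := by omega
        rcases this with h | h | h
        · rw [Finset.card_eq_zero] at h
          subst h
          exact ⟨fun _ => false, fun _ => false, by simp⟩
        · obtain ⟨a, rfl⟩ := Finset.card_eq_one.1 h
          exact ⟨a, a, by simp⟩
        · obtain ⟨a, b, -, rfl⟩ := Finset.card_eq_two.1 h
          exact ⟨a, b, by simp⟩
      obtain ⟨a, b, hab⟩ := this
      obtain ⟨i, hia, hib⟩ := h a b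
      refine ⟨g i, hg i, fun x y hxy => hxy i, fun x hx => ?_⟩
      rcases hab x hx with rfl | rfl
      exacts [hia, hib]
  let T : (n.Idx → Bool) → ι → Bool := fun x i => g i x
  have hfin : (Set.range T).Finite := Set.toFinite _
  choose s hs using fun t : Set.range T => t.2
  have : Fintype (Set.range T) := hfin.fintype
  obtain ⟨p, hp, hp', hpf⟩ := key _ (Finset.univ.image s) rfl
  have hf : ∀ x y, T x = T y → f x = f y := by
    intro x y hxy
    obtain ⟨i, hx, hy⟩ := h x y
    rw [← hx, ← hy]
    exact congrFun hxy i
  have e : f = p := by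
    funext x
    have h1 := hs ⟨T x, x, rfl⟩
    rw [hf x _ h1.symm, hp' x _ fun i => (congrFun h1 i).symm]
    exact (hpf _ (Finset.mem_image_of_mem _ (Finset.mem_univ _))).symm
  rw [e]
  exact hp

/-- In a clone with a median, finitary functions can be interpolated at pairs of points. -/
theorem mem_of_interpolation (hF : IsClone F) (hm : opMedian ∈ F) {k : ℕ} {f : (Arity.fin k).Fn}
    (h : ∀ x y, ∃ g : (Arity.fin k).Fn, Has F g ∧ g x = f x ∧ g y = f y) : Has F f :=
  have : Finite (Arity.fin k).Fn := inferInstanceAs (Finite ((Fin (k + 1) → Bool) → Bool))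
  bakerPixley hF hm (ι := {g : (Arity.fin k).Fn // Has F g}) (g := fun g => g.1) (fun g => g.2)
    fun x y => let ⟨g, hg, h⟩ := h x y; ⟨⟨g, hg⟩, h⟩


/-! ### The named clones, pointwise -/

/-- The continuous functions, in the guise of the polymorphisms of `lim`. -/
def Cont : Set Op := Pol {relLim}

theorem mem_Pol_singleton {R : Rel} {f : Op} : f ∈ Pol {R} ↔ Preserves f R :=
  ⟨fun h => h R rfl, fun h _ hR => hR ▸ h⟩

theorem has_Pol_singleton {R : Rel} {f : n.Fn} : Has (Pol {R}) f ↔ Preserves ⟨n, f⟩ R :=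
  mem_Pol_singleton

theorem tendsto_bool {u : ℕ → Bool} {b : Bool} :
    Tendsto u atTop (𝓝 b) ↔ ∃ N, ∀ k, N ≤ k → u k = b := by
  rw [nhds_discrete, tendsto_pure, eventually_atTop]

theorem isLUB_bool {u : ℕ → Bool} {b : Bool} :
    IsLUB (Set.range u) b ↔ (b = true ↔ ∃ k, u k = true) := by
  simp only [IsLUB, IsLeast, mem_upperBounds, mem_lowerBounds, Set.forall_mem_range,
    Bool.le_iff_imp]
  constructor
  · rintro ⟨h1, h2⟩
    refine ⟨fun hb => ?_, fun ⟨k, hk⟩ => h1 k hk⟩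
    by_contra! hc
    simpa using h2 false (fun k hk => absurd hk (hc k)) hb
  · intro h
    exact ⟨fun k hk => h.2 ⟨k, hk⟩, fun c hc hb => (h.1 hb).elim hc⟩

theorem isGLB_bool {u : ℕ → Bool} {b : Bool} :
    IsGLB (Set.range u) b ↔ (b = false ↔ ∃ k, u k = false) := by
  simp only [IsGLB, IsGreatest, mem_upperBounds, mem_lowerBounds, Set.forall_mem_range,
    Bool.le_iff_imp]
  constructor
  · rintro ⟨h1, h2⟩
    constructor
    · rintro rfl
      by_contra! hc
      simpa using h2 true fun k _ => by simpa using hc k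
    · rintro ⟨k, hk⟩
      by_contra hb
      simp [h1 k (by simpa using hb)] at hk
  · intro h
    refine ⟨fun k hb => ?_, fun c hc hc' => ?_⟩
    · by_contra hk
      simp [h.2 ⟨k, by simpa using hk⟩] at hb
    · by_contra hb
      obtain ⟨k, hk⟩ := h.1 (by simpa using hb)
      simp [hc k hc'] at hk

/-- An increasing exhaustion of an arity by finite sets. -/
theorem exists_exhaustion (n : Arity) :
    ∃ s : ℕ → Finset n.Idx, Monotone s ∧ ∀ i, ∃ k, i ∈ s k := by
  obtain ⟨e, he⟩ := exists_injective_nat n.Idx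
  refine ⟨fun k => ((Set.finite_lt_nat k).preimage he.injOn).toFinset, fun k l hkl i hi => ?_,
    fun i => ⟨e i + 1, ?_⟩⟩
  · simp only [Set.Finite.mem_toFinset, Set.mem_preimage, Set.mem_ofPred_eq] at hi ⊢
    omega
  · simp

theorem has_Mono {f : n.Fn} : Has Mono f ↔ Monotone f := by
  rw [Mono, has_Pol_singleton]
  constructor
  · intro h x y hxy
    exact h (![x, y] : Fin 2 → n.Idx → Bool) fun j => hxy j
  · intro h x hx
    exact h (fun j => hx j : x (0 : Fin 2) ≤ x (1 : Fin 2))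

theorem has_Cons0 {f : n.Fn} : Has Cons0 f ↔ f (fun _ => false) = false := by
  rw [Cons0, has_Pol_singleton]
  constructor
  · intro h
    exact h (fun _ _ => false) fun j => rfl
  · intro h x hx
    have : x (0 : Fin 1) = fun _ => false := funext hx
    change f (x (0 : Fin 1)) = false
    rw [this, h]

theorem has_Cons1 {f : n.Fn} : Has Cons1 f ↔ f (fun _ => true) = true := by
  rw [Cons1, has_Pol_singleton]
  constructor
  · intro h
    exact h (fun _ _ => true) fun j => rfl
  · intro h x hx
    have : x (0 : Fin 1) = fun _ => true := funext hx
    change f (x (0 : Fin 1)) = true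
    rw [this, h]

theorem has_Dual {f : n.Fn} : Has Dual f ↔ ∀ x, f (fun i => !x i) = !f x := by
  rw [Dual, has_Pol_singleton]
  constructor
  · intro h x
    exact h (![fun i => !x i, x] : Fin 2 → n.Idx → Bool) fun j => rfl
  · intro h x hx
    have : x (0 : Fin 2) = fun i => !x (1 : Fin 2) i := funext hx
    change f (x (0 : Fin 2)) = !f (x (1 : Fin 2))
    rw [this, h]

theorem has_Aff {f : n.Fn} : Has Aff f ↔
    ∀ x y z, f (fun i => ((x i).xor (y i)).xor (z i)) = ((f x).xor (f y)).xor (f z) := by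
  rw [Aff, has_Pol_singleton]
  constructor
  · intro h x y z
    exact h (![fun i => ((x i).xor (y i)).xor (z i), x, y, z] : Fin 4 → n.Idx → Bool) fun j => rfl
  · intro h x hx
    have : x (0 : Fin 4) = fun i => ((x (1 : Fin 4) i).xor (x (2 : Fin 4) i)).xor
      (x (3 : Fin 4) i) := funext hx
    change f (x (0 : Fin 4)) = ((f (x (1 : Fin 4))).xor (f (x (2 : Fin 4)))).xor (f (x (3 : Fin 4)))
    rw [this, h]

theorem preserves_lim_eq {f : n.Fn} {b : Bool} :
    Preserves ⟨n, f⟩ ⟨.omega, {v : ℕ → Bool | Tendsto v atTop (𝓝 b)}⟩ ↔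
      ∃ s : Finset n.Idx, ∀ y, (∀ i ∈ s, y i = b) → f y = b := by
  constructor
  · intro h
    by_contra! hc
    choose y hy hfy using hc
    obtain ⟨s, hs, hs'⟩ := exists_exhaustion n
    obtain ⟨N, hN⟩ := tendsto_bool.1 (h (fun k => y (s k)) fun i => tendsto_bool.2 <| by
      obtain ⟨k, hk⟩ := hs' i
      exact ⟨k, fun l hl => hy _ _ (hs hl hk)⟩)
    exact hfy _ (hN N le_rfl)
  · rintro ⟨s, hs⟩ x hx
    have hx : ∀ j, Tendsto (fun k => x k j) atTop (𝓝 b) := hx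
    simp only [nhds_discrete, tendsto_pure] at hx
    have : ∀ᶠ k in atTop, ∀ i ∈ s, x k i = b := (eventually_all_finset s).2 fun i _ => hx i
    change Tendsto (fun k => f (x k)) atTop (𝓝 b)
    rw [nhds_discrete, tendsto_pure]
    exact this.mono fun k hk => hs _ hk

theorem has_Lim0 {f : n.Fn} :
    Has Lim0 f ↔ ∃ s : Finset n.Idx, ∀ y, (∀ i ∈ s, y i = false) → f y = false := by
  rw [Lim0, has_Pol_singleton]
  exact preserves_lim_eq

theorem has_Lim1 {f : n.Fn} :
    Has Lim1 f ↔ ∃ s : Finset n.Idx, ∀ y, (∀ i ∈ s, y i = true) → f y = true := by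
  rw [Lim1, has_Pol_singleton]
  exact preserves_lim_eq

theorem has_Cont_iff_continuous {f : n.Fn} : Has Cont f ↔ Continuous f := by
  rw [Cont, has_Pol_singleton]
  constructor
  · intro h
    rw [continuous_iff_seqContinuous]
    intro u x hu
    exact h (fun k : ℕ => Nat.casesOn (motive := fun _ => n.Idx → Bool) k x u) fun j =>
      (tendsto_pi_nhds.1 hu j :)
  · intro h x hx
    have : Tendsto (fun k : ℕ => x (k + 1 : ℕ)) atTop (𝓝 (x (0 : ℕ))) := tendsto_pi_nhds.2 hx
    exact (h.tendsto _).comp this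

theorem exists_finset_of_mem_nhds {x : n.Idx → Bool} {U : Set (n.Idx → Bool)} (h : U ∈ 𝓝 x) :
    ∃ s : Finset n.Idx, ∀ y, (∀ i ∈ s, y i = x i) → y ∈ U := by
  rw [nhds_pi, Filter.mem_pi] at h
  obtain ⟨I, hI, t, ht, hsub⟩ := h
  refine ⟨hI.toFinset, fun y hy => hsub fun i hi => ?_⟩
  rw [hy i (hI.mem_toFinset.2 hi)]
  exact mem_of_mem_nhds (ht i)

theorem has_Cont_of_forall {f : n.Fn}
    (h : ∀ x, ∃ s : Finset n.Idx, ∀ y, (∀ i ∈ s, y i = x i) → f y = f x) : Has Cont f := by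
  refine has_Cont_iff_continuous.2 (continuous_iff_continuousAt.2 fun x => ?_)
  obtain ⟨s, hs⟩ := h x
  refine (continuousAt_const (y := f x)).congr ?_
  have : ∀ᶠ y in 𝓝 x, ∀ i ∈ s, y i = x i := (eventually_all_finset s).2 fun i _ => by
    have := (continuous_apply (A := fun _ : n.Idx => Bool) i).continuousAt (x := x)
    simpa [ContinuousAt, nhds_discrete] using this
  exact this.mono fun y hy => (hs _ hy).symm

/-- By compactness, continuous functions depend on finitely many coordinates. -/
theorem has_Cont {f : n.Fn} :
    Has Cont f ↔ ∃ s : Finset n.Idx, ∀ x y, (∀ i ∈ s, x i = y i) → f x = f y := by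
  classical
  constructor
  · intro h
    rw [has_Cont_iff_continuous] at h
    have h1 : ∀ x, ∃ s : Finset n.Idx, ∀ y, (∀ i ∈ s, y i = x i) → f y = f x := fun x =>
      exists_finset_of_mem_nhds (U := f ⁻¹' {f x}) (h.continuousAt (by simp [nhds_discrete]))
    choose s hs using h1
    obtain ⟨t, -, ht⟩ := isCompact_univ.elim_nhds_subcover
      (fun x : n.Idx → Bool => {y | ∀ i ∈ s x, y i = x i}) fun x _ => by
        refine IsOpen.mem_nhds ?_ fun _ _ => rfl
        have : {y : n.Idx → Bool | ∀ i ∈ s x, y i = x i} =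
            (s x : Set n.Idx).pi fun i => {x i} := by
          ext y
          simp
        rw [this]
        exact isOpen_set_pi (s x).finite_toSet fun i _ => isOpen_discrete _
    refine ⟨t.biUnion s, fun x y hxy => ?_⟩
    obtain ⟨a, hat, hxa⟩ := Set.mem_iUnion₂.1 (ht (Set.mem_univ x))
    rw [hs a x hxa, hs a y]
    intro i hi
    rw [← hxy i (Finset.mem_biUnion.2 ⟨a, hat, hi⟩)]
    exact hxa i hi
  · rintro ⟨s, hs⟩
    exact has_Cont_of_forall fun x => ⟨s, fun y hy => hs y x hy⟩

theorem Incr_subset_Mono : Incr ⊆ Mono := by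
  rintro ⟨n, f⟩ h
  rw [Incr, mem_Pol_singleton] at h
  refine has_Mono.2 fun x y hxy => ?_
  have := h (fun k : ℕ => if k = 1 then x else y) fun j => by
    refine ⟨monotone_nat_of_le_succ fun k => ?_, isLUB_bool.2 ⟨fun hj => ⟨1, by simpa using hj⟩, ?_⟩⟩
    · rcases k with _ | k
      · simpa using hxy j
      · simp
    · rintro ⟨k, hk⟩
      rcases k with _ | k
      · simp only [zero_add, ite_true] at hk
        exact Bool.le_iff_imp.1 (hxy j) hk
      · simpa using hk
  simpa using this.2.1 ⟨0, rfl⟩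

theorem has_Incr {f : n.Fn} : Has Incr f ↔ ∀ x, f x = true →
    ∃ s : Finset n.Idx, (∀ i ∈ s, x i = true) ∧ ∀ y, (∀ i ∈ s, y i = true) → f y = true := by
  classical
  constructor
  · intro h x hx
    have hm := has_Mono.1 (Incr_subset_Mono h)
    rw [Incr, has_Pol_singleton] at h
    obtain ⟨s, hs, hs'⟩ := exists_exhaustion n
    have := h (fun k : ℕ => k.casesOn x fun k => fun i => x i && decide (i ∈ s k)) fun j => by
      refine ⟨fun k l hkl => ?_, isLUB_bool.2 ⟨fun hj => ?_, ?_⟩⟩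
      · change (x j && decide (j ∈ s k)) ≤ (x j && decide (j ∈ s l))
        rw [Bool.le_iff_imp]
        have := @hs _ _ hkl j
        simp only [Bool.and_eq_true, decide_eq_true_eq]
        exact fun h => ⟨h.1, this h.2⟩
      · obtain ⟨k, hk⟩ := hs' j
        exact ⟨k, by simpa [hk] using hj⟩
      · rintro ⟨k, hk⟩
        simp only [Bool.and_eq_true, decide_eq_true_eq] at hk
        exact hk.1
    obtain ⟨k, hk⟩ := (isLUB_bool.1 this.2).1 hx
    refine ⟨(s k).filter fun i => x i = true, by simp, fun y hy => ?_⟩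
    have hle : (fun i => x i && decide (i ∈ s k)) ≤ y := by
      intro i
      rw [Bool.le_iff_imp]
      simp only [Bool.and_eq_true, decide_eq_true_eq]
      exact fun h => hy i (by simp [h])
    have := hm hle
    change f (fun i => x i && decide (i ∈ s k)) = true at hk
    rw [Bool.le_iff_imp] at this
    exact this hk
  · intro h
    have hm : ∀ x y : n.Idx → Bool, (∀ i, x i = true → y i = true) → f x = true → f y = true := by
      intro x y hxy hx
      obtain ⟨s, hs, hs'⟩ := h x hx
      exact hs' y fun i hi => hxy i (hs i hi)
    rw [Incr, has_Pol_singleton]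
    intro x hx
    have hx1 : ∀ j (k l : ℕ), k ≤ l → x (k + 1 : ℕ) j = true → x (l + 1 : ℕ) j = true :=
      fun j k l hkl => Bool.le_iff_imp.1 ((hx j).1 hkl)
    have hx2 : ∀ j, x (0 : ℕ) j = true ↔ ∃ k : ℕ, x (k + 1 : ℕ) j = true :=
      fun j => isLUB_bool.1 (hx j).2
    refine ⟨fun k l hkl => Bool.le_iff_imp.2 (hm _ _ fun j => hx1 j k l hkl),
      isLUB_bool.2 ⟨fun h0 => ?_, fun ⟨k, hk⟩ => hm _ _ (fun j hj => (hx2 j).2 ⟨k, hj⟩) hk⟩⟩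
    obtain ⟨s, hs, hs'⟩ := h _ h0
    have : ∀ i, ∃ k : ℕ, i ∈ s → x (k + 1 : ℕ) i = true := by
      intro i
      by_cases hi : i ∈ s
      · obtain ⟨k, hk⟩ := (hx2 i).1 (hs i hi)
        exact ⟨k, fun _ => hk⟩
      · exact ⟨0, fun h => absurd h hi⟩
    choose k hk using this
    exact ⟨s.sup k, hs' _ fun i hi => hx1 i _ _ (Finset.le_sup hi) (hk i hi)⟩

/-! ### Duality -/

/-- The class of the de Morgan duals of the members of a class. -/
def dualSet (F : Set Op) : Set Op := {f | deMorgan f ∈ F}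

theorem deMorgan_deMorgan (f : Op) : deMorgan (deMorgan f) = f := by
  simp [deMorgan]

theorem has_dualSet {f : n.Fn} :
    Has (dualSet F) f ↔ Has F (fun x : n.Idx → Bool => !f fun i => !x i) := Iff.rfl

theorem mem_dualSet {f : Op} : f ∈ dualSet F ↔ deMorgan f ∈ F := Iff.rfl

theorem IsCloneOn.dualSet (hF : IsClone F) : IsClone (dualSet F) where
  arity_mem _ _ := trivial
  proj_mem n _ i := by
    refine has_dualSet.2 ?_
    simpa using hF.proj i
  comp_mem m _ n _ g f hg hf := by
    have := hF.comp (has_dualSet.1 hg) fun i => has_dualSet.1 (hf i)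
    refine has_dualSet.2 ?_
    simpa using this

theorem deMorgan_opAnd : deMorgan opAnd = opOr := by
  simp [deMorgan, opAnd, opOr]
theorem deMorgan_opOr : deMorgan opOr = opAnd := by
  simp [deMorgan, opAnd, opOr]
open Classical in
theorem deMorgan_opBigAnd : deMorgan opBigAnd = opBigOr := by
  rw [deMorgan, opBigAnd, opBigOr]
  congr 1
  funext (x : ℕ → Bool)
  change (!decide (∀ i : ℕ, (!x i) = true)) = decide (∃ i : ℕ, x i = true)
  rw [Bool.eq_iff_iff]
  simp
theorem deMorgan_opBigOr : deMorgan opBigOr = opBigAnd := by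
  rw [← deMorgan_opBigAnd, deMorgan_deMorgan]
theorem deMorgan_opZero : deMorgan opZero = opOne := by
  simp [deMorgan, opZero, opOne]
theorem deMorgan_opOne : deMorgan opOne = opZero := by
  simp [deMorgan, opZero, opOne]
theorem deMorgan_ceil_opBigOr : deMorgan (ceilOp opBigOr) = floorOp opBigAnd := by
  rw [← deMorgan_opBigOr]
  simp [deMorgan, ceilOp, floorOp]
theorem deMorgan_floor_opBigAnd : deMorgan (floorOp opBigAnd) = ceilOp opBigOr := by
  rw [← deMorgan_ceil_opBigOr, deMorgan_deMorgan]

theorem deMorgan_mem_Mono {f : Op} : deMorgan f ∈ Mono ↔ f ∈ Mono := by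
  have key : ∀ f : Op, f ∈ Mono → deMorgan f ∈ Mono := by
    rintro ⟨n, f⟩ h
    refine has_Mono.2 fun x y hxy => ?_
    have := has_Mono.1 h (fun i => by
      have := hxy i
      cases hx : x i <;> cases hy : y i <;> simp_all : (fun i => !y i) ≤ fun i => !x i)
    cases h1 : f (fun i => !x i) <;> cases h2 : f (fun i => !y i) <;> simp_all
  exact ⟨fun h => deMorgan_deMorgan f ▸ key _ h, key f⟩

theorem deMorgan_mem_borelOps {f : Op} : deMorgan f ∈ borelOps ↔ f ∈ borelOps := by
  have key : ∀ f : Op, f ∈ borelOps → deMorgan f ∈ borelOps := by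
    rintro ⟨n, f⟩ h
    have h : Measurable f := h
    change Measurable fun x : n.Idx → Bool => !f fun i => !x i
    have h1 : Measurable (fun b : Bool => !b) := measurable_of_finite _
    exact h1.comp (h.comp (measurable_pi_lambda _ fun i => h1.comp (measurable_pi_apply i)))
  exact ⟨fun h => deMorgan_deMorgan f ▸ key _ h, key f⟩

theorem deMorgan_mem_Lim0 {f : Op} : deMorgan f ∈ Lim0 ↔ f ∈ Lim1 := by
  obtain ⟨n, f⟩ := f
  refine has_Lim0.trans (Iff.trans ?_ has_Lim1.symm)
  refine exists_congr fun s => ⟨fun h y hy => ?_, fun h y hy => ?_⟩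
  · simpa using h (fun i => !y i) (by simpa using hy)
  · simpa using h (fun i => !y i) (by simpa using hy)

theorem deMorgan_mem_Lim1 {f : Op} : deMorgan f ∈ Lim1 ↔ f ∈ Lim0 := by
  rw [← deMorgan_mem_Lim0, deMorgan_deMorgan]

theorem deMorgan_mem_Cons0 {f : Op} : deMorgan f ∈ Cons0 ↔ f ∈ Cons1 := by
  obtain ⟨n, f⟩ := f
  refine has_Cons0.trans (Iff.trans ?_ has_Cons1.symm)
  simp

theorem deMorgan_mem_Cons1 {f : Op} : deMorgan f ∈ Cons1 ↔ f ∈ Cons0 := by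
  rw [← deMorgan_mem_Cons0, deMorgan_deMorgan]

theorem deMorgan_mem_Cont {f : Op} : deMorgan f ∈ Cont ↔ f ∈ Cont := by
  have key : ∀ f : Op, f ∈ Cont → deMorgan f ∈ Cont := by
    rintro ⟨n, f⟩ h
    obtain ⟨s, hs⟩ := has_Cont.1 h
    refine has_Cont.2 ⟨s, fun x y hxy => ?_⟩
    simpa [deMorgan] using hs (fun i => !x i) (fun i => !y i) (by simpa using hxy)
  exact ⟨fun h => deMorgan_deMorgan f ▸ key _ h, key f⟩

theorem deMorgan_mem_Decr {f : Op} : deMorgan f ∈ Decr ↔ f ∈ Incr := by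
  have e : ∀ u : ℕ → Bool, Antitone (fun i => !u i) ↔ Monotone u := fun u => by
    constructor
    · intro h k l hkl
      have := h hkl
      revert this
      cases h1 : u k <;> cases h2 : u l <;> simp [h1, h2]
    · intro h k l hkl
      have := h hkl
      revert this
      cases h1 : u k <;> cases h2 : u l <;> simp [h1, h2]
  obtain ⟨n, f⟩ := f
  have key : ∀ v : ℕ → Bool, (fun i => !v i) ∈ relMeetDown.2 ↔ v ∈ relJoinUp.2 := fun v => by
    change (Antitone (fun i => !v (i + 1)) ∧ IsGLB (Set.range fun i => !v (i + 1)) (!v 0)) ↔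
      Monotone (fun i => v (i + 1)) ∧ IsLUB (Set.range fun i => v (i + 1)) (v 0)
    rw [e, isGLB_bool, isLUB_bool]
    simp
  rw [Decr, Incr, mem_Pol_singleton, mem_Pol_singleton]
  constructor
  · intro h x hx
    have := h (fun k i => !x k i) fun j => (key _).2 (hx j)
    refine (key fun k => f (x k)).1 ?_
    simp only [deMorgan, Bool.not_not] at this
    exact this
  · intro h x hx
    have := h (fun k i => !x k i) fun j => (key _).1 (by
      simp only [Bool.not_not]
      exact hx j)
    exact (key fun k => f fun i => !x k i).2 this

theorem deMorgan_mem_Incr {f : Op} : deMorgan f ∈ Incr ↔ f ∈ Decr := by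
  rw [← deMorgan_mem_Decr, deMorgan_deMorgan]

theorem has_Decr {f : n.Fn} : Has Decr f ↔ ∀ x, f x = false →
    ∃ s : Finset n.Idx, (∀ i ∈ s, x i = false) ∧ ∀ y, (∀ i ∈ s, y i = false) → f y = false := by
  refine deMorgan_mem_Incr.symm.trans (has_Incr.trans ⟨fun h x hx => ?_, fun h x hx => ?_⟩)
  · obtain ⟨s, hs, hs'⟩ := h (fun i => !x i) (by simpa using hx)
    exact ⟨s, by simpa using hs, fun y hy => by
      simpa using hs' (fun i => !y i) (by simpa using hy)⟩
  · obtain ⟨s, hs, hs'⟩ := h (fun i => !x i) (by simpa using hx)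
    exact ⟨s, by simpa using hs, fun y hy => by
      simpa using hs' (fun i => !y i) (by simpa using hy)⟩

theorem Decr_subset_Mono : Decr ⊆ Mono := fun _ h =>
  deMorgan_mem_Mono.1 (Incr_subset_Mono (deMorgan_mem_Incr.2 h))

/-! ### Inclusions -/

theorem Lim0_subset_Cons0 : Lim0 ⊆ Cons0 := by
  rintro ⟨n, f⟩ h
  obtain ⟨s, hs⟩ := has_Lim0.1 h
  exact has_Cons0.2 (hs _ fun _ _ => rfl)

theorem Lim1_subset_Cons1 : Lim1 ⊆ Cons1 := by
  rintro ⟨n, f⟩ h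
  obtain ⟨s, hs⟩ := has_Lim1.1 h
  exact has_Cons1.2 (hs _ fun _ _ => rfl)

theorem mem_Lim0_of_Decr {f : Op} (h : f ∈ Decr) (h0 : f ∈ Cons0) : f ∈ Lim0 := by
  obtain ⟨n, f⟩ := f
  obtain ⟨s, -, hs⟩ := has_Decr.1 h _ (has_Cons0.1 h0)
  exact has_Lim0.2 ⟨s, hs⟩

theorem mem_Lim1_of_Incr {f : Op} (h : f ∈ Incr) (h1 : f ∈ Cons1) : f ∈ Lim1 :=
  deMorgan_mem_Lim0.1 (mem_Lim0_of_Decr (deMorgan_mem_Decr.2 h) (deMorgan_mem_Cons0.2 h1))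

theorem mem_Lim0_of_Cont {f : Op} (h : f ∈ Cont) (h0 : f ∈ Cons0) : f ∈ Lim0 := by
  obtain ⟨n, f⟩ := f
  obtain ⟨s, hs⟩ := has_Cont.1 h
  exact has_Lim0.2 ⟨s, fun y hy => (hs _ _ hy).trans (has_Cons0.1 h0)⟩

theorem mem_Lim1_of_Cont {f : Op} (h : f ∈ Cont) (h1 : f ∈ Cons1) : f ∈ Lim1 :=
  deMorgan_mem_Lim0.1 (mem_Lim0_of_Cont (deMorgan_mem_Cont.2 h) (deMorgan_mem_Cons0.2 h1))

theorem mem_Decr_of_Cont {f : Op} (h : f ∈ Cont) (hm : f ∈ Mono) : f ∈ Decr := by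
  classical
  obtain ⟨n, f⟩ := f
  obtain ⟨s, hs⟩ := has_Cont.1 h
  refine has_Decr.2 fun x hx => ⟨s.filter fun i => x i = false, by simp, fun y hy => ?_⟩
  have hle : y ≤ fun i => if i ∈ s then x i else y i := fun i => by
    by_cases hi : i ∈ s
    · cases hxi : x i
      · simp [hi, hxi, hy i (by simp [hi, hxi])]
      · simp [hi, hxi]
    · simp [hi]
  have hm := has_Mono.1 hm hle
  rw [hs (fun i => if i ∈ s then x i else y i) x fun i hi => by simp [hi], hx] at hm
  exact le_bot_iff.1 hm

theorem mem_Incr_of_Cont {f : Op} (h : f ∈ Cont) (hm : f ∈ Mono) : f ∈ Incr :=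
  deMorgan_mem_Decr.1 (mem_Decr_of_Cont (deMorgan_mem_Cont.2 h) (deMorgan_mem_Mono.2 hm))

theorem mem_Cont_of_Incr_of_Decr {f : Op} (hi : f ∈ Incr) (hd : f ∈ Decr) : f ∈ Cont := by
  obtain ⟨n, f⟩ := f
  refine has_Cont_of_forall fun x => ?_
  cases hx : f x
  · obtain ⟨s, hs, hs'⟩ := has_Decr.1 hd x hx
    exact ⟨s, fun y hy => hs' y fun i h => (hy i h).trans (hs i h)⟩
  · obtain ⟨s, hs, hs'⟩ := has_Incr.1 hi x hx
    exact ⟨s, fun y hy => hs' y fun i h => (hy i h).trans (hs i h)⟩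

theorem mem_Cons0_of_Dual {f : Op} (h : f ∈ Dual) : f ∈ Cons0 ↔ f ∈ Cons1 := by
  obtain ⟨n, f⟩ := f
  refine has_Cons0.trans (Iff.trans ?_ has_Cons1.symm)
  have := has_Dual.1 h fun _ => false
  simp only [Bool.not_false] at this
  rw [this]
  simp

theorem deMorgan_eq_of_Dual {f : Op} (h : f ∈ Dual) : deMorgan f = f := by
  obtain ⟨n, f⟩ := f
  have := has_Dual.1 h
  simp [deMorgan, this]

theorem mem_Lim0_of_Dual {f : Op} (h : f ∈ Dual) : f ∈ Lim0 ↔ f ∈ Lim1 := by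
  rw [← deMorgan_mem_Lim0, deMorgan_eq_of_Dual h]

theorem Cont_subset_borelOps : Cont ⊆ borelOps := by
  rintro ⟨n, f⟩ h
  exact (has_Cont_iff_continuous.1 h).measurable

theorem finitaryOps_subset_Cont : finitaryOps ⊆ Cont := by
  rintro ⟨n, f⟩ ⟨k, rfl⟩
  exact has_Cont.2 ⟨(Finset.univ : Finset (Fin (k + 1))), fun x y h =>
    congrArg f (funext fun i => h i (Finset.mem_univ (α := Fin (k + 1)) i))⟩


/-! ### Continuous members of a clone -/

theorem Has.congr {f g : n.Fn} (h : Has F f) (e : ∀ x, f x = g x) : Has F g :=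
  (funext e : f = g) ▸ h

theorem IsCloneOn.minor (hF : IsClone F) {f : n.Fn} (hf : Has F f) (σ : n.Idx → m.Idx) :
    Has F (fun x : m.Idx → Bool => f fun i => x (σ i)) :=
  hF.comp hf fun i => hF.proj (σ i)

/-- A continuous function has a minor of finite arity from which it is recovered by inserting
variables, so a continuous member of a clone is generated by the finitary part of the clone. -/
theorem mem_of_mem_Cont (hF : IsClone F) (hX : IsClone X) (h : finPart X ⊆ F) {f : Op}
    (hf : f ∈ X) (hc : f ∈ Cont) : f ∈ F := by
  classical
  obtain ⟨n, f⟩ := f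
  obtain ⟨s, hs⟩ := has_Cont.1 hc
  have hcard : (insert n.zero s).card = (insert n.zero s).card - 1 + 1 :=
    (Nat.sub_add_cancel (Finset.card_pos.2 ⟨_, Finset.mem_insert_self _ _⟩)).symm
  let k := (insert n.zero s).card - 1
  let e : ↥(insert n.zero s) ≃ Fin (k + 1) := Finset.equivFinOfCardEq hcard
  let σ : n.Idx → (Arity.fin k).Idx := fun i => if hi : i ∈ insert n.zero s then e ⟨i, hi⟩ else 0
  have h1 : Has F (fun x : (Arity.fin k).Idx → Bool => f fun i => x (σ i)) :=
    h ⟨hX.minor hf σ, k, rfl⟩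
  refine (hF.minor h1 (m := n) fun j => (e.symm j).1).congr fun x => hs _ _ fun i hi => ?_
  have hi' : i ∈ insert n.zero s := Finset.mem_insert_of_mem hi
  simp only [σ, dif_pos hi', Equiv.symm_apply_apply]

theorem mem_gen_finPart (hX : IsClone X) {f : Op} : f ∈ gen (finPart X) ↔ f ∈ X ∧ f ∈ Cont :=
  ⟨fun h => ⟨gen_subset hX Set.inter_subset_left h, gen_subset (isClone_Pol _)
    (Set.inter_subset_right.trans finitaryOps_subset_Cont) h⟩,
    fun h => mem_of_mem_Cont (isClone_gen _) hX (subset_gen _) h.1 h.2⟩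

theorem isClone_or (hX : IsClone X) (p : Prop) : IsClone {f | f ∈ X ∨ p} := by
  by_cases hp : p
  · have : {f | f ∈ X ∨ p} = All := by simp [hp, All]
    rw [this]
    exact isClone_All
  · simpa [hp] using hX

/-! ### Generators of some finitary clones -/

theorem opAnd_mem_of_opIte (hF : IsClone F) (h : opIte ∈ F) : opAnd ∈ F :=
  (hF.ite h (hF.proj (n := .fin 1) (0 : Fin 2)) (hF.proj (1 : Fin 2)) (hF.proj (0 : Fin 2))).congr
    fun x => by cases x (0 : Fin 2) <;> cases x (1 : Fin 2) <;> rfl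

theorem opOr_mem_of_opIte (hF : IsClone F) (h : opIte ∈ F) : opOr ∈ F :=
  (hF.ite h (hF.proj (n := .fin 1) (0 : Fin 2)) (hF.proj (0 : Fin 2)) (hF.proj (1 : Fin 2))).congr
    fun x => by cases x (0 : Fin 2) <;> cases x (1 : Fin 2) <;> rfl

theorem opZero_mem_of_opNimp (hF : IsClone F) (h : opNimp ∈ F) : opZero ∈ F :=
  (hF.nimp h (hF.proj (n := .fin 0) (0 : Fin 1)) (hF.proj (0 : Fin 1))).congr
    fun x => by cases x (0 : Fin 1) <;> rfl

theorem opAnd_mem_of_opNimp (hF : IsClone F) (h : opNimp ∈ F) : opAnd ∈ F :=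
  (hF.nimp h (hF.proj (n := .fin 1) (0 : Fin 2))
    (hF.nimp h (hF.proj (0 : Fin 2)) (hF.proj (1 : Fin 2)))).congr
    fun x => by cases x (0 : Fin 2) <;> cases x (1 : Fin 2) <;> rfl

theorem opIte_mem_of_opNimp (hF : IsClone F) (h : opNimp ∈ F) (hor : opOr ∈ F) : opIte ∈ F :=
  (hF.or hor (hF.and (opAnd_mem_of_opNimp hF h) (hF.proj (n := .fin 2) (0 : Fin 3))
    (hF.proj (1 : Fin 3))) (hF.nimp h (hF.proj (2 : Fin 3)) (hF.proj (0 : Fin 3)))).congr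
    fun x => by cases x (0 : Fin 3) <;> cases x (1 : Fin 3) <;> cases x (2 : Fin 3) <;> rfl

theorem opOne_mem_of_opImp (hF : IsClone F) (h : opImp ∈ F) : opOne ∈ F :=
  (hF.imp h (hF.proj (n := .fin 0) (0 : Fin 1)) (hF.proj (0 : Fin 1))).congr
    fun x => by cases x (0 : Fin 1) <;> rfl

theorem opOr_mem_of_opImp (hF : IsClone F) (h : opImp ∈ F) : opOr ∈ F :=
  (hF.imp h (hF.imp h (hF.proj (n := .fin 1) (0 : Fin 2)) (hF.proj (1 : Fin 2)))
    (hF.proj (1 : Fin 2))).congr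
    fun x => by cases x (0 : Fin 2) <;> cases x (1 : Fin 2) <;> rfl

theorem opIte_mem_of_opImp (hF : IsClone F) (h : opImp ∈ F) (hand : opAnd ∈ F) : opIte ∈ F :=
  (hF.and hand (hF.imp h (hF.proj (n := .fin 2) (0 : Fin 3)) (hF.proj (1 : Fin 3)))
    (hF.or (opOr_mem_of_opImp hF h) (hF.proj (0 : Fin 3)) (hF.proj (2 : Fin 3)))).congr
    fun x => by cases x (0 : Fin 3) <;> cases x (1 : Fin 3) <;> cases x (2 : Fin 3) <;> rfl

theorem opAnd_mem_of_opNot (hF : IsClone F) (h : opNot ∈ F) (hor : opOr ∈ F) : opAnd ∈ F :=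
  (hF.not h (hF.or hor (hF.not h (hF.proj (n := .fin 1) (0 : Fin 2)))
    (hF.not h (hF.proj (1 : Fin 2))))).congr
    fun x => by cases x (0 : Fin 2) <;> cases x (1 : Fin 2) <;> rfl

theorem opNimp_mem_of_opNot (hF : IsClone F) (h : opNot ∈ F) (hor : opOr ∈ F) : opNimp ∈ F :=
  (hF.and (opAnd_mem_of_opNot hF h hor) (hF.proj (n := .fin 1) (0 : Fin 2))
    (hF.not h (hF.proj (1 : Fin 2)))).congr fun _ => rfl

theorem opZero_mem_of_opNot (hF : IsClone F) (h : opNot ∈ F) (hor : opOr ∈ F) : opZero ∈ F :=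
  opZero_mem_of_opNimp hF (opNimp_mem_of_opNot hF h hor)

theorem opOne_mem_of_opNot (hF : IsClone F) (h : opNot ∈ F) (hor : opOr ∈ F) : opOne ∈ F :=
  (hF.not h (opZero_mem_of_opNot hF h hor : Has F _)).congr fun _ => rfl

theorem opIte_mem_of_opNot (hF : IsClone F) (h : opNot ∈ F) (hor : opOr ∈ F) : opIte ∈ F :=
  opIte_mem_of_opNimp hF (opNimp_mem_of_opNot hF h hor) hor

theorem opMedian_mem_of_opAnd (hF : IsClone F) (hand : opAnd ∈ F) (hor : opOr ∈ F) :
    opMedian ∈ F :=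
  have p (i : (Arity.fin 2).Idx) : Has F fun x : (Arity.fin 2).Idx → Bool => x i := hF.proj i
  hF.or hor (hF.or hor (hF.and hand (p 0) (p 1)) (hF.and hand (p 0) (p 2)))
    (hF.and hand (p 1) (p 2))

/-- Interpolation at pairs of points, by the values to be attained. -/
theorem mem_of_interpolation_cases (hF : IsClone F) (hm : opMedian ∈ F) {k : ℕ}
    {f : (Arity.fin k).Fn}
    (h11 : ∀ x y, f x = true → f y = true →
      ∃ g : (Arity.fin k).Fn, Has F g ∧ g x = true ∧ g y = true)
    (h00 : ∀ x y, f x = false → f y = false →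
      ∃ g : (Arity.fin k).Fn, Has F g ∧ g x = false ∧ g y = false)
    (h10 : ∀ x y, f x = true → f y = false →
      ∃ g : (Arity.fin k).Fn, Has F g ∧ g x = true ∧ g y = false) : Has F f := by
  refine mem_of_interpolation hF hm fun x y => ?_
  cases hx : f x <;> cases hy : f y
  · exact h00 x y hx hy
  · obtain ⟨g, hg, h⟩ := h10 y x hy hx
    exact ⟨g, hg, h.2, h.1⟩
  · exact h10 x y hx hy
  · exact h11 x y hx hy

theorem exists_eq_true_of_Cons0 {f : n.Fn} (h : Has Cons0 f) {x : n.Idx → Bool} (hx : f x = true) :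
    ∃ i, x i = true := by
  by_contra! hc
  have : x = fun _ => false := funext fun i => by simpa using hc i
  rw [this, has_Cons0.1 h] at hx
  simp at hx

theorem exists_eq_false_of_Cons1 {f : n.Fn} (h : Has Cons1 f) {x : n.Idx → Bool}
    (hx : f x = false) : ∃ i, x i = false := by
  by_contra! hc
  have : x = fun _ => true := funext fun i => by simpa using hc i
  rw [this, has_Cons1.1 h] at hx
  simp at hx

theorem exists_true_false_of_Mono {f : n.Fn} (h : Has Mono f) {x y : n.Idx → Bool}
    (hx : f x = true) (hy : f y = false) : ∃ i, x i = true ∧ y i = false := by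
  by_contra! hc
  have := has_Mono.1 h (fun i => Bool.le_iff_imp.2 fun hi => by simpa using hc i hi : x ≤ y)
  have := Bool.le_iff_imp.1 this hx
  simp [hy] at this

theorem exists_ne_of_apply_ne {f : n.Fn} {x y : n.Idx → Bool}
    (hx : f x = true) (hy : f y = false) : ∃ i, x i ≠ y i := by
  by_contra! hc
  have : x = y := funext hc
  simp [this, hy] at hx

/-- The finitary functions that are monotone unless the conditional is at hand, and preserve
the constant `0` unless `1` is at hand and vice versa, are generated by `∧`, `∨` and these
additional functions. -/
theorem mem_of_fin (hF : IsClone F) (hand : opAnd ∈ F) (hor : opOr ∈ F) {k : ℕ}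
    {f : (Arity.fin k).Fn} (hm : Has Mono f ∨ opIte ∈ F) (h0 : Has Cons0 f ∨ opOne ∈ F)
    (h1 : Has Cons1 f ∨ opZero ∈ F) : Has F f := by
  have h11 : ∀ x y, f x = true → f y = true →
      ∃ g : (Arity.fin k).Fn, Has F g ∧ g x = true ∧ g y = true := by
    intro x y hx hy
    rcases h0 with h0 | h0
    · obtain ⟨i, hi⟩ := exists_eq_true_of_Cons0 h0 hx
      obtain ⟨j, hj⟩ := exists_eq_true_of_Cons0 h0 hy
      exact ⟨_, hF.or hor (hF.proj i) (hF.proj j), by simp [hi], by simp [hj]⟩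
    · exact ⟨_, hF.one h0, rfl, rfl⟩
  have h00 : ∀ x y, f x = false → f y = false →
      ∃ g : (Arity.fin k).Fn, Has F g ∧ g x = false ∧ g y = false := by
    intro x y hx hy
    rcases h1 with h1 | h1
    · obtain ⟨i, hi⟩ := exists_eq_false_of_Cons1 h1 hx
      obtain ⟨j, hj⟩ := exists_eq_false_of_Cons1 h1 hy
      exact ⟨_, hF.and hand (hF.proj i) (hF.proj j), by simp [hi], by simp [hj]⟩
    · exact ⟨_, hF.zero h1, rfl, rfl⟩
  refine mem_of_interpolation_cases hF (opMedian_mem_of_opAnd hF hand hor) h11 h00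
    fun x y hx hy => ?_
  rcases hm with hm | hm
  · obtain ⟨i, hi, hi'⟩ := exists_true_false_of_Mono hm hx hy
    exact ⟨_, hF.proj i, hi, hi'⟩
  · obtain ⟨i, hi⟩ := exists_ne_of_apply_ne hx hy
    cases hxi : x i
    · have hyi : y i = true := by
        rw [hxi] at hi
        simpa using hi.symm
      obtain ⟨g, hg, hgx, -⟩ := h11 x x hx hx
      obtain ⟨h, hh, hhy, -⟩ := h00 y y hy hy
      exact ⟨_, hF.ite hm (hF.proj i) hh hg, by simp [hxi, hgx], by simp [hyi, hhy]⟩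
    · exact ⟨_, hF.proj i, hxi, by rw [hxi] at hi; simpa using hi.symm⟩

theorem mem_of_Cont (hF : IsClone F) (hand : opAnd ∈ F) (hor : opOr ∈ F) {f : Op}
    (hc : f ∈ Cont) (hm : f ∈ Mono ∨ opIte ∈ F) (h0 : f ∈ Cons0 ∨ opOne ∈ F)
    (h1 : f ∈ Cons1 ∨ opZero ∈ F) : f ∈ F := by
  refine mem_of_mem_Cont hF (((isClone_or (isClone_Pol _) (opIte ∈ F)).inter
    (isClone_or (isClone_Pol _) (opOne ∈ F))).inter
    (isClone_or (isClone_Pol _) (opZero ∈ F))) ?_ (⟨⟨hm, h0⟩, h1⟩) hc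
  rintro ⟨n, f⟩ ⟨⟨⟨hm, h0⟩, h1⟩, k, rfl⟩
  exact mem_of_fin hF hand hor hm h0 h1

/-! ### Generators of the self-dual finitary clones -/

theorem exists_eq_of_Dual {f : n.Fn} (h : Has Dual f) {x y : n.Idx → Bool} (hxy : f x = f y) :
    ∃ i, x i = y i := by
  by_contra! hc
  have : x = fun i => !y i := funext fun i => by
    have := hc i
    revert this
    cases x i <;> cases y i <;> simp
  rw [this, has_Dual.1 h] at hxy
  simp at hxy

theorem finPart_Dual_subset (hF : IsClone F) (hm : opMedian ∈ F) (hn : opNot ∈ F) :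
    finPart Dual ⊆ F := by
  rintro ⟨n, f⟩ ⟨hf, k, rfl⟩
  refine mem_of_interpolation hF hm fun x y => ?_
  have : ∃ i, (x i = f x ∧ y i = f y) ∨ ((!x i) = f x ∧ (!y i) = f y) := by
    by_cases h : f x = f y
    · obtain ⟨i, hi⟩ := exists_eq_of_Dual hf h
      refine ⟨i, ?_⟩
      rw [hi, h]
      cases y i <;> cases f y <;> simp
    · have : ∃ i, x i ≠ y i := by
        by_contra! hc
        exact h (congrArg f (funext hc))
      obtain ⟨i, hi⟩ := this
      refine ⟨i, ?_⟩
      revert h hi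
      cases x i <;> cases y i <;> cases f x <;> cases f y <;> simp
  obtain ⟨i, h | h⟩ := this
  · exact ⟨_, hF.proj i, h⟩
  · exact ⟨_, hF.not hn (hF.proj i), h⟩

theorem finPart_Dual_Mono_subset (hF : IsClone F) (hm : opMedian ∈ F) :
    finPart (Dual ∩ Mono) ⊆ F := by
  rintro ⟨n, f⟩ ⟨⟨hd, hf⟩, k, rfl⟩
  have hd' := has_Dual.1 hd
  refine mem_of_interpolation_cases hF hm (fun x y hx hy => ?_) (fun x y hx hy => ?_)
    fun x y hx hy => ?_
  · obtain ⟨i, hi, hi'⟩ := exists_true_false_of_Mono hf hx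
      (by rw [hd', hy]; rfl : f (fun i => !y i) = false)
    exact ⟨_, hF.proj i, hi, by simpa using hi'⟩
  · obtain ⟨i, hi, hi'⟩ := exists_true_false_of_Mono hf
      (by rw [hd', hx]; rfl : f (fun i => !x i) = true) hy
    exact ⟨_, hF.proj i, by simpa using hi, hi'⟩
  · obtain ⟨i, hi, hi'⟩ := exists_true_false_of_Mono hf hx hy
    exact ⟨_, hF.proj i, hi, hi'⟩

theorem finPart_Dual_Cons0_subset (hF : IsClone F) (hm : opMedian ∈ F) (hx : opXor3 ∈ F) :
    finPart (Dual ∩ Cons0) ⊆ F := by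
  rintro ⟨n, f⟩ ⟨⟨hd, h0⟩, k, rfl⟩
  have h1 : Has Cons1 f := (mem_Cons0_of_Dual hd).1 h0
  have key : ∀ (x y : (Arity.fin k).Idx → Bool) (a b : Bool) (i₁ i₂ i₃ : (Arity.fin k).Idx),
      ((x i₁).xor (x i₂)).xor (x i₃) = a → ((y i₁).xor (y i₂)).xor (y i₃) = b →
      ∃ g : (Arity.fin k).Fn, Has F g ∧ g x = a ∧ g y = b := fun x y a b i₁ i₂ i₃ ha hb =>
    ⟨_, hF.xor3 hx (hF.proj i₁) (hF.proj i₂) (hF.proj i₃), ha, hb⟩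
  refine mem_of_interpolation_cases hF hm (fun x y hx hy => ?_) (fun x y hx hy => ?_)
    fun x y hx hy => ?_
  · by_cases h : ∃ i, x i = true ∧ y i = true
    · obtain ⟨i, hi⟩ := h
      exact ⟨_, hF.proj i, hi⟩
    · push Not at h
      obtain ⟨i, hi⟩ := exists_eq_true_of_Cons0 h0 hx
      obtain ⟨j, hj⟩ := exists_eq_true_of_Cons0 h0 hy
      obtain ⟨l, hl⟩ := exists_eq_of_Dual hd (hx.trans hy.symm)
      have h1 := h i
      have h2 := h j
      have h3 := h l
      refine key x y _ _ i j l ?_ ?_ <;> simp_all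
  · by_cases h : ∃ i, x i = false ∧ y i = false
    · obtain ⟨i, hi⟩ := h
      exact ⟨_, hF.proj i, hi⟩
    · push Not at h
      obtain ⟨i, hi⟩ := exists_eq_false_of_Cons1 h1 hx
      obtain ⟨j, hj⟩ := exists_eq_false_of_Cons1 h1 hy
      obtain ⟨l, hl⟩ := exists_eq_of_Dual hd (hx.trans hy.symm)
      have h1 := h i
      have h2 := h j
      have h3 := h l
      refine key x y _ _ i j l ?_ ?_ <;> simp_all
  · by_cases h : ∃ i, x i = true ∧ y i = false
    · obtain ⟨i, hi⟩ := h
      exact ⟨_, hF.proj i, hi⟩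
    · push Not at h
      obtain ⟨i, hi⟩ := exists_eq_true_of_Cons0 h0 hx
      obtain ⟨j, hj⟩ := exists_eq_false_of_Cons1 h1 hy
      obtain ⟨l, hl⟩ := exists_ne_of_apply_ne hx hy
      have hi' : y i = true := by simpa using h i hi
      have hj' : x j = false := by
        by_contra hc
        exact h j (by simpa using hc) hj
      have hl' : x l = false := by
        by_contra hc
        have hc : x l = true := by simpa using hc
        exact hl (by rw [hc]; simpa using (h l hc).symm)
      have hl'' : y l = true := by
        rw [hl'] at hl
        simpa using hl.symm
      exact key x y _ _ i j l (by simp [hi, hj', hl']) (by simp [hi', hj, hl''])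


/-! ### Monotone Borel sets are positive Borel -/

/-- `s` and `t` can be separated by a set with the property `P`. -/
def Separable {α : Type*} (P : Set α → Prop) (s t : Set α) : Prop :=
  ∃ u, P u ∧ s ⊆ u ∧ Disjoint t u

theorem Separable.iUnion {α : Type*} {P : Set α → Prop}
    (hU : ∀ A : ℕ → Set α, (∀ k, P (A k)) → P (⋃ k, A k))
    (hI : ∀ A : ℕ → Set α, (∀ k, P (A k)) → P (⋂ k, A k)) {s t : ℕ → Set α}
    (h : ∀ k l, Separable P (s k) (t l)) : Separable P (⋃ k, s k) (⋃ l, t l) := by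
  choose u hu hsu htu using h
  refine ⟨⋃ k, ⋂ l, u k l, hU _ fun k => hI _ fun l => hu k l, ?_, ?_⟩
  · exact Set.iUnion_subset fun k => Set.subset_iUnion_of_subset k
      (Set.subset_iInter fun l => hsu k l)
  · simp_rw [Set.disjoint_iUnion_left, Set.disjoint_iUnion_right]
    exact fun l k => (htu k l).mono_right (Set.iInter_subset _ l)

open PiNat in
/-- If the ranges of two functions on Baire space cannot be separated, then there are two points
such that the images of their neighbourhoods cannot be separated. -/
theorem exists_not_separable_cylinder {α : Type*} {P : Set α → Prop}
    (hU : ∀ A : ℕ → Set α, (∀ k, P (A k)) → P (⋃ k, A k))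
    (hI : ∀ A : ℕ → Set α, (∀ k, P (A k)) → P (⋂ k, A k)) {f g : (ℕ → ℕ) → α}
    (h : ¬Separable P (Set.range f) (Set.range g)) :
    ∃ x y : ℕ → ℕ, ∀ k, ¬Separable P (f '' cylinder x k) (g '' cylinder y k) := by
  have I : ∀ k x y, ¬Separable P (f '' cylinder x k) (g '' cylinder y k) →
      ∃ x' y', x' ∈ cylinder x k ∧ y' ∈ cylinder y k ∧
      ¬Separable P (f '' cylinder x' (k + 1)) (g '' cylinder y' (k + 1)) := by
    intro k x y
    contrapose!
    intro H
    rw [← iUnion_cylinder_update x k, ← iUnion_cylinder_update y k, Set.image_iUnion,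
      Set.image_iUnion]
    exact Separable.iUnion hU hI fun i j =>
      H _ _ (update_mem_cylinder _ _ _) (update_mem_cylinder _ _ _)
  let A := { p : ℕ × (ℕ → ℕ) × (ℕ → ℕ) //
      ¬Separable P (f '' cylinder p.2.1 p.1) (g '' cylinder p.2.2 p.1) }
  have : ∀ p : A, ∃ q : A,
      q.1.1 = p.1.1 + 1 ∧ q.1.2.1 ∈ cylinder p.1.2.1 p.1.1 ∧
        q.1.2.2 ∈ cylinder p.1.2.2 p.1.1 := by
    rintro ⟨⟨k, x, y⟩, hp⟩
    rcases I k x y hp with ⟨x', y', hx', hy', h'⟩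
    exact ⟨⟨⟨k + 1, x', y'⟩, h'⟩, rfl, hx', hy'⟩
  choose G hGn hGx hGy using this
  let p0 : A := ⟨⟨0, fun _ => 0, fun _ => 0⟩, by simpa using h⟩
  let p : ℕ → A := fun k => G^[k] p0
  have prec : ∀ k, p (k + 1) = G (p k) := fun k => by
    simp only [p, Function.iterate_succ', Function.comp]
  have pn_fst : ∀ k, (p k).1.1 = k := fun k => by
    induction k with
    | zero => rfl
    | succ k IH => simp only [prec, hGn, IH]
  have Ix : ∀ l k, l + 1 ≤ k → (p k).1.2.1 l = (p (l + 1)).1.2.1 l := by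
    intro l
    apply Nat.le_induction
    · rfl
    intro k hlk IH
    have I : (G (p k)).val.snd.fst l = (p k).val.snd.fst l := by
      apply hGx (p k) l
      rw [pn_fst]
      exact hlk
    rw [prec, I, IH]
  have Iy : ∀ l k, l + 1 ≤ k → (p k).1.2.2 l = (p (l + 1)).1.2.2 l := by
    intro l
    apply Nat.le_induction
    · rfl
    intro k hlk IH
    have I : (G (p k)).val.snd.snd l = (p k).val.snd.snd l := by
      apply hGy (p k) l
      rw [pn_fst]
      exact hlk
    rw [prec, I, IH]
  refine ⟨fun k => (p (k + 1)).1.2.1 k, fun k => (p (k + 1)).1.2.2 k, fun k => ?_⟩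
  convert! (p k).2 using 3
  · rw [pn_fst, ← mem_cylinder_iff_eq, mem_cylinder_iff]
    exact fun i hi => (Ix i k hi).symm
  · rw [pn_fst, ← mem_cylinder_iff_eq, mem_cylinder_iff]
    exact fun i hi => (Iy i k hi).symm

open PiNat in
/-- A neighbourhood of a point of Baire space contains a cylinder. -/
theorem exists_cylinder_subset {U : Set (ℕ → ℕ)} {x : ℕ → ℕ} (hU : U ∈ 𝓝 x) :
    ∃ k, cylinder x k ⊆ U := by
  let : MetricSpace (ℕ → ℕ) := metricSpaceNatNat
  obtain ⟨ε, hε, hsub⟩ := Metric.mem_nhds_iff.1 hU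
  obtain ⟨k, hk⟩ : ∃ k : ℕ, (1 / 2 : ℝ) ^ k < ε := exists_pow_lt_of_lt_one hε (by norm_num)
  refine ⟨k, fun z hz => hsub ?_⟩
  rw [mem_cylinder_iff_dist_le] at hz
  exact hz.trans_lt hk

/-- Monotone Borel subsets of `2^ι` are obtained from the subbasic sets `{x | x i = 1}` by
countable unions and intersections. This is Lusin's separation argument, carried out with
separating sets of this positive kind: a monotone set and its complement are separated by subbasic
sets near any two of their points. -/
theorem positive_induction {ι : Type*} [Countable ι] {P : Set (ι → Bool) → Prop} (h0 : P ∅)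
    (h1 : P Set.univ) (hc : ∀ i, P {x | x i = true})
    (hU : ∀ A : ℕ → Set (ι → Bool), (∀ k, P (A k)) → P (⋃ k, A k))
    (hI : ∀ A : ℕ → Set (ι → Bool), (∀ k, P (A k)) → P (⋂ k, A k)) {A : Set (ι → Bool)}
    (hA : MeasurableSet A) (hm : ∀ x y, x ≤ y → x ∈ A → y ∈ A) : P A := by
  have : PolishSpace (ι → Bool) := ⟨⟩
  have ha := hA.analyticSet
  have hb := hA.compl.analyticSet
  rw [MeasureTheory.AnalyticSet] at ha hb
  rcases ha with rfl | ⟨f, hf, hfA⟩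
  · exact h0
  rcases hb with hb | ⟨g, hg, hgA⟩
  · rw [Set.compl_empty_iff.1 hb]
    exact h1
  have hsep : Separable P (Set.range f) (Set.range g) := by
    by_contra hsep
    obtain ⟨x, y, hxy⟩ := exists_not_separable_cylinder hU hI hsep
    have hx : f x ∈ A := hfA ▸ Set.mem_range_self x
    have hy : g y ∈ Aᶜ := hgA ▸ Set.mem_range_self y
    obtain ⟨i, hi, hi'⟩ : ∃ i, f x i = true ∧ g y i = false := by
      by_contra! hc
      exact hy (hm _ _ (fun i => Bool.le_iff_imp.2 fun h => by simpa using hc i h) hx)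
    have hfi : ∀ᶠ z in 𝓝 x, f z i = true := by
      have := ((continuous_apply i).comp hf).continuousAt (x := x)
      simpa [ContinuousAt, nhds_discrete, hi] using this
    have hgi : ∀ᶠ z in 𝓝 y, g z i = false := by
      have := ((continuous_apply i).comp hg).continuousAt (x := y)
      simpa [ContinuousAt, nhds_discrete, hi'] using this
    obtain ⟨k, hk⟩ := exists_cylinder_subset hfi
    obtain ⟨l, hl⟩ := exists_cylinder_subset hgi
    refine hxy (max k l) ⟨{x | x i = true}, hc i, ?_, ?_⟩
    · rintro _ ⟨z, hz, rfl⟩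
      exact hk (PiNat.cylinder_anti x (le_max_left k l) hz)
    · rw [Set.disjoint_left]
      rintro _ ⟨z, hz, rfl⟩ hz'
      have := hl (PiNat.cylinder_anti y (le_max_right k l) hz)
      simp_all
  obtain ⟨u, hu, hAu, hdisj⟩ := hsep
  rw [hfA] at hAu
  rw [hgA] at hdisj
  rwa [hAu.antisymm (Set.disjoint_compl_left_iff_subset.1 hdisj)]

/-! ### Clones with both constants -/

open Classical in
theorem mem_of_positive (hF : IsClone F) (h0 : opZero ∈ F) (h1 : opOne ∈ F) (hI : opBigAnd ∈ F)
    (hU : opBigOr ∈ F) {f : Op} (hf : f ∈ borelOps) (hm : f ∈ Mono) : f ∈ F := by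
  obtain ⟨n, f⟩ := f
  have hf : Measurable f := hf
  have := positive_induction (P := fun A : Set (n.Idx → Bool) => Has F fun x => decide (x ∈ A))
    ((hF.zero h0).congr fun x => by simp) ((hF.one h1).congr fun x => by simp)
    (fun i => (hF.proj i).congr fun x => by simp)
    (fun A hA => (hF.bigOr hU hA).congr fun x => by simp)
    (fun A hA => (hF.bigAnd hI hA).congr fun x => by simp)
    (hf (measurableSet_singleton true)) (fun x y hxy hx =>
      Bool.le_iff_imp.1 (has_Mono.1 hm hxy) hx)
  exact this.congr fun x => by simp

open Classical in
theorem mem_of_Borel (hF : IsClone F) (h0 : opZero ∈ F) (hn : opNot ∈ F)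
    (hU : opBigOr ∈ F) {f : Op} (hf : f ∈ borelOps) : f ∈ F := by
  obtain ⟨n, f⟩ := f
  have hf : Measurable f := hf
  let S : MeasurableSpace (n.Idx → Bool) :=
    { MeasurableSet' := fun A => Has F fun x => decide (x ∈ A)
      measurableSet_empty := (hF.zero h0).congr fun x => by simp
      measurableSet_compl := fun A hA => (hF.not hn hA).congr fun x => by simp
      measurableSet_iUnion := fun A hA => (hF.bigOr hU hA).congr fun x => by simp }
  have hS : MeasurableSpace.pi ≤ S := by
    refine iSup_le fun i => ?_
    rintro _ ⟨t, -, rfl⟩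
    have : (fun x : n.Idx → Bool => decide (x ∈ (fun b : n.Idx → Bool => b i) ⁻¹' t)) =
        fun x => (bif x i then decide (true ∈ t) else decide (false ∈ t)) := by
      funext x
      cases hx : x i <;> simp [hx]
    change Has F _
    rw [this]
    have hzero := hF.zero (m := n) h0
    by_cases ht : true ∈ t <;> by_cases hf : false ∈ t
    · exact (hF.not hn hzero).congr fun x => by simp [ht, hf]
    · exact (hF.proj i).congr fun x => by simp [ht, hf]
    · exact (hF.not hn (hF.proj i)).congr fun x => by simp [ht, hf]
    · exact hzero.congr fun x => by simp [ht, hf]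
  have : Has F _ := hS _ (hf (measurableSet_singleton true))
  exact this.congr fun x => by simp

open Classical in
theorem mem_of_Incr (hF : IsClone F) (h0 : opZero ∈ F) (h1 : opOne ∈ F) (hand : opAnd ∈ F)
    (hU : opBigOr ∈ F) {f : Op} (hf : f ∈ Incr) : f ∈ F := by
  obtain ⟨n, f⟩ := f
  obtain ⟨s, hs⟩ := exists_surjective_nat (Finset n.Idx)
  have hconj : ∀ t : Finset n.Idx, Has F fun x => decide (∀ i ∈ t, x i = true) := fun t => by
    induction t using Finset.induction_on with
    | empty => exact (hF.one h1).congr fun x => by simp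
    | insert a t _ ih => exact (hF.and hand (hF.proj a) ih).congr fun x => by simp
  have hk : ∀ k, Has F fun x => decide ((∀ i ∈ s k, x i = true) ∧
      ∀ y, (∀ i ∈ s k, y i = true) → f y = true) := fun k => by
    by_cases h : ∀ y, (∀ i ∈ s k, y i = true) → f y = true
    · exact (hconj (s k)).congr fun x => decide_eq_decide.2 (and_iff_left h).symm
    · exact (hF.zero h0).congr fun x =>
        (decide_eq_false fun h' => h h'.2).symm
  refine (hF.bigOr hU hk).congr fun x => ?_
  rw [Bool.eq_iff_iff, decide_eq_true_iff]
  simp only [decide_eq_true_eq]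
  constructor
  · rintro ⟨k, hk, hk'⟩
    exact hk' x hk
  · intro hx
    obtain ⟨t, ht⟩ := has_Incr.1 hf x hx
    obtain ⟨k, rfl⟩ := hs t
    exact ⟨k, ht⟩

theorem mem_of_Decr (hF : IsClone F) (h0 : opZero ∈ F) (h1 : opOne ∈ F) (hor : opOr ∈ F)
    (hI : opBigAnd ∈ F) {f : Op} (hf : f ∈ Decr) : f ∈ F := by
  have := mem_of_Incr hF.dualSet (mem_dualSet.2 (by rwa [deMorgan_opZero]))
    (mem_dualSet.2 (by rwa [deMorgan_opOne])) (mem_dualSet.2 (by rwa [deMorgan_opAnd]))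
    (mem_dualSet.2 (by rwa [deMorgan_opBigOr])) (deMorgan_mem_Incr.2 hf)
  rwa [mem_dualSet, deMorgan_deMorgan] at this

/-! ### Reduction to clones with constants -/

/-- For members `u`, `v` of a clone `F`, the functions that preserve the class of all `h` such that
`u ∨ (v ∧ h)` belongs to `F`. This clone contains the constants. -/
def sandwich (F : Set Op) (u v : m.Fn) : Set Op :=
  {g | ∀ h : g.1.Idx → m.Fn, (∀ i, Has F fun x => u x || (v x && h i x)) →
    Has F fun x => u x || (v x && g.2 fun i => h i x)}

theorem isClone_sandwich (u v : m.Fn) : IsClone (sandwich F u v) where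
  arity_mem _ _ := trivial
  proj_mem _ _ i _ hh := hh i
  comp_mem _ _ _ _ _ _ hg hf h hh := hg _ fun i => hf i h hh

section

variable {u v : m.Fn}

theorem opZero_mem_sandwich (hu : Has F u) : opZero ∈ sandwich F u v := fun _ _ =>
  hu.congr fun x => by simp [opZero]

theorem opOne_mem_sandwich (hF : IsClone F) (hor : opOr ∈ F) (hu : Has F u) (hv : Has F v) :
    opOne ∈ sandwich F u v := fun _ _ => (hF.or hor hu hv).congr fun x => by simp [opOne]

theorem opAnd_mem_sandwich (hF : IsClone F) (hand : opAnd ∈ F) : opAnd ∈ sandwich F u v :=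
  fun h hh => (hF.and hand (hh (0 : Fin 2)) (hh (1 : Fin 2))).congr fun x => by
    change _ = (u x || (v x && (h (0 : Fin 2) x && h (1 : Fin 2) x)))
    cases u x <;> cases v x <;> simp

theorem opOr_mem_sandwich (hF : IsClone F) (hor : opOr ∈ F) : opOr ∈ sandwich F u v :=
  fun h hh => (hF.or hor (hh (0 : Fin 2)) (hh (1 : Fin 2))).congr fun x => by
    change _ = (u x || (v x && (h (0 : Fin 2) x || h (1 : Fin 2) x)))
    cases u x <;> cases v x <;> simp

theorem opNot_mem_sandwich (hF : IsClone F) (hite : opIte ∈ F) (hu : Has F u) (hv : Has F v) :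
    opNot ∈ sandwich F u v := fun h hh =>
  -- with `q = u ∨ (v ∧ h)`, the function `u ∨ (v ∧ ¬ h)` is `(q ? u : u ∨ v)`
  (hF.ite hite (hh (0 : Fin 1)) hu (hF.or (opOr_mem_of_opIte hF hite) hu hv)).congr fun x => by
    change _ = (u x || (v x && !h (0 : Fin 1) x))
    cases u x <;> cases v x <;> cases h (0 : Fin 1) x <;> simp

open Classical in
theorem opBigOr_mem_sandwich (hF : IsClone F) (hor : opOr ∈ F) (h : ceilOp opBigOr ∈ F)
    (hu : Has F u) (hv : Has F v) : opBigOr ∈ sandwich F u v := fun h' hh =>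
  (hF.or hor hu (hF.ceilBigOr h hv hh)).congr fun x => by
    change _ = (u x || (v x && decide (∃ i, h' i x = true)))
    cases u x <;> cases v x <;> simp
    rfl

open Classical in
theorem opBigAnd_mem_sandwich (hF : IsClone F) (h : floorOp opBigAnd ∈ F)
    (hu : Has F u) : opBigAnd ∈ sandwich F u v := fun h' hh =>
  (hF.floorBigAnd h hu hh).congr fun x => by
    change _ = (u x || (v x && decide (∀ i, h' i x = true)))
    cases u x <;> cases v x <;> simp
    rfl

/-- A function is recovered from its sandwich between a lower and an upper bound in the clone. -/
theorem mem_of_mem_sandwich (hF : IsClone F) (hand : opAnd ∈ F) (hor : opOr ∈ F) {f : m.Fn}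
    (hu : Has F u) (hv : Has F v) (huf : ∀ x, u x = true → f x = true)
    (hfv : ∀ x, f x = true → v x = true) (h : Has (sandwich F u v) f) : Has F f :=
  (h (fun i x => x i) fun i => hF.or hor hu (hF.and hand hv (hF.proj i))).congr fun x => by
    have h1 := huf x
    have h2 := hfv x
    revert h1 h2
    change (u x = true → f x = true) → (f x = true → v x = true) → (u x || (v x && f x)) = f x
    cases u x <;> cases v x <;> cases f x <;> simp

end

open Classical in
theorem has_conj (hF : IsClone F) (hand : opAnd ∈ F) (i : n.Idx) (t : Finset n.Idx) :
    Has F fun x : n.Idx → Bool => x i && decide (∀ j ∈ t, x j = true) := by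
  induction t using Finset.induction_on with
  | empty => exact (hF.proj i).congr fun x => by simp
  | insert a t _ ih =>
    exact (hF.and hand (hF.proj a) ih).congr fun x => by
      simp only [Finset.mem_insert, forall_eq_or_imp, Bool.decide_and, Bool.decide_eq_true]
      cases x a <;> cases x i <;> rfl

open Classical in
theorem exists_lower (hF : IsClone F) (hand : opAnd ∈ F) {f : n.Fn}
    (h : Has Lim1 f ∨ (Has Cons1 f ∧ opBigAnd ∈ F) ∨ opZero ∈ F) :
    ∃ u : n.Fn, Has F u ∧ ∀ x, u x = true → f x = true := by
  rcases h with h | ⟨h, hI⟩ | h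
  · obtain ⟨s, hs⟩ := has_Lim1.1 h
    refine ⟨_, has_conj hF hand n.zero s, fun x hx => hs x ?_⟩
    simp only [Bool.and_eq_true, decide_eq_true_eq] at hx
    exact hx.2
  · obtain ⟨e, he⟩ := exists_surjective_nat n.Idx
    refine ⟨_, hF.bigAnd hI fun k => hF.proj (e k), fun x hx => ?_⟩
    have : x = fun _ => true := funext fun i => by
      obtain ⟨k, rfl⟩ := he i
      exact of_decide_eq_true hx k
    rw [this, has_Cons1.1 h]
  · exact ⟨_, hF.zero h, by simp⟩

theorem exists_upper (hF : IsClone F) (hor : opOr ∈ F) {f : n.Fn}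
    (h : Has Lim0 f ∨ (Has Cons0 f ∧ opBigOr ∈ F) ∨ opOne ∈ F) :
    ∃ v : n.Fn, Has F v ∧ ∀ x, f x = true → v x = true := by
  obtain ⟨u, hu, huf⟩ := exists_lower hF.dualSet (f := fun x => !f fun i => !x i)
    (mem_dualSet.2 (by rwa [deMorgan_opAnd]))
    (by
      rw [← deMorgan_opOne, ← deMorgan_opBigOr, mem_dualSet, mem_dualSet, deMorgan_deMorgan,
        deMorgan_deMorgan]
      exact h.imp deMorgan_mem_Lim1.2 (Or.imp_left (And.imp_left deMorgan_mem_Cons1.2)))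
  refine ⟨_, has_dualSet.1 hu, fun x hx => ?_⟩
  have := huf fun i => !x i
  simp only [Bool.not_not, hx, Bool.not_true, imp_false, Bool.false_eq_true] at this
  simpa using this

/-- Monotone Borel functions in a clone containing `∧` and `∨`: a function is in the clone when
the infinitary meets and joins needed for its regularity, and the functions needed to bound it from
both sides, are in the clone. -/
theorem mem_of_Mono_levels (hF : IsClone F) (hand : opAnd ∈ F) (hor : opOr ∈ F) {f : Op}
    (hf : f ∈ borelOps) (hm : f ∈ Mono) (hI : f ∈ Incr ∨ floorOp opBigAnd ∈ F)
    (hD : f ∈ Decr ∨ ceilOp opBigOr ∈ F)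
    (hlow : f ∈ Lim1 ∨ (f ∈ Cons1 ∧ opBigAnd ∈ F) ∨ opZero ∈ F)
    (hup : f ∈ Lim0 ∨ (f ∈ Cons0 ∧ opBigOr ∈ F) ∨ opOne ∈ F) : f ∈ F := by
  obtain ⟨n, f⟩ := f
  obtain ⟨u, hu, huf⟩ := exists_lower hF hand hlow
  obtain ⟨v, hv, hfv⟩ := exists_upper hF hor hup
  refine mem_of_mem_sandwich hF hand hor hu hv huf hfv ?_
  have hS := isClone_sandwich (F := F) u v
  have h0 := opZero_mem_sandwich (v := v) hu
  have h1 := opOne_mem_sandwich hF hor hu hv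
  have hand' := opAnd_mem_sandwich (u := u) (v := v) hF hand
  have hor' := opOr_mem_sandwich (u := u) (v := v) hF hor
  rcases hI with hI | hI
  · rcases hD with hD | hD
    · exact mem_of_Cont hS hand' hor' (mem_Cont_of_Incr_of_Decr hI hD) (.inl hm) (.inr h1)
        (.inr h0)
    · exact mem_of_Incr hS h0 h1 hand' (opBigOr_mem_sandwich hF hor hD hu hv) hI
  · have hI := opBigAnd_mem_sandwich (v := v) hF hI hu
    rcases hD with hD | hD
    · exact mem_of_Decr hS h0 h1 hor' hI hD
    · exact mem_of_positive hS h0 h1 hI (opBigOr_mem_sandwich hF hor hD hu hv) hf hm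

theorem ceil_mem_of_opIte_of_floor (hF : IsClone F) (hite : opIte ∈ F)
    (h : floorOp opBigAnd ∈ F) : ceilOp opBigOr ∈ F := by
  classical
  have hand := opAnd_mem_of_opIte hF hite
  have hor := opOr_mem_of_opIte hF hite
  -- With `v` the first and `w` the second variable, the negations that are needed are taken
  -- between `v ∧ w` and `v`, and `⋁` is bounded from below by `w`.
  let v : Arity.omega.Fn := fun x : ℕ → Bool => x 0
  let u : Arity.omega.Fn := fun x : ℕ → Bool => x 0 && x 1
  have hv : Has F v := hF.proj (n := .omega) (0 : ℕ)
  have hu : Has F u := hF.and hand (hF.proj (n := .omega) (0 : ℕ)) (hF.proj (n := .omega) (1 : ℕ))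
  have hS := isClone_sandwich (F := F) u v
  have hN := opNot_mem_sandwich (u := u) (v := v) hF hite hu hv
  have hI := opBigAnd_mem_sandwich (v := v) hF h hu
  have := hS.not hN (hS.bigAnd hI fun k => hS.not hN (hS.proj (n := .omega) (k + 1 : ℕ)))
  refine (this (fun i x => x i) fun i => hF.or hor hu (hF.and hand hv (hF.proj i))).congr
    fun x => ?_
  change ((x (0 : ℕ) && x (1 : ℕ)) ||
    (x (0 : ℕ) && !decide (∀ k : ℕ, (!x (k + 1 : ℕ)) = true))) =
    (x (0 : ℕ) && decide (∃ k : ℕ, x (k + 1 : ℕ) = true))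
  cases h0 : x (0 : ℕ)
  · simp
  · rw [Bool.eq_iff_iff]
    simp only [Bool.true_and, Bool.or_eq_true, Bool.not_eq_true', decide_eq_true_eq,
      decide_eq_false_iff_not, not_forall, Bool.not_eq_false]
    exact ⟨fun h => h.elim (fun h => ⟨0, h⟩) id, .inr⟩

/-- Borel functions in a clone containing the conditional. -/
theorem mem_of_opIte_levels (hF : IsClone F) (hite : opIte ∈ F) {f : Op} (hf : f ∈ borelOps)
    (hc : f ∈ Cont ∨ ceilOp opBigOr ∈ F ∨ floorOp opBigAnd ∈ F)
    (hlow : f ∈ Lim1 ∨ (f ∈ Cons1 ∧ opBigAnd ∈ F) ∨ opZero ∈ F)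
    (hup : f ∈ Lim0 ∨ (f ∈ Cons0 ∧ opBigOr ∈ F) ∨ opOne ∈ F) : f ∈ F := by
  have hand := opAnd_mem_of_opIte hF hite
  have hor := opOr_mem_of_opIte hF hite
  obtain ⟨n, f⟩ := f
  obtain ⟨u, hu, huf⟩ := exists_lower hF hand hlow
  obtain ⟨v, hv, hfv⟩ := exists_upper hF hor hup
  refine mem_of_mem_sandwich hF hand hor hu hv huf hfv ?_
  have hS := isClone_sandwich (F := F) u v
  have h0 := opZero_mem_sandwich (v := v) hu
  have h1 := opOne_mem_sandwich hF hor hu hv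
  have hand' := opAnd_mem_sandwich (u := u) (v := v) hF hand
  have hor' := opOr_mem_sandwich (u := u) (v := v) hF hor
  have hnot := opNot_mem_sandwich hF hite hu hv
  have hc : Has Cont f ∨ ceilOp opBigOr ∈ F :=
    hc.imp_right fun h => h.elim id (ceil_mem_of_opIte_of_floor hF hite)
  rcases hc with hc | hc
  · exact mem_of_Cont hS hand' hor' hc (.inr (opIte_mem_of_opNot hS hnot hor')) (.inr h1)
      (.inr h0)
  · exact mem_of_Borel hS h0 hnot (opBigOr_mem_sandwich hF hor hc hu hv) hf


/-! ### Infinitary connectives from discontinuous functions -/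

open Classical in
theorem has_opBigOr_iff : opBigOr ∈ F ↔
    Has (n := .omega) F (fun z : ℕ → Bool => decide (∃ j, z j = true)) := Iff.rfl

open Classical in
theorem has_ceil_opBigOr_iff : ceilOp opBigOr ∈ F ↔
    Has (n := .omega) F (fun z : ℕ → Bool => z 0 && decide (∃ j, z (j + 1) = true)) := Iff.rfl

/-- At a point where some property of finite type fails, there is a sequence of witnesses that
converges to the point, with explicit moduli of convergence. -/
theorem exists_seq_of_forall_finset {p : (n.Idx → Bool) → Prop} {x : n.Idx → Bool}
    (h : ∀ s : Finset n.Idx, ∃ y, (∀ i ∈ s, y i = x i) ∧ p y) :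
    ∃ (y : ℕ → n.Idx → Bool) (k : n.Idx → ℕ), (∀ i j, k i ≤ j → y j i = x i) ∧ ∀ j, p (y j) := by
  obtain ⟨s, hs, hs'⟩ := exists_exhaustion n
  choose y hy hp using h
  choose k hk using hs'
  exact ⟨fun j => y (s j), k, fun i j hij => hy _ i (hs hij (hk i)), fun j => hp _⟩

theorem exists_seq_of_not_Lim0 {f : n.Fn} (hl : ¬Has Lim0 f) :
    ∃ (y : ℕ → n.Idx → Bool) (k : n.Idx → ℕ), (∀ i j, k i ≤ j → y j i = false) ∧
      ∀ j, f (y j) = true := by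
  refine exists_seq_of_forall_finset (x := fun _ => false) (p := fun y => f y = true) fun s => ?_
  rw [has_Lim0] at hl
  push Not at hl
  obtain ⟨y, hy, hfy⟩ := hl s
  exact ⟨y, hy, by simpa using hfy⟩

open Classical in
/-- Here `⋁ y` is obtained as `f (h y)` where `h y` is zero if `y` is, and lies above the `j`-th
witness of discontinuity if `y j = 1`; its coordinates are finite joins. -/
theorem opBigOr_mem_of_Mono (hF : IsClone F) (hor : opOr ∈ F) {f : Op} (hf : f ∈ F)
    (hm : f ∈ Mono) (h0 : f ∈ Cons0) (hl : f ∉ Lim0) : opBigOr ∈ F := by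
  obtain ⟨n, f⟩ := f
  obtain ⟨y, k, hy, hfy⟩ := exists_seq_of_not_Lim0 hl
  have hfin : ∀ l, Has (n := .omega) F fun z : ℕ → Bool => decide (∃ j ≤ l, z j = true) := by
    intro l
    induction l with
    | zero => exact (hF.proj (n := .omega) (0 : ℕ)).congr fun z => by simp
    | succ l ih =>
      refine (hF.or hor ih (hF.proj (n := .omega) (l + 1 : ℕ))).congr fun z => ?_
      rw [Bool.eq_iff_iff]
      simp only [Bool.or_eq_true, decide_eq_true_eq]
      constructor
      · rintro (⟨j, hj, hz⟩ | h)
        · exact ⟨j, by omega, hz⟩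
        · exact ⟨_, le_rfl, h⟩
      · rintro ⟨j, hj, hz⟩
        rcases Nat.le_succ_iff.1 hj with h | rfl
        · exact .inl ⟨j, h, hz⟩
        · exact .inr hz
  refine has_opBigOr_iff.2 ((hF.comp hf fun i => hfin (k i)).congr fun z => ?_)
  by_cases hz : ∃ j : ℕ, z j = true
  · rw [decide_eq_true hz]
    obtain ⟨j, hj⟩ := hz
    refine Bool.le_iff_imp.1 (has_Mono.1 hm fun i => Bool.le_iff_imp.2 fun hi => ?_) (hfy j)
    refine decide_eq_true ⟨j, ?_, hj⟩
    by_contra hij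
    rw [hy i j (by omega)] at hi
    simp at hi
  · rw [decide_eq_false hz]
    rw [← has_Cons0.1 h0]
    exact congrArg f (funext fun i => decide_eq_false fun ⟨j, _, hj⟩ => hz ⟨j, hj⟩)

open Classical in
/-- This is the construction of `opBigOr_mem_of_Mono` at a point `x` other than `0`, with an
additional variable below everything in place of the constant `1`. -/
theorem ceil_mem_of_Mono (hF : IsClone F) (hc : ceilOp opOr ∈ F) {f : Op} (hf : f ∈ F)
    (hm : f ∈ Mono) (hd : f ∉ Decr) : ceilOp opBigOr ∈ F := by
  obtain ⟨n, f⟩ := f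
  have : ∃ x, f x = false ∧ ∀ s : Finset n.Idx, (∀ i ∈ s, x i = false) →
      ∃ y, (∀ i ∈ s, y i = false) ∧ f y = true := by
    have hd : ¬Has Decr f := hd
    rw [has_Decr] at hd
    push Not at hd
    simpa using hd
  obtain ⟨x, hx, hs⟩ := this
  obtain ⟨y, k, hy, hfy⟩ := exists_seq_of_forall_finset (x := x)
    (p := fun y => f y = true) fun s => by
      obtain ⟨y, hy, hfy⟩ := hs (s.filter fun i => x i = false) (by simp)
      -- above `x i = 1`, the witness may be replaced by a larger one
      refine ⟨fun i => x i || y i, fun i hi => ?_, ?_⟩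
      · cases hxi : x i
        · simp [hxi, hy i (by simp [hi, hxi])]
        · simp [hxi]
      · exact Bool.le_iff_imp.1 (has_Mono.1 hm fun i => Bool.le_iff_imp.2 fun h => by simp [h]) hfy
  have hc' : ∀ {a b : Arity.omega.Fn}, Has F a → Has F b →
      Has (n := .omega) F fun z => z (0 : ℕ) && (a z || b z) := fun {a b} ha hb =>
    hF.comp_oneAdd (n := .fin 1) hc (hF.proj (n := .omega) (0 : ℕ)) (f := ![a, b])
      (Fin.forall_fin_two.2 ⟨ha, hb⟩) fun z w h0 h1 => by
        change (w (0 : Fin 3) && (w (1 : Fin 3) || w (2 : Fin 3))) = _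
        rw [show w (0 : Fin 3) = _ from h0, show w (1 : Fin 3) = _ from h1 (0 : Fin 2),
          show w (2 : Fin 3) = _ from h1 (1 : Fin 2)]
        rfl
  have hfin : ∀ l, Has (n := .omega) F
      fun z : ℕ → Bool => z 0 && decide (∃ j ≤ l, z (j + 1) = true) := by
    intro l
    induction l with
    | zero =>
      exact (hc' (hF.proj (n := .omega) (1 : ℕ)) (hF.proj (n := .omega) (1 : ℕ))).congr
        fun z => by simp
    | succ l ih =>
      refine (hc' ih (hF.proj (n := .omega) (l + 2 : ℕ))).congr fun z => ?_
      rw [Bool.eq_iff_iff]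
      simp only [Bool.or_eq_true, Bool.and_eq_true, decide_eq_true_eq]
      constructor
      · rintro ⟨h0, ⟨-, j, hj, hz⟩ | h⟩
        · exact ⟨h0, j, by omega, hz⟩
        · exact ⟨h0, _, le_rfl, h⟩
      · rintro ⟨h0, j, hj, hz⟩
        rcases Nat.le_succ_iff.1 hj with h | rfl
        · exact ⟨h0, .inl ⟨h0, j, h, hz⟩⟩
        · exact ⟨h0, .inr hz⟩
  let h : n.Idx → Arity.omega.Fn := fun i =>
    if x i = true then fun z => z (0 : ℕ)
    else fun z : ℕ → Bool => z 0 && decide (∃ j ≤ k i, z (j + 1) = true)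
  have hh : ∀ i, Has F (h i) := fun i => by
    by_cases hi : x i = true
    · simpa only [h, if_pos hi] using hF.proj (n := .omega) (0 : ℕ)
    · simpa only [h, if_neg hi] using hfin (k i)
  refine has_ceil_opBigOr_iff.2 ((hF.comp hf hh).congr fun z => ?_)
  have hle : ∀ w, w ≤ x → f w = false := fun w hw => by
    have := has_Mono.1 hm hw
    rw [hx] at this
    exact le_bot_iff.1 this
  cases h0 : z (0 : ℕ)
  · rw [Bool.false_and]
    refine hle _ fun i => Bool.le_iff_imp.2 fun hi => ?_
    by_cases hxi : x i = true <;> simp [h, hxi, h0] at hi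
  rw [Bool.true_and]
  by_cases hz : ∃ j : ℕ, z (j + 1 : ℕ) = true
  · rw [decide_eq_true hz]
    obtain ⟨j, hj⟩ := hz
    refine Bool.le_iff_imp.1 (has_Mono.1 hm fun i => Bool.le_iff_imp.2 fun hi => ?_) (hfy j)
    by_cases hxi : x i = true
    · simp only [h, if_pos hxi, h0]
    · simp only [h, if_neg hxi, h0, Bool.true_and]
      refine decide_eq_true ⟨j, ?_, hj⟩
      by_contra hij
      exact hxi (by rw [← hy i j (by omega), hi])
  · rw [decide_eq_false hz]
    refine hle _ fun i => Bool.le_iff_imp.2 fun hi => ?_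
    by_contra hxi
    simp only [h, if_neg hxi, h0, Bool.true_and, decide_eq_true_eq] at hi
    obtain ⟨j, -, hj⟩ := hi
    exact hz ⟨j, hj⟩

open Classical in
/-- The point `y j` for the first `j` with `w j = 1`, and `x` if there is none. -/
noncomputable def select (x : n.Idx → Bool) (y : ℕ → n.Idx → Bool) (w : ℕ → Bool) :
    n.Idx → Bool :=
  if h : ∃ j, w j = true then y (Nat.find h) else x

section

variable {x : n.Idx → Bool} {y : ℕ → n.Idx → Bool} {w w' : ℕ → Bool} {i : n.Idx} {k : ℕ}

theorem select_of_forall_not (h : ∀ j, w j = false) : select x y w = x :=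
  dif_neg (by simp [h])

theorem exists_select_eq (h : ∃ j, w j = true) : ∃ j, select x y w = y j :=
  ⟨_, dif_pos h⟩

theorem select_congr (hk : ∀ j, k ≤ j → y j i = x i) (hw : ∀ j, j < k → w j = w' j) :
    select x y w i = select x y w' i := by
  classical
  have key : ∀ w, (∀ j, j < k → w j = false) → select x y w i = x i := by
    intro w hw
    by_cases h : ∃ j, w j = true
    · rw [select, dif_pos h]
      refine hk _ ?_
      by_contra hlt
      have := Nat.find_spec h
      rw [hw _ (by omega)] at this
      simp at this
    · rw [select, dif_neg h]
  by_cases h : ∃ j, j < k ∧ w j = true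
  · obtain ⟨j, hj, hwj⟩ := h
    have h1 : ∃ j, w j = true := ⟨j, hwj⟩
    have h2 : ∃ j, w' j = true := ⟨j, by rwa [← hw j hj]⟩
    have hlt : Nat.find h1 < k := (Nat.find_min' h1 hwj).trans_lt hj
    have : Nat.find h2 = Nat.find h1 := (Nat.find_eq_iff h2).2
      ⟨by rw [← hw _ hlt]; exact Nat.find_spec h1, fun l hl => by
        rw [← hw l (hl.trans hlt)]
        exact Nat.find_min h1 hl⟩
    rw [select, select, dif_pos h1, dif_pos h2, this]
  · push Not at h
    have h : ∀ j, j < k → w j = false := fun j hj => by simpa using h j hj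
    rw [key w h, key w' fun j hj => (hw j hj) ▸ h j hj]

end

open Classical in
theorem opBigOr_mem_of_opIte (hF : IsClone F) (hite : opIte ∈ F) {f : Op} (hf : f ∈ F)
    (h0 : f ∈ Cons0) (hl : f ∉ Lim0) : opBigOr ∈ F := by
  obtain ⟨n, f⟩ := f
  obtain ⟨y, k, hy, hfy⟩ := exists_seq_of_not_Lim0 hl
  have hand := opAnd_mem_of_opIte hF hite
  have hor := opOr_mem_of_opIte hF hite
  -- the variable `z 0` is added to preserve the constant `1`
  let h : n.Idx → Arity.omega.Fn := fun i z => z (0 : ℕ) || select (fun _ => false) y z i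
  have hh : ∀ i, Has F (h i) := fun i => by
    refine mem_of_Cont hF hand hor (has_Cont.2 ⟨Finset.range (k i + 1), fun z z' hz => ?_⟩)
      (.inr hite) (.inl (has_Cons0.2 ?_)) (.inl (has_Cons1.2 ?_))
    · have h1 : z (0 : ℕ) = z' (0 : ℕ) := hz (0 : ℕ) (by simp)
      have h2 := select_congr (x := fun _ => false) (y := y) (w := z) (w' := z') (hy i)
        fun j hj => hz j (by simp; omega)
      simp only [h, h1, h2]
    · simp only [h]
      rw [select_of_forall_not fun _ => rfl]
      rfl
    · simp only [h, Bool.true_or]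
  refine has_opBigOr_iff.2
    ((hF.or hor (hF.proj (n := .omega) (0 : ℕ)) (hF.comp hf hh)).congr fun z => ?_)
  cases hz0 : z (0 : ℕ)
  · rw [Bool.false_or]
    have : (fun i => h i z) = select (fun _ => false) y z := by
      funext i
      simp only [h, hz0, Bool.false_or]
    rw [this]
    by_cases hz : ∃ j : ℕ, z j = true
    · obtain ⟨j, hj⟩ := exists_select_eq (x := fun _ => false) (y := y) hz
      rw [hj, decide_eq_true hz, hfy]
    · rw [decide_eq_false hz, select_of_forall_not (fun j => by simpa using not_exists.1 hz j),
        has_Cons0.1 h0]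
  · rw [Bool.true_or, decide_eq_true (⟨0, hz0⟩ : ∃ j : ℕ, z j = true)]

open Classical in
/-- Here a discontinuity at `x` is turned into `⌈⋁⌉`. The variable below everything, `z 0`, and
the variable `z 1` of the join allow to use only functions preserving both constants. -/
theorem ceil_mem_of_opIte (hF : IsClone F) (hite : opIte ∈ F) {f : Op} (hf : f ∈ F)
    (hc : f ∉ Cont) : ceilOp opBigOr ∈ F := by
  obtain ⟨n, f⟩ := f
  have hand := opAnd_mem_of_opIte hF hite
  have hor := opOr_mem_of_opIte hF hite
  have : ∃ x, ∀ s : Finset n.Idx, ∃ y, (∀ i ∈ s, y i = x i) ∧ f y ≠ f x := by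
    by_contra! h
    exact hc (has_Cont_of_forall h)
  obtain ⟨x, hx⟩ := this
  obtain ⟨y, k, hy, hfy⟩ := exists_seq_of_forall_finset (p := fun y => f y ≠ f x) hx
  let h : n.Idx → Arity.omega.Fn := fun i z =>
    z (0 : ℕ) && (z (1 : ℕ) || select x y (fun j : ℕ => z (j + 1 : ℕ)) i)
  have hh : ∀ i, Has F (h i) := fun i => by
    refine mem_of_Cont hF hand hor (has_Cont.2 ⟨Finset.range (k i + 2), fun z z' hz => ?_⟩)
      (.inr hite) (.inl (has_Cons0.2 ?_)) (.inl (has_Cons1.2 ?_))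
    · have h0 : z (0 : ℕ) = z' (0 : ℕ) := hz (0 : ℕ) (by simp)
      have h1 : z (1 : ℕ) = z' (1 : ℕ) := hz (1 : ℕ) (by simp)
      have h2 := select_congr (x := x) (y := y) (w := fun j => z (j + 1 : ℕ))
        (w' := fun j => z' (j + 1 : ℕ)) (hy i)
        fun j hj => hz (j + 1 : ℕ) (Finset.mem_range.2 (by omega))
      simp only [h, h0, h1, h2]
    · simp only [h, Bool.false_and]
    · simp only [h, Bool.true_or, Bool.and_self]
  have hp0 := hF.proj (n := .omega) (0 : ℕ)
  have hp1 := hF.proj (n := .omega) (1 : ℕ)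
  have hfh := hF.comp hf hh
  have key : Has (n := .omega) F
      fun z => z (0 : ℕ) && (z (1 : ℕ) || (f fun i => h i z).xor (f x)) := by
    cases hfx : f x
    · exact (hF.and hand hp0 (hF.or hor hp1 hfh)).congr fun z => by simp
    · refine (hF.ite hite hfh (hF.and hand hp0 hp1) hp0).congr fun z => ?_
      cases z (0 : ℕ) <;> cases z (1 : ℕ) <;> simp
  refine has_ceil_opBigOr_iff.2 (key.congr fun z => ?_)
  cases hz0 : z (0 : ℕ)
  · rfl
  rw [Bool.true_and, Bool.true_and]
  cases hz1 : z (1 : ℕ)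
  · have : (fun i => h i z) = select x y (fun j : ℕ => z (j + 1 : ℕ)) := by
      funext i
      simp only [h, hz0, hz1, Bool.true_and, Bool.false_or]
    rw [this, Bool.false_or]
    by_cases hz : ∃ j : ℕ, z (j + 1 : ℕ) = true
    · obtain ⟨j, hj⟩ := exists_select_eq (x := x) (y := y) hz
      rw [hj, decide_eq_true hz]
      have := hfy j
      revert this
      cases f (y j) <;> cases f x <;> simp
    · rw [decide_eq_false hz, select_of_forall_not (fun j => by simpa using not_exists.1 hz j)]
      simp
  · rw [Bool.true_or, decide_eq_true (⟨0, hz1⟩ : ∃ j : ℕ, z (j + 1 : ℕ) = true)]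

theorem ceil_opOr_mem (hF : IsClone F) (hand : opAnd ∈ F) (hor : opOr ∈ F) :
    ceilOp opOr ∈ F :=
  have p (i : (Arity.fin 2).Idx) : Has F fun x : (Arity.fin 2).Idx → Bool => x i := hF.proj i
  hF.and hand (p 0) (hF.or hor (p 1) (p 2))

/-! ### Dual forms -/

theorem opBigAnd_mem_of_Mono (hF : IsClone F) (hand : opAnd ∈ F) {f : Op} (hf : f ∈ F)
    (hm : f ∈ Mono) (h1 : f ∈ Cons1) (hl : f ∉ Lim1) : opBigAnd ∈ F := by
  rw [← deMorgan_opBigOr]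
  exact opBigOr_mem_of_Mono hF.dualSet (f := deMorgan f) (mem_dualSet.2 (by rwa [deMorgan_opOr]))
    (mem_dualSet.2 (by rwa [deMorgan_deMorgan])) (deMorgan_mem_Mono.2 hm)
    (deMorgan_mem_Cons0.2 h1) (mt deMorgan_mem_Lim0.1 hl)

theorem floor_mem_of_Mono (hF : IsClone F) (hand : opAnd ∈ F) (hor : opOr ∈ F) {f : Op}
    (hf : f ∈ F) (hm : f ∈ Mono) (hi : f ∉ Incr) : floorOp opBigAnd ∈ F := by
  rw [← deMorgan_ceil_opBigOr]
  exact ceil_mem_of_Mono hF.dualSet (f := deMorgan f)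
    (ceil_opOr_mem hF.dualSet (mem_dualSet.2 (by rwa [deMorgan_opAnd]))
      (mem_dualSet.2 (by rwa [deMorgan_opOr])))
    (mem_dualSet.2 (by rwa [deMorgan_deMorgan])) (deMorgan_mem_Mono.2 hm)
    (mt deMorgan_mem_Decr.1 hi)

theorem opIte_mem_dualSet (hF : IsClone F) (hite : opIte ∈ F) : opIte ∈ dualSet F :=
  have p (i : (Arity.fin 2).Idx) : Has F fun x : (Arity.fin 2).Idx → Bool => x i := hF.proj i
  has_dualSet.2 ((hF.ite hite (p 0) (p 2) (p 1)).congr fun x => by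
    change _ = !((!x (0 : Fin 3) && !x (1 : Fin 3)) || (!!x (0 : Fin 3) && !x (2 : Fin 3)))
    cases x (0 : Fin 3) <;> cases x (1 : Fin 3) <;> cases x (2 : Fin 3) <;> rfl)

theorem opBigAnd_mem_of_opIte (hF : IsClone F) (hite : opIte ∈ F) {f : Op} (hf : f ∈ F)
    (h1 : f ∈ Cons1) (hl : f ∉ Lim1) : opBigAnd ∈ F := by
  rw [← deMorgan_opBigOr]
  exact opBigOr_mem_of_opIte hF.dualSet (f := deMorgan f) (opIte_mem_dualSet hF hite)
    (mem_dualSet.2 (by rwa [deMorgan_deMorgan])) (deMorgan_mem_Cons0.2 h1)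
    (mt deMorgan_mem_Lim0.1 hl)

/-! ### Implications between the infinitary connectives -/

open Classical in
theorem opOr_mem_of_opBigOr (hF : IsClone F) (h : opBigOr ∈ F) : opOr ∈ F := by
  refine (hF.bigOr h (a := fun i : ℕ => fun x : (Arity.fin 1).Idx → Bool =>
    x (if i = 0 then (0 : Fin 2) else (1 : Fin 2))) fun i => hF.proj _).congr fun x => ?_
  rw [Bool.eq_iff_iff, decide_eq_true_iff]
  change _ ↔ (x (0 : Fin 2) || x (1 : Fin 2)) = true
  rw [Bool.or_eq_true]
  constructor
  · rintro ⟨i, hi⟩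
    split_ifs at hi
    exacts [.inl hi, .inr hi]
  · rintro (h | h)
    exacts [⟨0, h⟩, ⟨1, h⟩]

theorem opAnd_mem_of_opBigAnd (hF : IsClone F) (h : opBigAnd ∈ F) : opAnd ∈ F := by
  rw [← deMorgan_opOr]
  exact opOr_mem_of_opBigOr hF.dualSet (mem_dualSet.2 (by rwa [deMorgan_opBigOr]))

open Classical in
theorem ceil_mem_of_opBigOr (hF : IsClone F) (hand : opAnd ∈ F) (h : opBigOr ∈ F) :
    ceilOp opBigOr ∈ F :=
  has_ceil_opBigOr_iff.2 (hF.and hand (hF.proj (n := .omega) (0 : ℕ))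
    (hF.bigOr h fun j : ℕ => hF.proj (n := .omega) (j + 1 : ℕ)))

theorem floor_mem_of_opBigAnd (hF : IsClone F) (hor : opOr ∈ F) (h : opBigAnd ∈ F) :
    floorOp opBigAnd ∈ F := by
  rw [← deMorgan_ceil_opBigOr]
  exact ceil_mem_of_opBigOr hF.dualSet (mem_dualSet.2 (by rwa [deMorgan_opAnd]))
    (mem_dualSet.2 (by rwa [deMorgan_opBigOr]))

open Classical in
theorem opBigOr_mem_of_ceil (hF : IsClone F) (h1 : opOne ∈ F) (h : ceilOp opBigOr ∈ F) :
    opBigOr ∈ F :=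
  has_opBigOr_iff.2 ((hF.ceilBigOr h (hF.one (m := .omega) h1)
    fun j : ℕ => hF.proj (n := .omega) j).congr fun z => by rw [Bool.true_and])

theorem opBigAnd_mem_of_floor (hF : IsClone F) (h0 : opZero ∈ F) (h : floorOp opBigAnd ∈ F) :
    opBigAnd ∈ F := by
  rw [← deMorgan_opBigOr]
  exact opBigOr_mem_of_ceil hF.dualSet (mem_dualSet.2 (by rwa [deMorgan_opOne]))
    (mem_dualSet.2 (by rwa [deMorgan_ceil_opBigOr]))

open Classical in
theorem opAnd_mem_of_ceil (hF : IsClone F) (h : ceilOp opBigOr ∈ F) : opAnd ∈ F :=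
  (hF.ceilBigOr h (hF.proj (n := .fin 1) (0 : Fin 2))
    fun _ : ℕ => hF.proj (n := .fin 1) (1 : Fin 2)).congr fun x => by simp

theorem opOr_mem_of_floor (hF : IsClone F) (h : floorOp opBigAnd ∈ F) : opOr ∈ F := by
  rw [← deMorgan_opAnd]
  exact opAnd_mem_of_ceil hF.dualSet (mem_dualSet.2 (by rwa [deMorgan_ceil_opBigOr]))

theorem floor_mem_of_opIte_of_ceil (hF : IsClone F) (hite : opIte ∈ F)
    (h : ceilOp opBigOr ∈ F) : floorOp opBigAnd ∈ F := by
  rw [← deMorgan_ceil_opBigOr]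
  exact ceil_mem_of_opIte_of_floor hF.dualSet (opIte_mem_dualSet hF hite)
    (mem_dualSet.2 (by rwa [deMorgan_floor_opBigAnd]))


/-! ### The extremal Borel clones over a finitary clone -/

theorem exists_equiv_fin (T : Type*) [Finite T] [Nonempty T] : ∃ k, Nonempty (T ≃ Fin (k + 1)) :=
  ⟨Nat.card T - 1, ⟨(Finite.equivFin T).trans
    (finCongr (Nat.sub_add_cancel Finite.card_pos).symm)⟩⟩

/-- The Borel functions all of whose minors of finite arity belong to `G`. For a finitary clone `G`
this is the largest Borel clone over `G`, the smallest one being `gen G`. -/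
def maxExt (G : Set Op) : Set Op :=
  {f | f ∈ borelOps ∧ ∀ (k : ℕ) (σ : f.1.Idx → (Arity.fin k).Idx),
    Has G (fun x : (Arity.fin k).Idx → Bool => f.2 fun i => x (σ i))}

/-- Composition of functions `g` and `f i` with all finite minors in `G`: at finite arity there are
only finitely many functions `f i`, so that `g` may be replaced by a finite minor. -/
theorem isClone_maxExt (hG : IsFinitaryClone G) : IsClone (maxExt G) where
  arity_mem _ _ := trivial
  proj_mem n _ i := ⟨isClone_borelOps.proj i, fun k σ => hG.proj_mem _ ⟨k, rfl⟩ (σ i)⟩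
  comp_mem m _ n _ g f hg hf := by
    refine ⟨isClone_borelOps.comp hg.1 fun i => (hf i).1, fun k σ => ?_⟩
    let T := {h : (Arity.fin k).Fn // Has G h}
    have : Finite (Arity.fin k).Fn := inferInstanceAs (Finite ((Fin (k + 1) → Bool) → Bool))
    let τ : n.Idx → T := fun i => ⟨_, (hf i).2 k σ⟩
    have : Nonempty T := ⟨τ n.zero⟩
    obtain ⟨l, ⟨e⟩⟩ := exists_equiv_fin T
    have := hG.comp_mem (.fin k) ⟨k, rfl⟩ (.fin l) ⟨l, rfl⟩ _ (fun j => (e.symm j).1)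
      (hg.2 l fun i => e (τ i)) fun j => (e.symm j).2
    simpa [τ] using this

theorem finPart_maxExt (hG : IsFinitaryClone G) : finPart (maxExt G) = G := by
  refine Set.Subset.antisymm ?_ fun f hf => ?_
  · rintro ⟨n, f⟩ ⟨hf, k, rfl⟩
    exact hf.2 k id
  · obtain ⟨n, f⟩ := f
    obtain ⟨l, rfl⟩ := hG.arity_mem _ hf
    exact ⟨⟨mem_borelOps_of_fin f, fun k σ => hG.comp_mem (.fin k) ⟨k, rfl⟩ (.fin l) ⟨l, rfl⟩ f _ hf
      fun i => hG.proj_mem _ ⟨k, rfl⟩ (σ i)⟩, l, rfl⟩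

theorem subset_maxExt (hF : IsClone F) (hB : F ⊆ borelOps) (h : finPart F ⊆ G) :
    F ⊆ maxExt G := fun f hf =>
  ⟨hB hf, fun k σ => h ⟨hF.minor (n := f.1) (f := f.2) hf σ, k, rfl⟩⟩

theorem maxExt_mem_fiber (hG : IsFinitaryClone G) : maxExt G ∈ fiber G :=
  ⟨⟨isClone_maxExt hG, fun _ h => h.1⟩, finPart_maxExt hG⟩

theorem subset_finitaryOps (hG : IsFinitaryClone G) : G ⊆ finitaryOps := fun _ h =>
  hG.arity_mem _ h

theorem gen_mem_fiber (hG : IsFinitaryClone G) : gen G ∈ fiber G := by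
  have h : gen G ⊆ maxExt G := gen_subset (isClone_maxExt hG)
    fun f hf => ((finPart_maxExt hG).symm ▸ hf : f ∈ finPart (maxExt G)).1
  exact ⟨⟨isClone_gen _, h.trans fun _ h => h.1⟩, Set.Subset.antisymm
    (fun f hf => finPart_maxExt hG ▸ ⟨h hf.1, hf.2⟩)
    fun f hf => ⟨subset_gen G hf, subset_finitaryOps hG hf⟩⟩

theorem gen_subset_of_mem_fiber (hF : F ∈ fiber G) : gen G ⊆ F :=
  gen_subset hF.1.1 fun f hf => (hF.2.symm ▸ hf : f ∈ finPart F).1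

theorem subset_maxExt_of_mem_fiber (hF : F ∈ fiber G) : F ⊆ maxExt G :=
  subset_maxExt hF.1.1 hF.1.2 hF.2.subset

/-- Invariance of a relation of finite arity is a property of the finitary part of a clone. -/
theorem subset_Pol_of_finPart (hF : IsClone F) {k : ℕ} {R : Set ((Arity.fin k).Idx → Bool)}
    (h : finPart F ⊆ Pol {⟨.fin k, R⟩}) : F ⊆ Pol {⟨.fin k, R⟩} := by
  rintro ⟨n, f⟩ hf
  rw [mem_Pol_singleton]
  intro x hx
  let τ : n.Idx → R := fun j => ⟨fun i => x i j, hx j⟩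
  have : Nonempty R := ⟨τ n.zero⟩
  have : Finite R := inferInstanceAs (Finite {c : Fin (k + 1) → Bool // c ∈ R})
  obtain ⟨l, ⟨e⟩⟩ := exists_equiv_fin R
  have := mem_Pol_singleton.1 (h ⟨hF.minor hf (m := .fin l) fun j => e (τ j), l, rfl⟩)
    (fun i j => (e.symm j).1 i) fun j => (e.symm j).2
  simpa [τ] using this

/-! ### Affine functions -/

open MeasureTheory in
/-- Automatic continuity: one of the two cosets of the kernel of a Borel homomorphism has positive
Haar measure, so the kernel is a neighbourhood of `0`. -/
theorem mem_Cont_of_Aff {f : Op} (hf : f ∈ Aff) (hB : f ∈ borelOps) : f ∈ Cont := by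
  obtain ⟨n, f⟩ := f
  have hB : Measurable f := hB
  have ha := has_Aff.1 hf
  let : AddCommGroup Bool :=
    { add := xor
      zero := false
      neg := id
      nsmul := nsmulRec
      zsmul := zsmulRec
      add_assoc := by decide
      zero_add := by decide
      add_zero := by decide
      neg_add_cancel := by decide
      add_comm := by decide }
  have : IsTopologicalAddGroup Bool :=
    { continuous_add := continuous_of_discreteTopology
      continuous_neg := continuous_of_discreteTopology }
  have hadd : ∀ x y : n.Idx → Bool, f (x + y) = ((f x).xor (f y)).xor (f 0) := fun x y => by
    rw [← ha]
    congr 1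
    funext i
    exact (Bool.xor_false _).symm
  have hsub : ∀ x y : n.Idx → Bool, f (x - y) = ((f x).xor (f y)).xor (f 0) := fun x y => by
    rw [sub_eq_add_neg]
    exact hadd x y
  have hE : MeasurableSet {x | f x = f 0} := hB (measurableSet_singleton (f 0))
  let μ : Measure (n.Idx → Bool) := Measure.addHaar
  have hpos : 0 < μ {x | f x = f 0} := by
    rw [pos_iff_ne_zero]
    intro h0
    have huniv : μ Set.univ ≠ 0 := (isOpen_univ.measure_pos μ Set.univ_nonempty).ne'
    by_cases h : ∃ a, f a ≠ f 0
    · obtain ⟨a, ha⟩ := h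
      have h1 : μ ((fun x => x + a) ⁻¹' {x | f x = f 0}) = 0 := by
        rw [measure_preimage_add_right, h0]
      refine huniv (measure_mono_null (fun x _ => ?_) (measure_union_null h0 h1))
      change f x = f 0 ∨ f (x + a) = f 0
      rw [hadd]
      revert ha
      cases f x <;> cases f a <;> cases f 0 <;> simp
    · push Not at h
      exact huniv (measure_mono_null (fun x _ => h x) h0)
  obtain ⟨s, hs⟩ := exists_finset_of_mem_nhds
    (Measure.sub_mem_nhds_zero_of_addHaar_pos μ _ hE hpos)
  refine has_Cont.2 ⟨s, fun x y hxy => ?_⟩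
  obtain ⟨a, ha, b, hb, hab⟩ := hs (x - y) fun i hi => by
    rw [Pi.sub_apply, hxy i hi, sub_self]
    rfl
  have ha : f a = f 0 := ha
  have hb : f b = f 0 := hb
  have h1 := hsub a b
  have h2 := hsub x y
  rw [show a - b = x - y from hab, h2, ha, hb] at h1
  revert h1
  cases f x <;> cases f y <;> cases f 0 <;> simp

theorem maxExt_subset_gen (hG : IsFinitaryClone G) (h : G ⊆ Aff) : maxExt G ⊆ gen G := by
  have hX := isClone_maxExt hG
  intro f hf
  refine mem_of_mem_Cont (isClone_gen G) hX ((finPart_maxExt hG).subset.trans (subset_gen G)) hf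
    (mem_Cont_of_Aff (subset_Pol_of_finPart (k := 3) hX ?_ hf) hf.1)
  exact (finPart_maxExt hG).subset.trans h

theorem borelPart_pointwiseClosure_subset_maxExt (hG : IsFinitaryClone G) :
    borelPart (pointwiseClosure (gen G)) ⊆ maxExt G := by
  rintro ⟨n, f⟩ ⟨hf, hB⟩
  refine ⟨hB, fun k σ => ?_⟩
  let Φ : n.Fn → (Arity.fin k).Fn := fun g x => g fun i => x (σ i)
  have hΦ : Continuous Φ := continuous_pi fun x => continuous_apply _
  have : DiscreteTopology (Arity.fin k).Fn :=
    inferInstanceAs (DiscreteTopology ((Fin (k + 1) → Bool) → Bool))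
  have h1 : Φ f ∈ closure {g : (Arity.fin k).Fn | Has G g} :=
    map_mem_closure hΦ hf fun g hg => (gen_mem_fiber hG).2.subset
      ⟨(isClone_gen G).minor (n := n) (f := g) hg σ, k, rfl⟩
  rwa [(isClosed_discrete _).closure_eq] at h1

/-! ### The correspondence between a self-dual clone and a clone containing `0` -/

/-- The functions `f` with `β(f)` in `F`. The functions `β(f)` are the self-dual functions of
arity `1 + n`, so a clone of self-dual functions is determined by this clone. -/
def betaClone (F : Set Op) : Set Op := {f | beta f ∈ F}

theorem isClone_betaClone (hF : IsClone F) : IsClone (betaClone F) where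
  arity_mem _ _ := trivial
  proj_mem n _ i := (hF.proj (n.next i)).congr fun x => by
    cases x n.first <;> simp [deMorgan]
  comp_mem m _ n _ g f hg hf := (hF.beta hg (hF.proj m.first) hf).congr fun x => by
    cases h : x m.first <;> simp [h, deMorgan]

theorem mem_betaClone_of_Dual (hF : IsClone F) {f : Op} (hf : f ∈ F) (hd : f ∈ Dual) :
    f ∈ betaClone F := by
  obtain ⟨n, f⟩ := f
  have := has_Dual.1 hd
  exact (hF.minor hf n.next).congr fun x => by
    cases x n.first <;> simp [deMorgan, this fun i => x (n.next i)]

theorem mem_of_mem_betaClone (hF : IsClone F) {f : Op} (hf : f ∈ betaClone F) (hd : f ∈ Dual) :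
    f ∈ F := by
  obtain ⟨n, f⟩ := f
  have := has_Dual.1 hd
  exact (hF.beta (n := n) hf (hF.proj (n := n) n.zero) fun i => hF.proj i).congr fun x => by
    cases x n.zero <;> simp [this fun i => x i]

theorem opZero_mem_betaClone (hF : IsClone F) : opZero ∈ betaClone F :=
  (hF.proj (Arity.first (.fin 0))).congr fun x => by
    cases h : x (Arity.first (.fin 0)) <;> simp [h, deMorgan, opZero]

theorem beta_opAnd : beta opAnd = opMedian := by
  refine Sigma.ext rfl (heq_of_eq (funext fun x => ?_))
  change (bif x (0 : Fin 3) then !(!x (1 : Fin 3) && !x (2 : Fin 3))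
    else (x (1 : Fin 3) && x (2 : Fin 3))) = ((x (0 : Fin 3) && x (1 : Fin 3)) ||
      (x (0 : Fin 3) && x (2 : Fin 3)) || (x (1 : Fin 3) && x (2 : Fin 3)))
  cases x (0 : Fin 3) <;> cases x (1 : Fin 3) <;> cases x (2 : Fin 3) <;> rfl

theorem IsCloneOn.betaOr (hF : IsClone F) (h : BorelClone.beta opOr ∈ F) {a b c : m.Fn}
    (ha : Has F a) (hb : Has F b) (hc : Has F c) :
    Has F (fun x => bif a x then (b x && c x) else (b x || c x)) :=
  (hF.beta (n := .fin 1) h ha (b := ![b, c]) (Fin.forall_fin_two.2 ⟨hb, hc⟩)).congr fun x => by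
    change (bif a x then !(!b x || !c x) else (b x || c x)) = _
    simp

/-- `β(∨)` is the median with its first argument negated, and negates itself away. -/
theorem opMedian_mem_of_beta_opOr (hF : IsClone F) (h : beta opOr ∈ F) : opMedian ∈ F :=
  have p (i : (Arity.fin 2).Idx) : Has F fun x : (Arity.fin 2).Idx → Bool => x i := hF.proj i
  (hF.betaOr h (hF.betaOr h (p 0) (p 1) (p 2)) (p 1) (p 2)).congr fun x => by
    cases x (0 : Fin 3) <;> cases x (1 : Fin 3) <;> cases x (2 : Fin 3) <;> rfl

/-- The sum of a full adder from its carry `c`: `x + y + z = m(¬c, z, m(¬c, x, y))`. -/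
theorem opXor3_mem_of_beta_opOr (hF : IsClone F) (h : beta opOr ∈ F) : opXor3 ∈ F :=
  have p (i : (Arity.fin 2).Idx) : Has F fun x : (Arity.fin 2).Idx → Bool => x i := hF.proj i
  have c := hF.median (opMedian_mem_of_beta_opOr hF h) (p 0) (p 1) (p 2)
  (hF.betaOr h c (p 2) (hF.betaOr h c (p 0) (p 1))).congr fun x => by
    cases x (0 : Fin 3) <;> cases x (1 : Fin 3) <;> cases x (2 : Fin 3) <;> rfl

/-! ### Clones with a function that is not affine -/

/-- From `0` and a binary function whose values have odd sum, one of `∧` and `∨` is obtained. -/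
theorem opAnd_or_opOr_mem_of_binary (hF : IsClone F) (h0 : opZero ∈ F) {p : (Arity.fin 1).Fn}
    (hp : Has F p) (hodd : p ![true, true] ≠
      ((p ![true, false]).xor (p ![false, true])).xor (p ![false, false])) :
    opAnd ∈ F ∨ opOr ∈ F := by
  have hx := hF.proj (n := .fin 1) (0 : Fin 2)
  have hy := hF.proj (n := .fin 1) (1 : Fin 2)
  have hz := hF.zero (m := .fin 1) h0
  cases h11 : p ![true, true] <;> cases h10 : p ![true, false] <;>
    cases h01 : p ![false, true] <;> cases h00 : p ![false, false] <;>
    simp only [h11, h10, h01, h00, Bool.xor_false, Bool.xor_true, Bool.not_true, Bool.not_false,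
      ne_eq, not_true_eq_false] at hodd
  · exact .inl ((hF.comp₂ hp (hF.comp₂ hp hx hx) (hF.comp₂ hp hy hy)).congr fun x => by
      cases h0 : x (0 : Fin 2) <;> cases h1 : x (1 : Fin 2) <;> simp [*])
  · exact .inl ((hF.comp₂ hp (hF.comp₂ hp hx hy) hy).congr fun x => by
      cases h0 : x (0 : Fin 2) <;> cases h1 : x (1 : Fin 2) <;> simp [*])
  · exact .inl ((hF.comp₂ hp hx (hF.comp₂ hp hx hy)).congr fun x => by
      cases h0 : x (0 : Fin 2) <;> cases h1 : x (1 : Fin 2) <;> simp [*])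
  · exact .inl ((hF.comp₂ hp (hF.comp₂ hp hx hy) (hF.comp₂ hp hx hy)).congr fun x => by
      cases h0 : x (0 : Fin 2) <;> cases h1 : x (1 : Fin 2) <;> simp [*])
  · exact .inl ((hF.comp₂ hp hx hy).congr fun x => by
      cases h0 : x (0 : Fin 2) <;> cases h1 : x (1 : Fin 2) <;> simp [*])
  · exact .inr ((hF.comp₂ hp (hF.comp₂ hp hx hz) hy).congr fun x => by
      cases h0 : x (0 : Fin 2) <;> cases h1 : x (1 : Fin 2) <;> simp [*])
  · exact .inr ((hF.comp₂ hp hx (hF.comp₂ hp hz hy)).congr fun x => by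
      cases h0 : x (0 : Fin 2) <;> cases h1 : x (1 : Fin 2) <;> simp [*])
  · exact .inr ((hF.comp₂ hp hx hy).congr fun x => by
      cases h0 : x (0 : Fin 2) <;> cases h1 : x (1 : Fin 2) <;> simp [*])

/-- A function that is additive on disjoint arguments is affine. -/
theorem has_Aff_of_disjoint {f : n.Fn} (h : ∀ a b : n.Idx → Bool, (∀ i, (a i && b i) = false) →
    f (fun i => a i || b i) = ((f a).xor (f b)).xor (f fun _ => false)) : Has Aff f := by
  have h2 : ∀ x y : n.Idx → Bool, f (fun i => (x i).xor (y i)) =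
      ((f x).xor (f y)).xor (f fun _ => false) := by
    intro x y
    have e1 := h (fun i => x i && !y i) (fun i => y i && !x i) fun i => by
      cases x i <;> cases y i <;> rfl
    have e2 := h (fun i => x i && !y i) (fun i => x i && y i) fun i => by
      cases x i <;> cases y i <;> rfl
    have e3 := h (fun i => y i && !x i) (fun i => x i && y i) fun i => by
      cases x i <;> cases y i <;> rfl
    have r1 : (fun i => (x i && !y i) || (y i && !x i)) = fun i => (x i).xor (y i) :=
      funext fun i => by cases x i <;> cases y i <;> rfl
    have r2 : (fun i => (x i && !y i) || (x i && y i)) = x :=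
      funext fun i => by cases x i <;> cases y i <;> rfl
    have r3 : (fun i => (y i && !x i) || (x i && y i)) = y :=
      funext fun i => by cases x i <;> cases y i <;> rfl
    rw [r1] at e1
    rw [r2] at e2
    rw [r3] at e3
    rw [e1, e2, e3]
    cases f (fun i => x i && !y i) <;> cases f (fun i => y i && !x i) <;>
      cases f (fun i => x i && y i) <;> cases f (fun _ => false) <;> rfl
  refine has_Aff.2 fun x y z => ?_
  rw [h2, h2]
  cases f x <;> cases f y <;> cases f z <;> cases f (fun _ => false) <;> rfl

theorem opAnd_or_opOr_mem_of_opZero (hF : IsClone F) (h0 : opZero ∈ F) (h : ¬F ⊆ Aff) :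
    opAnd ∈ F ∨ opOr ∈ F := by
  by_contra hc
  refine h ?_
  rintro ⟨n, f⟩ hf
  refine has_Aff_of_disjoint fun a b hab => ?_
  by_contra hne
  have hp : Has (n := .fin 1) F
      fun z => f fun i => (a i && z (0 : Fin 2)) || (b i && z (1 : Fin 2)) :=
    hF.comp hf (f := fun i (z : (Arity.fin 1).Idx → Bool) =>
      (a i && z (0 : Fin 2)) || (b i && z (1 : Fin 2))) fun i => by
      have := hab i
      cases ha : a i <;> cases hb : b i
      · exact (hF.zero h0).congr fun z => rfl
      · exact (hF.proj (n := .fin 1) (1 : Fin 2)).congr fun z => by simp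
      · exact (hF.proj (n := .fin 1) (0 : Fin 2)).congr fun z => by simp
      · simp [ha, hb] at this
  refine hc (opAnd_or_opOr_mem_of_binary hF h0 hp ?_)
  simpa using hne

theorem deMorgan_mem_Aff {f : Op} (hf : deMorgan f ∈ Aff) : f ∈ Aff := by
  obtain ⟨n, f⟩ := f
  refine has_Aff.2 fun x y z => ?_
  have := has_Aff.1 hf (fun i => !x i) (fun i => !y i) fun i => !z i
  have e : (fun i => !(((!x i).xor (!y i)).xor (!z i))) = fun i => ((x i).xor (y i)).xor (z i) :=
    funext fun i => by cases x i <;> cases y i <;> cases z i <;> rfl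
  simp only [Bool.not_not] at this
  rw [e] at this
  revert this
  cases f x <;> cases f y <;> cases f z <;> simp

/-- Every clone that is not affine contains `∧`, `∨` or the median. -/
theorem opAnd_or_opOr_or_opMedian_mem (hF : IsClone F) (h : ¬F ⊆ Aff) :
    opAnd ∈ F ∨ opOr ∈ F ∨ opMedian ∈ F := by
  by_cases h0 : opZero ∈ F
  · exact (opAnd_or_opOr_mem_of_opZero hF h0 h).imp_right .inl
  by_cases h1 : opOne ∈ F
  · have := opAnd_or_opOr_mem_of_opZero hF.dualSet (mem_dualSet.2 (by rwa [deMorgan_opZero]))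
      fun hs => h fun f hf => deMorgan_mem_Aff (hs (mem_dualSet.2 (by rwa [deMorgan_deMorgan])))
    rw [mem_dualSet, mem_dualSet, deMorgan_opAnd, deMorgan_opOr] at this
    exact this.elim (fun h => .inr (.inl h)) .inl
  by_cases hd : F ⊆ Dual
  · refine .inr (.inr ?_)
    have hne : ¬betaClone F ⊆ Aff := fun hs => h fun f hf =>
      hs (mem_betaClone_of_Dual hF hf (hd hf))
    rcases opAnd_or_opOr_mem_of_opZero (isClone_betaClone hF) (opZero_mem_betaClone hF) hne with
      h | h
    · exact beta_opAnd ▸ h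
    · exact opMedian_mem_of_beta_opOr hF h
  -- a function with equal values at complementary points yields `∧` or `∨`
  obtain ⟨⟨n, f⟩, hf, hnd⟩ := Set.not_subset.1 hd
  have hnd : ¬Has Dual f := hnd
  rw [has_Dual] at hnd
  push Not at hnd
  obtain ⟨a, ha⟩ := hnd
  have hp : Has (n := .fin 1) F fun z => f fun i => bif a i then z (0 : Fin 2) else z (1 : Fin 2) :=
    hF.comp hf (f := fun i (z : (Arity.fin 1).Idx → Bool) =>
      bif a i then z (0 : Fin 2) else z (1 : Fin 2)) fun i => by
      cases ha : a i
      · exact hF.proj (n := .fin 1) (1 : Fin 2)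
      · exact hF.proj (n := .fin 1) (0 : Fin 2)
  generalize hpdef : (fun z : (Arity.fin 1).Idx → Bool =>
    f fun i => bif a i then z (0 : Fin 2) else z (1 : Fin 2)) = p at hp
  have h10 : p ![true, false] = f a := by
    rw [← hpdef]
    refine congrArg f (funext fun i => ?_)
    cases a i <;> rfl
  have h01 : p ![false, true] = f a := by
    rw [← hpdef]
    have : f a = f fun i => !a i := by
      revert ha
      cases f a <;> cases f (fun i => !a i) <;> simp
    rw [this]
    refine congrArg f (funext fun i => ?_)
    cases a i <;> rfl
  have hu := hF.proj (n := .fin 0) (0 : Fin 1)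
  have hx := hF.proj (n := .fin 1) (0 : Fin 2)
  have hy := hF.proj (n := .fin 1) (1 : Fin 2)
  have hpu := hF.comp₂ hp hu hu
  cases h00 : p ![false, false] <;> cases h11 : p ![true, true]
  · exact absurd (hpu.congr fun x => by cases h : x (0 : Fin 1) <;> simp [*]) h0
  · cases hfa : f a
    · exact .inl ((hF.comp₂ hp hx hy).congr fun x => by
        cases h0 : x (0 : Fin 2) <;> cases h1 : x (1 : Fin 2) <;> simp [*])
    · exact .inr (.inl ((hF.comp₂ hp hx hy).congr fun x => by
        cases h0 : x (0 : Fin 2) <;> cases h1 : x (1 : Fin 2) <;> simp [*]))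
  · have hpu' := hF.comp₂ hp hu hpu
    cases hfa : f a
    · exact absurd (hpu'.congr fun x => by cases h : x (0 : Fin 1) <;> simp [*]) h0
    · exact absurd (hpu'.congr fun x => by cases h : x (0 : Fin 1) <;> simp [*]) h1
  · exact absurd (hpu.congr fun x => by cases h : x (0 : Fin 1) <;> simp [*]) h1


/-! ### Which of the basic functions belong to which of the named clones -/

theorem mem_Lim0_iff_of_Cont {f : Op} (h : f ∈ Cont) : f ∈ Lim0 ↔ f ∈ Cons0 :=
  ⟨fun h => Lim0_subset_Cons0 h, mem_Lim0_of_Cont h⟩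

theorem mem_Lim1_iff_of_Cont {f : Op} (h : f ∈ Cont) : f ∈ Lim1 ↔ f ∈ Cons1 :=
  ⟨fun h => Lim1_subset_Cons1 h, mem_Lim1_of_Cont h⟩

theorem mem_Cont_of_fin {k : ℕ} (f : (Arity.fin k).Fn) : Has Cont f :=
  finitaryOps_subset_Cont ⟨k, rfl⟩

open Classical in
theorem opBigOr_facts : opBigOr ∈ borelOps ∧ opBigOr ∈ Mono ∧ opBigOr ∈ Incr ∧ opBigOr ∉ Decr ∧
    opBigOr ∈ Cons0 ∧ opBigOr ∈ Cons1 ∧ opBigOr ∉ Lim0 ∧ opBigOr ∈ Lim1 ∧ opBigOr ∉ Cont := by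
  have hI : opBigOr ∈ Incr := has_Incr.2 fun x hx => by
    obtain ⟨i, hi⟩ := of_decide_eq_true hx
    exact ⟨{i}, by simpa using hi, fun y hy => decide_eq_true ⟨i, hy i (Finset.mem_singleton_self i)⟩⟩
  have h0 : opBigOr ∈ Cons0 := has_Cons0.2 (by simp)
  have h1 : opBigOr ∈ Cons1 := has_Cons1.2 (by simp)
  have hl : opBigOr ∉ Lim0 := fun h => by
    obtain ⟨s, hs⟩ := has_Lim0.1 h
    obtain ⟨k, hk⟩ := Infinite.exists_notMem_finset (α := ℕ) s
    have := hs (fun j : ℕ => decide (j = k)) fun i hi => decide_eq_false fun h => hk (h ▸ hi)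
    have := of_decide_eq_false this
    exact this ⟨k, decide_eq_true rfl⟩
  refine ⟨?_, Incr_subset_Mono hI, hI, fun h => hl (mem_Lim0_of_Decr h h0), h0, h1, hl,
    mem_Lim1_of_Incr hI h1, fun h => hl (mem_Lim0_of_Cont h h0)⟩
  refine measurable_to_bool ?_
  have : (fun x : ℕ → Bool => decide (∃ i, x i = true)) ⁻¹' {true} =
      ⋃ i, (fun x : ℕ → Bool => x i) ⁻¹' {true} := by
    ext x
    simp
  exact this ▸ MeasurableSet.iUnion fun i => measurable_pi_apply i (measurableSet_singleton true)

theorem opBigAnd_facts : opBigAnd ∈ borelOps ∧ opBigAnd ∈ Mono ∧ opBigAnd ∉ Incr ∧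
    opBigAnd ∈ Decr ∧ opBigAnd ∈ Cons0 ∧ opBigAnd ∈ Cons1 ∧ opBigAnd ∈ Lim0 ∧ opBigAnd ∉ Lim1 ∧
    opBigAnd ∉ Cont := by
  rw [← deMorgan_mem_borelOps, ← deMorgan_mem_Mono, ← deMorgan_mem_Incr, ← deMorgan_mem_Decr,
    ← deMorgan_mem_Cons0, ← deMorgan_mem_Cons1, ← deMorgan_mem_Lim0, ← deMorgan_mem_Lim1,
    ← deMorgan_mem_Cont, deMorgan_opBigAnd]
  have := opBigOr_facts
  tauto

theorem opAnd_facts : opAnd ∈ borelOps ∧ opAnd ∈ Mono ∧ opAnd ∈ Incr ∧ opAnd ∈ Decr ∧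
    opAnd ∈ Cons0 ∧ opAnd ∈ Cons1 ∧ opAnd ∈ Lim0 ∧ opAnd ∈ Lim1 ∧ opAnd ∈ Cont := by
  have hc : opAnd ∈ Cont := mem_Cont_of_fin _
  have hm : opAnd ∈ Mono := opAnd_mem_of_opBigAnd (isClone_Pol _) opBigAnd_facts.2.1
  have h0 : opAnd ∈ Cons0 := has_Cons0.2 rfl
  have h1 : opAnd ∈ Cons1 := has_Cons1.2 rfl
  exact ⟨Cont_subset_borelOps hc, hm, mem_Incr_of_Cont hc hm, mem_Decr_of_Cont hc hm, h0, h1,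
    mem_Lim0_of_Cont hc h0, mem_Lim1_of_Cont hc h1, hc⟩

theorem opOr_facts : opOr ∈ borelOps ∧ opOr ∈ Mono ∧ opOr ∈ Incr ∧ opOr ∈ Decr ∧
    opOr ∈ Cons0 ∧ opOr ∈ Cons1 ∧ opOr ∈ Lim0 ∧ opOr ∈ Lim1 ∧ opOr ∈ Cont := by
  have hc : opOr ∈ Cont := mem_Cont_of_fin _
  have hm : opOr ∈ Mono := opOr_mem_of_opBigOr (isClone_Pol _) opBigOr_facts.2.1
  have h0 : opOr ∈ Cons0 := has_Cons0.2 rfl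
  have h1 : opOr ∈ Cons1 := has_Cons1.2 rfl
  exact ⟨Cont_subset_borelOps hc, hm, mem_Incr_of_Cont hc hm, mem_Decr_of_Cont hc hm, h0, h1,
    mem_Lim0_of_Cont hc h0, mem_Lim1_of_Cont hc h1, hc⟩

theorem opZero_facts : opZero ∈ borelOps ∧ opZero ∈ Mono ∧ opZero ∈ Incr ∧ opZero ∈ Decr ∧
    opZero ∈ Cons0 ∧ opZero ∈ Lim0 ∧ opZero ∈ Cont := by
  have hc : opZero ∈ Cont := mem_Cont_of_fin _
  have hm : opZero ∈ Mono := has_Mono.2 monotone_const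
  have h0 : opZero ∈ Cons0 := has_Cons0.2 rfl
  exact ⟨Cont_subset_borelOps hc, hm, mem_Incr_of_Cont hc hm, mem_Decr_of_Cont hc hm, h0,
    mem_Lim0_of_Cont hc h0, hc⟩

theorem opOne_facts : opOne ∈ borelOps ∧ opOne ∈ Mono ∧ opOne ∈ Incr ∧ opOne ∈ Decr ∧
    opOne ∈ Cons1 ∧ opOne ∈ Lim1 ∧ opOne ∈ Cont := by
  have hc : opOne ∈ Cont := mem_Cont_of_fin _
  have hm : opOne ∈ Mono := has_Mono.2 monotone_const
  have h1 : opOne ∈ Cons1 := has_Cons1.2 rfl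
  exact ⟨Cont_subset_borelOps hc, hm, mem_Incr_of_Cont hc hm, mem_Decr_of_Cont hc hm, h1,
    mem_Lim1_of_Cont hc h1, hc⟩

theorem opNot_facts : opNot ∈ borelOps ∧ opNot ∈ Cont ∧ opNot ∈ Dual :=
  ⟨mem_borelOps_of_fin _, mem_Cont_of_fin _, has_Dual.2 fun _ => rfl⟩

theorem opNimp_facts : opNimp ∈ borelOps ∧ opNimp ∈ Cons0 ∧ opNimp ∈ Lim0 ∧ opNimp ∈ Cont :=
  have h0 : opNimp ∈ Cons0 := has_Cons0.2 rfl
  ⟨mem_borelOps_of_fin _, h0, mem_Lim0_of_Cont (mem_Cont_of_fin _) h0, mem_Cont_of_fin _⟩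

theorem opImp_facts : opImp ∈ borelOps ∧ opImp ∈ Cons1 ∧ opImp ∈ Lim1 ∧ opImp ∈ Cont :=
  have h1 : opImp ∈ Cons1 := has_Cons1.2 rfl
  ⟨mem_borelOps_of_fin _, h1, mem_Lim1_of_Cont (mem_Cont_of_fin _) h1, mem_Cont_of_fin _⟩

theorem opIte_facts : opIte ∈ borelOps ∧ opIte ∈ Cons0 ∧ opIte ∈ Cons1 ∧ opIte ∈ Lim0 ∧
    opIte ∈ Lim1 ∧ opIte ∈ Cont :=
  have h0 : opIte ∈ Cons0 := has_Cons0.2 rfl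
  have h1 : opIte ∈ Cons1 := has_Cons1.2 rfl
  ⟨mem_borelOps_of_fin _, h0, h1, mem_Lim0_of_Cont (mem_Cont_of_fin _) h0,
    mem_Lim1_of_Cont (mem_Cont_of_fin _) h1, mem_Cont_of_fin _⟩

open Classical in
theorem ceil_facts : ceilOp opBigOr ∈ borelOps ∧ ceilOp opBigOr ∈ Mono ∧ ceilOp opBigOr ∈ Incr ∧
    ceilOp opBigOr ∉ Decr ∧ ceilOp opBigOr ∈ Cons0 ∧ ceilOp opBigOr ∈ Cons1 ∧
    ceilOp opBigOr ∈ Lim0 ∧ ceilOp opBigOr ∈ Lim1 ∧ ceilOp opBigOr ∉ Cont := by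
  obtain ⟨b1, b2, b3, b4, b5, b6, b7, b8, b9⟩ := opBigOr_facts
  obtain ⟨a1, a2, a3, a4, a5, a6, a7, a8, a9⟩ := opAnd_facts
  have hm := ceil_mem_of_opBigOr (isClone_Pol {relLe}) a2 b2
  have hd : ceilOp opBigOr ∉ Decr := fun h =>
    b4 (opBigOr_mem_of_ceil (isClone_Pol _) opOne_facts.2.2.2.1 h)
  refine ⟨ceil_mem_of_opBigOr isClone_borelOps a1 b1, hm, ceil_mem_of_opBigOr (isClone_Pol _) a3 b3,
    hd, ceil_mem_of_opBigOr (isClone_Pol _) a5 b5, ceil_mem_of_opBigOr (isClone_Pol _) a6 b6,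
    has_Lim0.2 ⟨{(0 : ℕ)}, fun y hy => ?_⟩, ceil_mem_of_opBigOr (isClone_Pol _) a8 b8,
    fun h => hd (mem_Decr_of_Cont h hm)⟩
  change (y (0 : ℕ) && _) = false
  rw [hy (0 : ℕ) (Finset.mem_singleton_self (0 : ℕ)), Bool.false_and]

theorem floor_facts : floorOp opBigAnd ∈ borelOps ∧ floorOp opBigAnd ∈ Mono ∧
    floorOp opBigAnd ∉ Incr ∧ floorOp opBigAnd ∈ Decr ∧ floorOp opBigAnd ∈ Cons0 ∧
    floorOp opBigAnd ∈ Cons1 ∧ floorOp opBigAnd ∈ Lim0 ∧ floorOp opBigAnd ∈ Lim1 ∧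
    floorOp opBigAnd ∉ Cont := by
  rw [← deMorgan_mem_borelOps, ← deMorgan_mem_Mono, ← deMorgan_mem_Incr, ← deMorgan_mem_Decr,
    ← deMorgan_mem_Cons0, ← deMorgan_mem_Cons1, ← deMorgan_mem_Lim0, ← deMorgan_mem_Lim1,
    ← deMorgan_mem_Cont, deMorgan_floor_opBigAnd]
  have := ceil_facts
  tauto

/-! ### Borel clones over a finitary clone containing `∧` and `∨` -/

/-- The relations between memberships of basic functions in a clone. -/
theorem closure_facts (hF : IsClone F) :
    (opBigOr ∈ F → opOr ∈ F) ∧ (opBigAnd ∈ F → opAnd ∈ F) ∧ (ceilOp opBigOr ∈ F → opAnd ∈ F) ∧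
    (floorOp opBigAnd ∈ F → opOr ∈ F) ∧ (opAnd ∈ F → opBigOr ∈ F → ceilOp opBigOr ∈ F) ∧
    (opOr ∈ F → opBigAnd ∈ F → floorOp opBigAnd ∈ F) ∧
    (opOne ∈ F → ceilOp opBigOr ∈ F → opBigOr ∈ F) ∧
    (opZero ∈ F → floorOp opBigAnd ∈ F → opBigAnd ∈ F) ∧
    (opNimp ∈ F → opZero ∈ F) ∧ (opNimp ∈ F → opAnd ∈ F) ∧ (opNimp ∈ F → opOr ∈ F → opIte ∈ F) ∧
    (opImp ∈ F → opOne ∈ F) ∧ (opImp ∈ F → opOr ∈ F) ∧ (opImp ∈ F → opAnd ∈ F → opIte ∈ F) ∧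
    (opIte ∈ F → opAnd ∈ F) ∧ (opIte ∈ F → opOr ∈ F) ∧
    (opIte ∈ F → (ceilOp opBigOr ∈ F ↔ floorOp opBigAnd ∈ F)) ∧
    (opNot ∈ F → opOr ∈ F → opZero ∈ F ∧ opOne ∈ F ∧ opIte ∈ F) :=
  ⟨opOr_mem_of_opBigOr hF, opAnd_mem_of_opBigAnd hF, opAnd_mem_of_ceil hF, opOr_mem_of_floor hF,
    ceil_mem_of_opBigOr hF, floor_mem_of_opBigAnd hF, opBigOr_mem_of_ceil hF,
    opBigAnd_mem_of_floor hF, opZero_mem_of_opNimp hF, opAnd_mem_of_opNimp hF,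
    opIte_mem_of_opNimp hF, opOne_mem_of_opImp hF, opOr_mem_of_opImp hF, opIte_mem_of_opImp hF,
    opAnd_mem_of_opIte hF, opOr_mem_of_opIte hF,
    fun h => ⟨floor_mem_of_opIte_of_ceil hF h, ceil_mem_of_opIte_of_floor hF h⟩,
    fun h h' => ⟨opZero_mem_of_opNot hF h h', opOne_mem_of_opNot hF h h', opIte_mem_of_opNot hF h h'⟩⟩

/-- The inclusion relations between the named clones. -/
theorem mem_facts (f : Op) : (f ∈ Incr → f ∈ Mono) ∧ (f ∈ Decr → f ∈ Mono) ∧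
    (f ∈ Lim0 → f ∈ Cons0) ∧ (f ∈ Lim1 → f ∈ Cons1) ∧ (f ∈ Decr → f ∈ Cons0 → f ∈ Lim0) ∧
    (f ∈ Incr → f ∈ Cons1 → f ∈ Lim1) ∧ (f ∈ Cont → f ∈ borelOps) :=
  ⟨fun h => Incr_subset_Mono h, fun h => Decr_subset_Mono h, fun h => Lim0_subset_Cons0 h,
    fun h => Lim1_subset_Cons1 h, mem_Lim0_of_Decr, mem_Lim1_of_Incr,
    fun h => Cont_subset_borelOps h⟩

theorem opZero_mem_of_not_Cons1 (hF : IsClone F) (hand : opAnd ∈ F) {f : Op} (hf : f ∈ F)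
    (h : f ∉ Cons1) : opZero ∈ F := by
  obtain ⟨n, f⟩ := f
  have h : ¬Has Cons1 f := h
  rw [has_Cons1] at h
  refine (hF.and hand (hF.proj (n := .fin 0) (0 : Fin 1))
    (hF.minor hf fun _ => (0 : Fin 1))).congr fun x => ?_
  change (x (0 : Fin 1) && f fun _ => x (0 : Fin 1)) = false
  cases x (0 : Fin 1)
  · rfl
  · simpa using h

theorem opOne_mem_of_not_Cons0 (hF : IsClone F) (hor : opOr ∈ F) {f : Op} (hf : f ∈ F)
    (h : f ∉ Cons0) : opOne ∈ F := by
  rw [← deMorgan_opZero]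
  exact opZero_mem_of_not_Cons1 hF.dualSet (f := deMorgan f) (mem_dualSet.2 (by rwa [deMorgan_opAnd]))
    (mem_dualSet.2 (by rwa [deMorgan_deMorgan])) (mt deMorgan_mem_Cons1.1 h)

/-- Among the clones containing the same finitary functions, `∧` and `∨` included, inclusion is
decided by the four functions `⌈⋁⌉`, `⋁`, `⌊⋀⌋` and `⋀`. -/
theorem subset_of_levels (hF : IsClone F) (hB : F ⊆ borelOps) (hF' : IsClone F')
    (hfin : finPart F ⊆ F') (hand : opAnd ∈ F) (hor : opOr ∈ F) (hm : F ⊆ Mono ∨ opIte ∈ F)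
    (h1 : ceilOp opBigOr ∈ F → ceilOp opBigOr ∈ F') (h2 : opBigOr ∈ F → opBigOr ∈ F')
    (h3 : floorOp opBigAnd ∈ F → floorOp opBigAnd ∈ F') (h4 : opBigAnd ∈ F → opBigAnd ∈ F') :
    F ⊆ F' := by
  intro f hf
  have hand' : opAnd ∈ F' := hfin ⟨hand, 1, rfl⟩
  have hor' : opOr ∈ F' := hfin ⟨hor, 1, rfl⟩
  have hlow : f ∈ Cons1 ∨ opZero ∈ F' := by
    by_contra! hc
    exact hc.2 (hfin ⟨opZero_mem_of_not_Cons1 hF hand hf hc.1, 0, rfl⟩)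
  have hup : f ∈ Cons0 ∨ opOne ∈ F' := by
    by_contra! hc
    exact hc.2 (hfin ⟨opOne_mem_of_not_Cons0 hF hor hf hc.1, 0, rfl⟩)
  have hlow' : (f ∈ Cons1 → f ∉ Lim1 → opBigAnd ∈ F) →
      f ∈ Lim1 ∨ (f ∈ Cons1 ∧ opBigAnd ∈ F') ∨ opZero ∈ F' := fun h => by
    by_cases hl : f ∈ Lim1
    · exact .inl hl
    · exact .inr (hlow.imp_left fun hc => ⟨hc, h4 (h hc hl)⟩)
  have hup' : (f ∈ Cons0 → f ∉ Lim0 → opBigOr ∈ F) →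
      f ∈ Lim0 ∨ (f ∈ Cons0 ∧ opBigOr ∈ F') ∨ opOne ∈ F' := fun h => by
    by_cases hl : f ∈ Lim0
    · exact .inl hl
    · exact .inr (hup.imp_left fun hc => ⟨hc, h2 (h hc hl)⟩)
  rcases hm with hm | hm
  · refine mem_of_Mono_levels hF' hand' hor' (hB hf) (hm hf) ?_ ?_
      (hlow' (opBigAnd_mem_of_Mono hF hand hf (hm hf)))
      (hup' (opBigOr_mem_of_Mono hF hor hf (hm hf)))
    · by_cases hi : f ∈ Incr
      · exact .inl hi
      · exact .inr (h3 (floor_mem_of_Mono hF hand hor hf (hm hf) hi))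
    · by_cases hd : f ∈ Decr
      · exact .inl hd
      · exact .inr (h1 (ceil_mem_of_Mono hF (ceil_opOr_mem hF hand hor) hf (hm hf) hd))
  · refine mem_of_opIte_levels hF' (hfin ⟨hm, 2, rfl⟩) (hB hf) ?_
      (hlow' (opBigAnd_mem_of_opIte hF hm hf)) (hup' (opBigOr_mem_of_opIte hF hm hf))
    by_cases hc : f ∈ Cont
    · exact .inl hc
    · exact .inr (.inl (h1 (ceil_mem_of_opIte hF hm hf hc)))

open Classical in
/-- The memberships of `⌈⋁⌉`, `⋁`, `⌊⋀⌋` and `⋀` in a class. -/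
noncomputable def levels (F : Set Op) : Bool × Bool × Bool × Bool :=
  (decide (ceilOp opBigOr ∈ F), decide (opBigOr ∈ F), decide (floorOp opBigAnd ∈ F),
    decide (opBigAnd ∈ F))

theorem levels_eq_iff : levels F = levels F' ↔ (ceilOp opBigOr ∈ F ↔ ceilOp opBigOr ∈ F') ∧
    (opBigOr ∈ F ↔ opBigOr ∈ F') ∧ (floorOp opBigAnd ∈ F ↔ floorOp opBigAnd ∈ F') ∧
    (opBigAnd ∈ F ↔ opBigAnd ∈ F') := by
  simp [levels]

theorem mem_of_mem_fiber (hF : F ∈ fiber G) {f : Op} (hf : f ∈ G) : f ∈ F :=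
  (hF.2.symm ▸ hf : f ∈ finPart F).1

theorem subset_Mono_of_mem_fiber (hF : F ∈ fiber G) (h : G ⊆ Mono) : F ⊆ Mono :=
  subset_Pol_of_finPart (k := 1) hF.1.1 (hF.2.subset.trans h)

theorem eq_of_levels_eq (hand : opAnd ∈ G) (hor : opOr ∈ G) (hm : G ⊆ Mono ∨ opIte ∈ G)
    (hF : F ∈ fiber G) (hF' : F' ∈ fiber G) (h : levels F = levels F') : F = F' := by
  have key : ∀ F F', F ∈ fiber G → F' ∈ fiber G → levels F = levels F' → F ⊆ F' := by
    intro F F' hF hF' h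
    obtain ⟨h1, h2, h3, h4⟩ := levels_eq_iff.1 h
    exact subset_of_levels hF.1.1 hF.1.2 hF'.1.1
      (hF.2.subset.trans fun f hf => mem_of_mem_fiber hF' hf)
      (mem_of_mem_fiber hF hand) (mem_of_mem_fiber hF hor)
      (hm.imp (subset_Mono_of_mem_fiber hF) (mem_of_mem_fiber hF)) h1.1 h2.1 h3.1 h4.1
  exact (key F F' hF hF' h).antisymm (key F' F hF' hF h.symm)

/-! ### Classification tables -/

/-- A table is a classification if it exhausts the fiber, some invariant tells its rows apart,
and its rows are as described. -/
theorem classified_of {α : Type*} {k : ℕ} {T : List (Set Op × List (Set Rel) × List (Set Op))}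
    (inv : Set Op → α) (hlen : T.length = k) (hex : ∀ F ∈ fiber G, ∃ t ∈ T, t.1 = F)
    (hnd : (T.map fun t => inv t.1).Nodup)
    (hrow : ∀ t ∈ T, t.1 ∈ fiber G ∧ (∀ M ∈ t.2.1, t.1 = PolB M) ∧ ∀ S ∈ t.2.2, t.1 = gen S) :
    Classified G k T := by
  classical
  have hiff : ∀ F, F ∈ fiber G ↔ ∃ t ∈ T, t.1 = F :=
    fun F => ⟨hex F, fun ⟨t, ht, h⟩ => h ▸ (hrow t ht).1⟩
  refine ⟨?_, hiff, fun t ht => (hrow t ht).2⟩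
  have h1 : fiber G = ((T.map Prod.fst).toFinset : Set (Set Op)) := by
    ext F
    rw [hiff]
    simp
  have h2 : (T.map Prod.fst).Nodup := by
    refine List.Nodup.of_map inv ?_
    rwa [List.map_map]
  rw [h1, Set.encard_coe_eq_coe_finsetCard, List.toFinset_card_of_nodup h2, List.length_map, hlen]

theorem classified_of_levels {k : ℕ} {T : List (Set Op × List (Set Rel) × List (Set Op))}
    (hand : opAnd ∈ G) (hor : opOr ∈ G) (hm : G ⊆ Mono ∨ opIte ∈ G) (hlen : T.length = k)
    (l : List (Bool × Bool × Bool × Bool)) (hl : (T.map fun t => levels t.1) = l)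
    (hnd : l.Nodup) (hex : ∀ F ∈ fiber G, levels F ∈ l)
    (hrow : ∀ t ∈ T, t.1 ∈ fiber G ∧ (∀ M ∈ t.2.1, t.1 = PolB M) ∧ ∀ S ∈ t.2.2, t.1 = gen S) :
    Classified G k T := by
  refine classified_of levels hlen (fun F hF => ?_) (hl.symm ▸ hnd) hrow
  have := hex F hF
  rw [← hl, List.mem_map] at this
  obtain ⟨t, ht, h⟩ := this
  exact ⟨t, ht, eq_of_levels_eq hand hor hm (hrow t ht).1 hF h⟩

theorem finPart_subset_of_opAnd_opOr (hF : IsClone F) (hand : opAnd ∈ F) (hor : opOr ∈ F)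
    (hm : X ⊆ Mono ∨ opIte ∈ F) (h0 : X ⊆ Cons0 ∨ opOne ∈ F) (h1 : X ⊆ Cons1 ∨ opZero ∈ F) :
    finPart X ⊆ F := by
  rintro ⟨n, f⟩ ⟨hf, k, rfl⟩
  exact mem_of_fin hF hand hor (hm.imp_left fun h => h hf) (h0.imp_left fun h => h hf)
    (h1.imp_left fun h => h hf)

/-- To show that a clone in the fiber is generated by `S` it suffices to find in every clone
containing `S` the basic functions that are needed. -/
theorem eq_gen_of_levels {S : Set Op} (hC : C ∈ fiber (finPart X)) (hSC : S ⊆ C)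
    (h : ∀ F, IsClone F → S ⊆ F → (X ⊆ Mono ∨ opIte ∈ F) ∧ (X ⊆ Cons0 ∨ opOne ∈ F) ∧
      (X ⊆ Cons1 ∨ opZero ∈ F) ∧ opAnd ∈ F ∧ opOr ∈ F ∧
      (ceilOp opBigOr ∈ C → ceilOp opBigOr ∈ F) ∧ (opBigOr ∈ C → opBigOr ∈ F) ∧
      (floorOp opBigAnd ∈ C → floorOp opBigAnd ∈ F) ∧ (opBigAnd ∈ C → opBigAnd ∈ F)) :
    C = gen S := by
  obtain ⟨hm, h0, h1, hand, hor, a1, a2, a3, a4⟩ := h (gen S) (isClone_gen S) (subset_gen S)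
  have hsub := gen_subset hC.1.1 hSC
  have hfin : finPart C ⊆ gen S := hC.2.subset.trans
    (finPart_subset_of_opAnd_opOr (isClone_gen S) hand hor hm h0 h1)
  refine (subset_of_levels hC.1.1 hC.1.2 (isClone_gen S) hfin (hsub hand) (hsub hor) ?_
    a1 a2 a3 a4).antisymm hsub
  exact hm.imp (fun h => subset_Mono_of_mem_fiber hC (Set.inter_subset_left.trans h)) fun h =>
    hsub h

theorem mem_borelPart {f : Op} : f ∈ borelPart X ↔ f ∈ X ∧ f ∈ borelOps := Iff.rfl

theorem mem_PolB_empty {f : Op} : f ∈ PolB ∅ ↔ f ∈ borelOps := by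
  simp [PolB, Pol, borelPart]

theorem mem_PolB_singleton {R : Rel} {f : Op} : f ∈ PolB {R} ↔ f ∈ Pol {R} ∧ f ∈ borelOps :=
  Iff.rfl

theorem mem_PolB_insert {R : Rel} {M : Set Rel} {f : Op} :
    f ∈ PolB (insert R M) ↔ f ∈ Pol {R} ∧ f ∈ PolB M := by
  simp [PolB, Pol, borelPart, and_assoc]

theorem borelPart_mem_fiber (hC : IsClone C) (h : finPart C = finPart X) :
    borelPart C ∈ fiber (finPart X) := by
  refine ⟨⟨hC.inter isClone_borelOps, fun _ h => h.2⟩, ?_⟩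
  rw [← h]
  exact Set.Subset.antisymm (fun f hf => ⟨hf.1.1, hf.2⟩) fun f hf =>
    ⟨⟨hf.1, finPart_subset_borelOps hf⟩, hf.2⟩

theorem gen_finPart_mem_fiber (hX : IsClone X) : gen (finPart X) ∈ fiber (finPart X) :=
  ⟨⟨isClone_gen _, gen_subset isClone_borelOps finPart_subset_borelOps⟩,
    Set.Subset.antisymm (fun _ hf => ⟨((mem_gen_finPart hX).1 hf.1).1, hf.2⟩) fun _ hf =>
      ⟨subset_gen _ hf, hf.2⟩⟩

theorem finPart_inter : finPart (F ∩ F') = finPart F ∩ finPart F' := by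
  ext f
  simp only [finPart, Set.mem_inter_iff]
  tauto

theorem finPart_Lim0 : finPart Lim0 = finPart Cons0 := by
  ext f
  exact and_congr_left fun h => mem_Lim0_iff_of_Cont (finitaryOps_subset_Cont h)

theorem finPart_Lim1 : finPart Lim1 = finPart Cons1 := by
  ext f
  exact and_congr_left fun h => mem_Lim1_iff_of_Cont (finitaryOps_subset_Cont h)

theorem finPart_Incr : finPart Incr = finPart Mono := by
  ext f
  exact and_congr_left fun h => ⟨fun h => Incr_subset_Mono h,
    mem_Incr_of_Cont (finitaryOps_subset_Cont h)⟩

theorem finPart_Decr : finPart Decr = finPart Mono := by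
  ext f
  exact and_congr_left fun h => ⟨fun h => Decr_subset_Mono h,
    mem_Decr_of_Cont (finitaryOps_subset_Cont h)⟩


/-! ### The Borel clones of all, of monotone and of constant-preserving functions

In each of the following tables the rows are told apart by the memberships of `⌈⋁⌉`, `⋁`, `⌊⋀⌋` and
`⋀`, and `closure_facts` excludes every other combination of the four. -/

attribute [simp] finPart_Lim0 finPart_Lim1 finPart_Incr finPart_Decr mem_borelPart
  mem_PolB_empty mem_PolB_singleton mem_PolB_insert opBigOr_facts opBigAnd_facts ceil_facts
  floor_facts opAnd_facts opOr_facts opZero_facts opOne_facts opNimp_facts opImp_facts opIte_facts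
  opNot_facts

@[simp]
theorem Pol_singletons : Pol {relLe} = Mono ∧ Pol {relZero} = Cons0 ∧ Pol {relOne} = Cons1 ∧
    Pol {relJoinUp} = Incr ∧ Pol {relMeetDown} = Decr ∧ Pol {relLimZero} = Lim0 ∧
    Pol {relLimOne} = Lim1 ∧ Pol {relLim} = Cont ∧ Pol {relNot} = Dual :=
  ⟨rfl, rfl, rfl, rfl, rfl, rfl, rfl, rfl, rfl⟩

@[simp]
theorem mem_All {f : Op} : f ∈ All := trivial

theorem classified_All : Classified (finPart All) 2 [
    (borelPart All, [∅], [{opBigOr, opNot}, {opBigAnd, opBigOr, opZero, opOne, opNot}]),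
    (gen (finPart All), [{relLim}], [{opOr, opNot}, {opAnd, opOr, opZero, opOne, opNot}])] := by
  have hX : IsClone All :=
    isClone_All
  have hg (f : Op) : f ∈ gen (finPart All) ↔
      f ∈ All ∧ f ∈ Cont :=
    mem_gen_finPart hX
  have hand : opAnd ∈ finPart All := ⟨trivial, 1, rfl⟩
  have hor : opOr ∈ finPart All := ⟨trivial, 1, rfl⟩
  have hi : opIte ∈ finPart All := ⟨trivial, 2, rfl⟩
  have hz : opZero ∈ finPart All := ⟨trivial, 0, rfl⟩
  have ho : opOne ∈ finPart All := ⟨trivial, 0, rfl⟩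
  refine classified_of_levels hand hor (.inr hi) rfl
    [(true, true, true, true), (false, false, false, false)]
    (by simp [levels, hg]) (by decide) (fun F hF => ?_) ?_
  · have := closure_facts hF.1.1
    have hand : opAnd ∈ F := mem_of_mem_fiber hF hand
    have hor : opOr ∈ F := mem_of_mem_fiber hF hor
    have hi : opIte ∈ F := mem_of_mem_fiber hF hi
    have hz : opZero ∈ F := mem_of_mem_fiber hF hz
    have ho : opOne ∈ F := mem_of_mem_fiber hF ho
    by_cases h1 : ceilOp opBigOr ∈ F <;> by_cases h2 : opBigOr ∈ F <;>
      by_cases h3 : floorOp opBigAnd ∈ F <;> by_cases h4 : opBigAnd ∈ F <;> simp_all [levels]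
  · have hC : borelPart All ∈ fiber (finPart All) := borelPart_mem_fiber isClone_All rfl
    have hG := gen_finPart_mem_fiber hX
    simp only [List.forall_mem_cons, List.not_mem_nil, false_imp_iff, implies_true, and_true]
    refine ⟨⟨hC, ?_, ⟨?_, ?_⟩⟩,
      ⟨hG, ?_, ⟨?_, ?_⟩⟩⟩
    all_goals first
      | refine eq_gen_of_levels (by first | exact hG | exact hC)
          (by simp [Set.insert_subset_iff, hg]) fun F hF hS => ?_
        have := closure_facts hF
        simp only [Set.insert_subset_iff, Set.singleton_subset_iff] at hS
        simp_all <;> grind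
      | ext f
        have := mem_facts f
        simp [hg] <;> grind

theorem classified_Cons0 : Classified (finPart Cons0) 3 [
    (borelPart Cons0, [{relZero}], [{opBigOr, opNimp}, {opBigAnd, opBigOr, opZero, opNimp}]),
    (borelPart Lim0, [{relLimZero}],
      [{opBigAnd, opOr, opNimp}, {ceilOp opBigOr, opOr, opNimp},
        {opBigAnd, ceilOp opBigOr, opOr, opZero, opNimp}]),
    (gen (finPart Cons0), [{relLim, relZero}], [{opOr, opNimp}, {opAnd, opOr, opZero, opNimp}])] := by
  have hX : IsClone Cons0 :=
    isClone_Pol _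
  have hg (f : Op) : f ∈ gen (finPart Cons0) ↔
      f ∈ Cons0 ∧ f ∈ Cont :=
    mem_gen_finPart hX
  have hand : opAnd ∈ finPart Cons0 := ⟨by simp, 1, rfl⟩
  have hor : opOr ∈ finPart Cons0 := ⟨by simp, 1, rfl⟩
  have hi : opIte ∈ finPart Cons0 := ⟨by simp, 2, rfl⟩
  have hz : opZero ∈ finPart Cons0 := ⟨by simp, 0, rfl⟩
  refine classified_of_levels hand hor (.inr hi) rfl
    [(true, true, true, true), (true, false, true, true), (false, false, false, false)]
    (by simp [levels, hg]) (by decide) (fun F hF => ?_) ?_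
  · have := closure_facts hF.1.1
    have hand : opAnd ∈ F := mem_of_mem_fiber hF hand
    have hor : opOr ∈ F := mem_of_mem_fiber hF hor
    have hi : opIte ∈ F := mem_of_mem_fiber hF hi
    have hz : opZero ∈ F := mem_of_mem_fiber hF hz
    by_cases h1 : ceilOp opBigOr ∈ F <;> by_cases h2 : opBigOr ∈ F <;>
      by_cases h3 : floorOp opBigAnd ∈ F <;> by_cases h4 : opBigAnd ∈ F <;> simp_all [levels]
  · have hC {A : Set Rel} (h : finPart (Pol A) = finPart Cons0) :
        borelPart (Pol A) ∈ fiber (finPart Cons0) :=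
      borelPart_mem_fiber (isClone_Pol _) h
    have hG := gen_finPart_mem_fiber hX
    have h0 : Cons0 ⊆ Cons0 := fun _ hf => hf
    simp only [List.forall_mem_cons, List.not_mem_nil, false_imp_iff, implies_true, and_true]
    refine ⟨⟨hC (by simp), ?_, ⟨?_, ?_⟩⟩,
      ⟨hC (by simp), ?_, ⟨?_, ?_, ?_⟩⟩,
      ⟨hG, ?_, ⟨?_, ?_⟩⟩⟩
    all_goals first
      | refine eq_gen_of_levels (by first | exact hG | exact hC (by simp))
          (by simp [Set.insert_subset_iff, hg]) fun F hF hS => ?_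
        have := closure_facts hF
        simp only [Set.insert_subset_iff, Set.singleton_subset_iff] at hS
        simp_all <;> grind
      | ext f
        have := mem_facts f
        simp [hg] <;> grind

theorem classified_Cons1 : Classified (finPart Cons1) 3 [
    (borelPart Cons1, [{relOne}], [{opBigAnd, opImp}, {opBigOr, opBigAnd, opOne, opImp}]),
    (borelPart Lim1, [{relLimOne}],
      [{opBigOr, opAnd, opImp}, {floorOp opBigAnd, opAnd, opImp},
        {opBigOr, floorOp opBigAnd, opAnd, opOne, opImp}]),
    (gen (finPart Cons1), [{relLim, relOne}], [{opAnd, opImp}, {opOr, opAnd, opOne, opImp}])] := by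
  have hX : IsClone Cons1 :=
    isClone_Pol _
  have hg (f : Op) : f ∈ gen (finPart Cons1) ↔
      f ∈ Cons1 ∧ f ∈ Cont :=
    mem_gen_finPart hX
  have hand : opAnd ∈ finPart Cons1 := ⟨by simp, 1, rfl⟩
  have hor : opOr ∈ finPart Cons1 := ⟨by simp, 1, rfl⟩
  have hi : opIte ∈ finPart Cons1 := ⟨by simp, 2, rfl⟩
  have ho : opOne ∈ finPart Cons1 := ⟨by simp, 0, rfl⟩
  refine classified_of_levels hand hor (.inr hi) rfl
    [(true, true, true, true), (true, true, true, false), (false, false, false, false)]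
    (by simp [levels, hg]) (by decide) (fun F hF => ?_) ?_
  · have := closure_facts hF.1.1
    have hand : opAnd ∈ F := mem_of_mem_fiber hF hand
    have hor : opOr ∈ F := mem_of_mem_fiber hF hor
    have hi : opIte ∈ F := mem_of_mem_fiber hF hi
    have ho : opOne ∈ F := mem_of_mem_fiber hF ho
    by_cases h1 : ceilOp opBigOr ∈ F <;> by_cases h2 : opBigOr ∈ F <;>
      by_cases h3 : floorOp opBigAnd ∈ F <;> by_cases h4 : opBigAnd ∈ F <;> simp_all [levels]
  · have hC {A : Set Rel} (h : finPart (Pol A) = finPart Cons1) :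
        borelPart (Pol A) ∈ fiber (finPart Cons1) :=
      borelPart_mem_fiber (isClone_Pol _) h
    have hG := gen_finPart_mem_fiber hX
    have h1 : Cons1 ⊆ Cons1 := fun _ hf => hf
    simp only [List.forall_mem_cons, List.not_mem_nil, false_imp_iff, implies_true, and_true]
    refine ⟨⟨hC (by simp), ?_, ⟨?_, ?_⟩⟩,
      ⟨hC (by simp), ?_, ⟨?_, ?_, ?_⟩⟩,
      ⟨hG, ?_, ⟨?_, ?_⟩⟩⟩
    all_goals first
      | refine eq_gen_of_levels (by first | exact hG | exact hC (by simp))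
          (by simp [Set.insert_subset_iff, hg]) fun F hF hS => ?_
        have := closure_facts hF
        simp only [Set.insert_subset_iff, Set.singleton_subset_iff] at hS
        simp_all <;> grind
      | ext f
        have := mem_facts f
        simp [hg] <;> grind

theorem classified_Cons0_Cons1 : Classified (finPart (Cons0 ∩ Cons1)) 5 [
    (borelPart (Cons0 ∩ Cons1), [{relZero, relOne}], [{opBigAnd, opBigOr, opIte}]),
    (borelPart (Cons0 ∩ Lim1), [{relZero, relLimOne}], [{opBigOr, opIte}]),
    (borelPart (Lim0 ∩ Cons1), [{relLimZero, relOne}], [{opBigAnd, opIte}]),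
    (borelPart (Lim0 ∩ Lim1), [{relLimZero, relLimOne}],
      [{floorOp opBigAnd, opIte}, {ceilOp opBigOr, opIte}]),
    (gen (finPart (Cons0 ∩ Cons1)), [{relLim, relZero, relOne}], [{opIte}])] := by
  have hX : IsClone (Cons0 ∩ Cons1) :=
    (isClone_Pol _).inter (isClone_Pol _)
  have hg (f : Op) : f ∈ gen (finPart (Cons0 ∩ Cons1)) ↔
      (f ∈ Cons0 ∧ f ∈ Cons1) ∧ f ∈ Cont :=
    mem_gen_finPart hX
  have hand : opAnd ∈ finPart (Cons0 ∩ Cons1) := ⟨by simp, 1, rfl⟩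
  have hor : opOr ∈ finPart (Cons0 ∩ Cons1) := ⟨by simp, 1, rfl⟩
  have hi : opIte ∈ finPart (Cons0 ∩ Cons1) := ⟨by simp, 2, rfl⟩
  refine classified_of_levels hand hor (.inr hi) rfl
    [(true, true, true, true), (true, true, true, false), (true, false, true, true),
      (true, false, true, false), (false, false, false, false)]
    (by simp [levels, hg]) (by decide) (fun F hF => ?_) ?_
  · have := closure_facts hF.1.1
    have hand : opAnd ∈ F := mem_of_mem_fiber hF hand
    have hor : opOr ∈ F := mem_of_mem_fiber hF hor
    have hi : opIte ∈ F := mem_of_mem_fiber hF hi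
    by_cases h1 : ceilOp opBigOr ∈ F <;> by_cases h2 : opBigOr ∈ F <;>
      by_cases h3 : floorOp opBigAnd ∈ F <;> by_cases h4 : opBigAnd ∈ F <;> simp_all [levels]
  · have hC {A B : Set Rel} (h : finPart (Pol A ∩ Pol B) = finPart (Cons0 ∩ Cons1)) :
        borelPart (Pol A ∩ Pol B) ∈ fiber (finPart (Cons0 ∩ Cons1)) :=
      borelPart_mem_fiber ((isClone_Pol _).inter (isClone_Pol _)) h
    have hG := gen_finPart_mem_fiber hX
    have h0 : (Cons0 ∩ Cons1) ⊆ Cons0 := fun _ hf => hf.1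
    have h1 : (Cons0 ∩ Cons1) ⊆ Cons1 := fun _ hf => hf.2
    simp only [List.forall_mem_cons, List.not_mem_nil, false_imp_iff, implies_true, and_true]
    refine ⟨⟨hC (by simp [finPart_inter]), ?_, ?_⟩,
      ⟨hC (by simp [finPart_inter]), ?_, ?_⟩,
      ⟨hC (by simp [finPart_inter]), ?_, ?_⟩,
      ⟨hC (by simp [finPart_inter]), ?_, ⟨?_, ?_⟩⟩,
      ⟨hG, ?_, ?_⟩⟩
    all_goals first
      | refine eq_gen_of_levels (by first | exact hG | exact hC (by simp [finPart_inter]))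
          (by simp [Set.insert_subset_iff, hg]) fun F hF hS => ?_
        have := closure_facts hF
        simp only [Set.insert_subset_iff, Set.singleton_subset_iff] at hS
        simp_all <;> grind
      | ext f
        have := mem_facts f
        simp [hg]
        grind

theorem classified_Mono : Classified (finPart Mono) 4 [
    (borelPart Mono, [{relLe}], [{opBigAnd, opBigOr, opZero, opOne}]),
    (borelPart Incr, [{relJoinUp}], [{opAnd, opBigOr, opZero, opOne}]),
    (borelPart Decr, [{relMeetDown}], [{opBigAnd, opOr, opZero, opOne}]),
    (gen (finPart Mono), [{relLim, relLe}], [{opAnd, opOr, opZero, opOne}])] := by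
  have hX : IsClone Mono :=
    isClone_Pol _
  have hg (f : Op) : f ∈ gen (finPart Mono) ↔
      f ∈ Mono ∧ f ∈ Cont :=
    mem_gen_finPart hX
  have hand : opAnd ∈ finPart Mono := ⟨by simp, 1, rfl⟩
  have hor : opOr ∈ finPart Mono := ⟨by simp, 1, rfl⟩
  have hz : opZero ∈ finPart Mono := ⟨by simp, 0, rfl⟩
  have ho : opOne ∈ finPart Mono := ⟨by simp, 0, rfl⟩
  refine classified_of_levels hand hor (.inl fun _ hf => hf.1) rfl
    [(true, true, true, true), (true, true, false, false), (false, false, true, true),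
      (false, false, false, false)]
    (by simp [levels, hg]) (by decide) (fun F hF => ?_) ?_
  · have := closure_facts hF.1.1
    have hand : opAnd ∈ F := mem_of_mem_fiber hF hand
    have hor : opOr ∈ F := mem_of_mem_fiber hF hor
    have hz : opZero ∈ F := mem_of_mem_fiber hF hz
    have ho : opOne ∈ F := mem_of_mem_fiber hF ho
    by_cases h1 : ceilOp opBigOr ∈ F <;> by_cases h2 : opBigOr ∈ F <;>
      by_cases h3 : floorOp opBigAnd ∈ F <;> by_cases h4 : opBigAnd ∈ F <;> simp_all [levels]
  · have hC {A : Set Rel} (h : finPart (Pol A) = finPart Mono) :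
        borelPart (Pol A) ∈ fiber (finPart Mono) :=
      borelPart_mem_fiber (isClone_Pol _) h
    have hG := gen_finPart_mem_fiber hX
    have hm : Mono ⊆ Mono := fun _ hf => hf
    simp only [List.forall_mem_cons, List.not_mem_nil, false_imp_iff, implies_true, and_true]
    refine ⟨⟨hC (by simp), ?_, ?_⟩,
      ⟨hC (by simp), ?_, ?_⟩,
      ⟨hC (by simp), ?_, ?_⟩,
      ⟨hG, ?_, ?_⟩⟩
    all_goals first
      | refine eq_gen_of_levels (by first | exact hG | exact hC (by simp))
          (by simp [Set.insert_subset_iff, hg]) fun F hF hS => ?_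
        have := closure_facts hF
        simp only [Set.insert_subset_iff, Set.singleton_subset_iff] at hS
        simp_all
      | ext f
        have := mem_facts f
        simp [hg] <;> grind

theorem classified_Mono_Cons0 : Classified (finPart (Mono ∩ Cons0)) 6 [
    (borelPart (Mono ∩ Cons0), [{relLe, relZero}], [{opBigAnd, opBigOr, opZero}]),
    (borelPart (Incr ∩ Cons0), [{relJoinUp, relZero}], [{opAnd, opBigOr, opZero}]),
    (borelPart (Mono ∩ Lim0), [{relLe, relLimZero}],
      [{opBigAnd, ceilOp opBigOr, opOr, opZero}]),
    (borelPart (Incr ∩ Lim0), [{relJoinUp, relLimZero}], [{ceilOp opBigOr, opOr, opZero}]),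
    (borelPart (Decr ∩ Cons0), [{relMeetDown, relZero}, {relMeetDown, relLimZero}],
      [{opBigAnd, opOr, opZero}]),
    (gen (finPart (Mono ∩ Cons0)), [{relLe, relLim, relZero}], [{opAnd, opOr, opZero}])] := by
  have hX : IsClone (Mono ∩ Cons0) :=
    (isClone_Pol _).inter (isClone_Pol _)
  have hg (f : Op) : f ∈ gen (finPart (Mono ∩ Cons0)) ↔
      (f ∈ Mono ∧ f ∈ Cons0) ∧ f ∈ Cont :=
    mem_gen_finPart hX
  have hand : opAnd ∈ finPart (Mono ∩ Cons0) := ⟨by simp, 1, rfl⟩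
  have hor : opOr ∈ finPart (Mono ∩ Cons0) := ⟨by simp, 1, rfl⟩
  have hz : opZero ∈ finPart (Mono ∩ Cons0) := ⟨by simp, 0, rfl⟩
  refine classified_of_levels hand hor (.inl fun _ hf => hf.1.1) rfl
    [(true, true, true, true), (true, true, false, false), (true, false, true, true),
      (true, false, false, false), (false, false, true, true), (false, false, false, false)]
    (by simp [levels, hg]) (by decide) (fun F hF => ?_) ?_
  · have := closure_facts hF.1.1
    have hand : opAnd ∈ F := mem_of_mem_fiber hF hand
    have hor : opOr ∈ F := mem_of_mem_fiber hF hor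
    have hz : opZero ∈ F := mem_of_mem_fiber hF hz
    by_cases h1 : ceilOp opBigOr ∈ F <;> by_cases h2 : opBigOr ∈ F <;>
      by_cases h3 : floorOp opBigAnd ∈ F <;> by_cases h4 : opBigAnd ∈ F <;> simp_all [levels]
  · have hC {A B : Set Rel} (h : finPart (Pol A ∩ Pol B) = finPart (Mono ∩ Cons0)) :
        borelPart (Pol A ∩ Pol B) ∈ fiber (finPart (Mono ∩ Cons0)) :=
      borelPart_mem_fiber ((isClone_Pol _).inter (isClone_Pol _)) h
    have hG := gen_finPart_mem_fiber hX
    have hm : (Mono ∩ Cons0) ⊆ Mono := fun _ hf => hf.1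
    have h0 : (Mono ∩ Cons0) ⊆ Cons0 := fun _ hf => hf.2
    simp only [List.forall_mem_cons, List.not_mem_nil, false_imp_iff, implies_true, and_true]
    refine ⟨⟨hC (by simp [finPart_inter]), ?_, ?_⟩,
      ⟨hC (by simp [finPart_inter]), ?_, ?_⟩,
      ⟨hC (by simp [finPart_inter]), ?_, ?_⟩,
      ⟨hC (by simp [finPart_inter]), ?_, ?_⟩,
      ⟨hC (by simp [finPart_inter]), ⟨?_, ?_⟩, ?_⟩,
      ⟨hG, ?_, ?_⟩⟩
    all_goals first
      | refine eq_gen_of_levels (by first | exact hG | exact hC (by simp [finPart_inter]))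
          (by simp [Set.insert_subset_iff, hg]) fun F hF hS => ?_
        have := closure_facts hF
        simp only [Set.insert_subset_iff, Set.singleton_subset_iff] at hS
        simp_all
      | ext f
        have := mem_facts f
        simp [hg]
        grind

theorem classified_Mono_Cons1 : Classified (finPart (Mono ∩ Cons1)) 6 [
    (borelPart (Mono ∩ Cons1), [{relLe, relOne}], [{opBigOr, opBigAnd, opOne}]),
    (borelPart (Decr ∩ Cons1), [{relMeetDown, relOne}], [{opOr, opBigAnd, opOne}]),
    (borelPart (Mono ∩ Lim1), [{relLe, relLimOne}],
      [{opBigOr, floorOp opBigAnd, opAnd, opOne}]),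
    (borelPart (Decr ∩ Lim1), [{relMeetDown, relLimOne}], [{floorOp opBigAnd, opAnd, opOne}]),
    (borelPart (Incr ∩ Cons1), [{relJoinUp, relOne}, {relJoinUp, relLimOne}],
      [{opBigOr, opAnd, opOne}]),
    (gen (finPart (Mono ∩ Cons1)), [{relLe, relLim, relOne}], [{opOr, opAnd, opOne}])] := by
  have hX : IsClone (Mono ∩ Cons1) :=
    (isClone_Pol _).inter (isClone_Pol _)
  have hg (f : Op) : f ∈ gen (finPart (Mono ∩ Cons1)) ↔
      (f ∈ Mono ∧ f ∈ Cons1) ∧ f ∈ Cont :=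
    mem_gen_finPart hX
  have hand : opAnd ∈ finPart (Mono ∩ Cons1) := ⟨by simp, 1, rfl⟩
  have hor : opOr ∈ finPart (Mono ∩ Cons1) := ⟨by simp, 1, rfl⟩
  have ho : opOne ∈ finPart (Mono ∩ Cons1) := ⟨by simp, 0, rfl⟩
  refine classified_of_levels hand hor (.inl fun _ hf => hf.1.1) rfl
    [(true, true, true, true), (false, false, true, true), (true, true, true, false),
      (false, false, true, false), (true, true, false, false), (false, false, false, false)]
    (by simp [levels, hg]) (by decide) (fun F hF => ?_) ?_
  · have := closure_facts hF.1.1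
    have hand : opAnd ∈ F := mem_of_mem_fiber hF hand
    have hor : opOr ∈ F := mem_of_mem_fiber hF hor
    have ho : opOne ∈ F := mem_of_mem_fiber hF ho
    by_cases h1 : ceilOp opBigOr ∈ F <;> by_cases h2 : opBigOr ∈ F <;>
      by_cases h3 : floorOp opBigAnd ∈ F <;> by_cases h4 : opBigAnd ∈ F <;> simp_all [levels]
  · have hC {A B : Set Rel} (h : finPart (Pol A ∩ Pol B) = finPart (Mono ∩ Cons1)) :
        borelPart (Pol A ∩ Pol B) ∈ fiber (finPart (Mono ∩ Cons1)) :=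
      borelPart_mem_fiber ((isClone_Pol _).inter (isClone_Pol _)) h
    have hG := gen_finPart_mem_fiber hX
    have hm : (Mono ∩ Cons1) ⊆ Mono := fun _ hf => hf.1
    have h1 : (Mono ∩ Cons1) ⊆ Cons1 := fun _ hf => hf.2
    simp only [List.forall_mem_cons, List.not_mem_nil, false_imp_iff, implies_true, and_true]
    refine ⟨⟨hC (by simp [finPart_inter]), ?_, ?_⟩,
      ⟨hC (by simp [finPart_inter]), ?_, ?_⟩,
      ⟨hC (by simp [finPart_inter]), ?_, ?_⟩,
      ⟨hC (by simp [finPart_inter]), ?_, ?_⟩,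
      ⟨hC (by simp [finPart_inter]), ⟨?_, ?_⟩, ?_⟩,
      ⟨hG, ?_, ?_⟩⟩
    all_goals first
      | refine eq_gen_of_levels (by first | exact hG | exact hC (by simp [finPart_inter]))
          (by simp [Set.insert_subset_iff, hg]) fun F hF hS => ?_
        have := closure_facts hF
        simp only [Set.insert_subset_iff, Set.singleton_subset_iff] at hS
        simp_all
      | ext f
        have := mem_facts f
        simp [hg]
        grind

theorem classified_Mono_Cons0_Cons1 : Classified (finPart (Mono ∩ Cons0 ∩ Cons1)) 9 [
    (borelPart (Mono ∩ Cons0 ∩ Cons1), [{relLe, relZero, relOne}], [{opBigAnd, opBigOr}]),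
    (borelPart (Mono ∩ Cons0 ∩ Lim1), [{relLe, relZero, relLimOne}],
      [{floorOp opBigAnd, opAnd, opBigOr}]),
    (borelPart (Incr ∩ Cons0 ∩ Cons1), [{relJoinUp, relZero, relOne}], [{opAnd, opBigOr}]),
    (borelPart (Mono ∩ Lim0 ∩ Cons1), [{relLe, relLimZero, relOne}],
      [{opBigAnd, ceilOp opBigOr, opOr}]),
    (borelPart (Decr ∩ Cons0 ∩ Cons1), [{relMeetDown, relZero, relOne}], [{opBigAnd, opOr}]),
    (borelPart (Mono ∩ Lim0 ∩ Lim1), [{relLe, relLimZero, relLimOne}],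
      [{floorOp opBigAnd, ceilOp opBigOr}]),
    (borelPart (Incr ∩ Lim0 ∩ Cons1), [{relJoinUp, relLimZero, relOne}],
      [{ceilOp opBigOr, opOr}]),
    (borelPart (Decr ∩ Cons0 ∩ Lim1), [{relMeetDown, relZero, relLimOne}],
      [{floorOp opBigAnd, opAnd}]),
    (gen (finPart (Mono ∩ Cons0 ∩ Cons1)), [{relLe, relLim, relZero, relOne}], [{opAnd, opOr}])] := by
  have hX : IsClone (Mono ∩ Cons0 ∩ Cons1) :=
    ((isClone_Pol _).inter (isClone_Pol _)).inter (isClone_Pol _)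
  have hg (f : Op) : f ∈ gen (finPart (Mono ∩ Cons0 ∩ Cons1)) ↔
      ((f ∈ Mono ∧ f ∈ Cons0) ∧ f ∈ Cons1) ∧ f ∈ Cont :=
    mem_gen_finPart hX
  have hand : opAnd ∈ finPart (Mono ∩ Cons0 ∩ Cons1) := ⟨by simp, 1, rfl⟩
  have hor : opOr ∈ finPart (Mono ∩ Cons0 ∩ Cons1) := ⟨by simp, 1, rfl⟩
  refine classified_of_levels hand hor (.inl fun _ hf => hf.1.1.1) rfl
    [(true, true, true, true), (true, true, true, false), (true, true, false, false),
      (true, false, true, true), (false, false, true, true), (true, false, true, false),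
      (true, false, false, false), (false, false, true, false), (false, false, false, false)]
    (by simp [levels, hg]) (by decide) (fun F hF => ?_) ?_
  · have := closure_facts hF.1.1
    have hand : opAnd ∈ F := mem_of_mem_fiber hF hand
    have hor : opOr ∈ F := mem_of_mem_fiber hF hor
    by_cases h1 : ceilOp opBigOr ∈ F <;> by_cases h2 : opBigOr ∈ F <;>
      by_cases h3 : floorOp opBigAnd ∈ F <;> by_cases h4 : opBigAnd ∈ F <;> simp_all [levels]
  · have hC {A B C : Set Rel} (h : finPart (Pol A ∩ Pol B ∩ Pol C) = finPart (Mono ∩ Cons0 ∩ Cons1)) :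
        borelPart (Pol A ∩ Pol B ∩ Pol C) ∈ fiber (finPart (Mono ∩ Cons0 ∩ Cons1)) :=
      borelPart_mem_fiber (((isClone_Pol _).inter (isClone_Pol _)).inter (isClone_Pol _)) h
    have hG := gen_finPart_mem_fiber hX
    have hm : (Mono ∩ Cons0 ∩ Cons1) ⊆ Mono := fun _ hf => hf.1.1
    have h0 : (Mono ∩ Cons0 ∩ Cons1) ⊆ Cons0 := fun _ hf => hf.1.2
    have h1 : (Mono ∩ Cons0 ∩ Cons1) ⊆ Cons1 := fun _ hf => hf.2
    simp only [List.forall_mem_cons, List.not_mem_nil, false_imp_iff, implies_true, and_true]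
    refine ⟨⟨hC (by simp [finPart_inter]), ?_, ?_⟩,
      ⟨hC (by simp [finPart_inter]), ?_, ?_⟩,
      ⟨hC (by simp [finPart_inter]), ?_, ?_⟩,
      ⟨hC (by simp [finPart_inter]), ?_, ?_⟩,
      ⟨hC (by simp [finPart_inter]), ?_, ?_⟩,
      ⟨hC (by simp [finPart_inter]), ?_, ?_⟩,
      ⟨hC (by simp [finPart_inter]), ?_, ?_⟩,
      ⟨hC (by simp [finPart_inter]), ?_, ?_⟩,
      ⟨hG, ?_, ?_⟩⟩
    all_goals first
      | refine eq_gen_of_levels (by first | exact hG | exact hC (by simp [finPart_inter]))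
          (by simp [Set.insert_subset_iff, hg]) fun F hF hS => ?_
        have := closure_facts hF
        simp only [Set.insert_subset_iff, Set.singleton_subset_iff] at hS
        simp_all
      | ext f
        have := mem_facts f
        simp [hg]
        grind


/-! ### Membership of `β(f)` in the named clones -/

theorem beta_mem_of_mem (hF : IsClone F) (hi : opIte ∈ F) (hn : opNot ∈ F) {f : Op} (hf : f ∈ F) :
    beta f ∈ F := by
  obtain ⟨n, f⟩ := f
  exact (hF.ite hi (hF.proj n.first) (hF.not hn (hF.comp hf fun i => hF.not hn (hF.proj (n.next i))))
    (hF.comp hf fun i => hF.proj (n.next i))).congr fun x => by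
    cases x n.first <;> simp [deMorgan]

theorem mem_of_beta_mem (hF : IsClone F) (h0 : opZero ∈ F) {f : Op} (hf : beta f ∈ F) : f ∈ F :=
  (hF.beta (n := f.1) hf (hF.zero h0) fun i => hF.proj i).congr fun _ => rfl

@[simp]
theorem beta_mem_Dual (f : Op) : beta f ∈ Dual := by
  obtain ⟨n, f⟩ := f
  refine has_Dual.2 fun x => ?_
  cases h : x n.first <;> simp [h, deMorgan]

@[simp]
theorem beta_mem_borelOps {f : Op} : beta f ∈ borelOps ↔ f ∈ borelOps :=
  ⟨mem_of_beta_mem isClone_borelOps (by simp), beta_mem_of_mem isClone_borelOps (by simp) (by simp)⟩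

@[simp]
theorem beta_mem_Cont {f : Op} : beta f ∈ Cont ↔ f ∈ Cont :=
  ⟨mem_of_beta_mem (isClone_Pol _) opZero_facts.2.2.2.2.2.2,
    beta_mem_of_mem (isClone_Pol _) opIte_facts.2.2.2.2.2 opNot_facts.2.1⟩

@[simp]
theorem beta_mem_Cons0 {f : Op} : beta f ∈ Cons0 ↔ f ∈ Cons0 := by
  obtain ⟨n, f⟩ := f
  exact has_Cons0.trans (has_Cons0 (f := f)).symm

open Classical in
@[simp]
theorem beta_mem_Lim0 {f : Op} : beta f ∈ Lim0 ↔ f ∈ Lim0 := by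
  refine ⟨mem_of_beta_mem (isClone_Pol _) opZero_facts.2.2.2.2.2.1, fun h => ?_⟩
  obtain ⟨n, f⟩ := f
  obtain ⟨s, hs⟩ := has_Lim0.1 h
  refine has_Lim0.2 ⟨insert n.first (s.image n.next), fun y hy => ?_⟩
  have h0 := hy n.first (Finset.mem_insert_self _ _)
  simp only [h0, cond_false]
  exact hs _ fun i hi => hy _ (Finset.mem_insert_of_mem (Finset.mem_image_of_mem _ hi))

theorem beta_mem_Mono {f : n.Fn} (hf : Has Mono f)
    (hle : ∀ x, f x = true → f (fun i => !x i) = false) : beta ⟨n, f⟩ ∈ Mono := by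
  have hf := has_Mono.1 hf
  refine has_Mono.2 fun x y hxy => Bool.le_iff_imp.2 fun hx => ?_
  have hn := fun i => hxy (n.next i)
  have hxy := hxy n.first
  cases h1 : x n.first <;> cases h2 : y n.first <;> rw [h1, h2] at hxy <;>
    simp only [h1, cond_true, cond_false, deMorgan] at hx ⊢
  · exact Bool.le_iff_imp.1 (hf hn) hx
  · rw [hle _ (Bool.le_iff_imp.1 (hf hn) hx)]
    rfl
  · have : ¬true ≤ false := by decide
    exact absurd hxy this
  · rw [Bool.not_eq_true'] at hx ⊢
    by_contra hc
    rw [Bool.not_eq_false] at hc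
    rw [Bool.le_iff_imp.1 (hf fun i => ?_) hc] at hx
    · simp at hx
    · have := hn i
      revert this
      cases x (n.next i) <;> cases y (n.next i) <;> simp

/-! ### The self-dual Borel clones -/

theorem subset_Dual_of_mem_fiber (hF : F ∈ fiber (finPart (Dual ∩ X))) : F ⊆ Dual :=
  subset_Pol_of_finPart (k := 1) hF.1.1 (hF.2.subset.trans fun _ h => h.1.1)

theorem eq_betaClone_inter_Dual (hF : F ∈ fiber (finPart (Dual ∩ X))) :
    F = betaClone F ∩ Dual :=
  Set.Subset.antisymm (fun _ hf => have hd := subset_Dual_of_mem_fiber hF hf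
    ⟨mem_betaClone_of_Dual hF.1.1 hf hd, hd⟩) fun _ hf => mem_of_mem_betaClone hF.1.1 hf.1 hf.2

theorem betaClone_mem_fiber (hX : ∀ f, beta f ∈ X ↔ f ∈ X) (hF : F ∈ fiber (finPart (Dual ∩ X))) :
    betaClone F ∈ fiber (finPart X) := by
  refine ⟨⟨isClone_betaClone hF.1.1, fun f hf => beta_mem_borelOps.1 (hF.1.2 hf)⟩, ?_⟩
  ext ⟨n, f⟩
  refine and_congr_left fun hn => ?_
  obtain ⟨k, rfl⟩ := hn
  have : beta ⟨.fin k, f⟩ ∈ finPart F ↔ beta ⟨.fin k, f⟩ ∈ finPart (Dual ∩ X) := by rw [hF.2]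
  have hfin : beta ⟨.fin k, f⟩ ∈ finitaryOps := ⟨k + 1, rfl⟩
  simp only [finPart, Set.mem_inter_iff, hfin, beta_mem_Dual, hX, true_and, and_true] at this
  exact this

theorem gen_mem_fiber_of_finPart_subset {S : Set Op} (hX : IsClone X) (hS : S ⊆ borelPart X)
    (h : finPart X ⊆ gen S) : gen S ∈ fiber (finPart X) := by
  have hsub := gen_subset (hX.inter isClone_borelOps) hS
  exact ⟨⟨isClone_gen S, fun f hf => (hsub hf).2⟩,
    Set.Subset.antisymm (fun f hf => ⟨(hsub hf.1).1, hf.2⟩) fun f hf => ⟨h hf, hf.2⟩⟩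

theorem opMedian_mem_of_beta_opBigAnd (hF : IsClone F) (h : beta opBigAnd ∈ F) : opMedian ∈ F :=
  beta_opAnd ▸ opAnd_mem_of_opBigAnd (isClone_betaClone hF) h

theorem beta_opOr_mem (hF : IsClone F) (h : beta opBigOr ∈ F) : beta opOr ∈ F :=
  opOr_mem_of_opBigOr (isClone_betaClone hF) h

theorem opMedian_facts : opMedian ∈ borelOps ∧ opMedian ∈ Dual ∧ opMedian ∈ Mono ∧
    opMedian ∈ Cons0 ∧ opMedian ∈ Lim0 ∧ opMedian ∈ Cont := by
  rw [← beta_opAnd]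
  refine ⟨by simp, by simp, beta_mem_Mono opAnd_facts.2.1 fun x hx => ?_, by simp, by simp,
    by simp⟩
  have := (Bool.and_eq_true_iff.1 hx).1
  simp [show x (0 : Fin 2) = true from this]

theorem opXor3_facts : opXor3 ∈ borelOps ∧ opXor3 ∈ Dual ∧ opXor3 ∈ Cons0 ∧ opXor3 ∈ Lim0 ∧
    opXor3 ∈ Cont :=
  have h0 : opXor3 ∈ Cons0 := has_Cons0.2 rfl
  ⟨mem_borelOps_of_fin _, has_Dual.2 fun x => by
    change (((!x (0 : Fin 3)).xor (!x (1 : Fin 3))).xor (!x (2 : Fin 3))) =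
      !(((x (0 : Fin 3)).xor (x (1 : Fin 3))).xor (x (2 : Fin 3)))
    cases x (0 : Fin 3) <;> cases x (1 : Fin 3) <;> cases x (2 : Fin 3) <;> rfl,
    h0, mem_Lim0_of_Cont (mem_Cont_of_fin _) h0, mem_Cont_of_fin _⟩

attribute [simp] opMedian_facts opXor3_facts

open Classical in
theorem classified_Dual : Classified (finPart Dual) 2 [
    (borelPart Dual, [{relNot}], [{beta opBigOr, opNot}, {beta opBigAnd, opNot}]),
    (gen (finPart Dual), [{relLim, relNot}], [{opMedian, opNot}])] := by
  have hX : IsClone Dual := isClone_Pol _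
  have hg (f : Op) : f ∈ gen (finPart Dual) ↔ f ∈ Dual ∧ f ∈ Cont := mem_gen_finPart hX
  have hex : ∀ F ∈ fiber (finPart Dual), F = borelPart Dual ∨ F = gen (finPart Dual) := by
    intro F hF
    have hF : F ∈ fiber (finPart (Dual ∩ All)) := by simpa [All] using hF
    rw [eq_betaClone_inter_Dual hF]
    obtain ⟨t, ht, h⟩ := (classified_All.2.1 _).1 (betaClone_mem_fiber (by simp) hF)
    simp only [List.mem_cons, List.not_mem_nil, or_false] at ht
    rcases ht with rfl | rfl
    · refine .inl ?_
      ext f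
      simp [← h, and_comm]
    · refine .inr ?_
      ext f
      simp [← h, mem_gen_finPart isClone_All, hg, and_comm]
  have hgen (S : Set Op) (hS : S ⊆ borelPart Dual) (hm : opMedian ∈ gen S) (hn : opNot ∈ gen S) :=
    hex (gen S) (gen_mem_fiber_of_finPart_subset hX hS
      (finPart_Dual_subset (isClone_gen S) hm hn))
  refine classified_of (fun F => decide (beta opBigOr ∈ F)) rfl
    (fun F hF => by simpa [eq_comm] using hex F hF) (by simp [hg]) ?_
  simp only [List.forall_mem_cons, List.not_mem_nil, false_imp_iff, implies_true, and_true]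
  refine ⟨⟨borelPart_mem_fiber hX rfl, rfl, ?_, ?_⟩, gen_finPart_mem_fiber hX, ?_, ?_⟩
  · have hS := subset_gen {beta opBigOr, opNot}
    simp only [Set.insert_subset_iff, Set.singleton_subset_iff] at hS
    refine ((hgen _ (by simp [Set.insert_subset_iff]) (opMedian_mem_of_beta_opOr (isClone_gen _)
      (beta_opOr_mem (isClone_gen _) hS.1)) hS.2).resolve_right fun h => ?_).symm
    rw [h, hg] at hS
    simp at hS
  · have hS := subset_gen {beta opBigAnd, opNot}
    simp only [Set.insert_subset_iff, Set.singleton_subset_iff] at hS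
    refine ((hgen _ (by simp [Set.insert_subset_iff]) (opMedian_mem_of_beta_opBigAnd
      (isClone_gen _) hS.1) hS.2).resolve_right fun h => ?_).symm
    rw [h, hg] at hS
    simp at hS
  · ext f
    have := mem_facts f
    simp [hg]
    grind
  · have hS := subset_gen {opMedian, opNot}
    simp only [Set.insert_subset_iff, Set.singleton_subset_iff] at hS
    refine ((hgen _ (by simp [Set.insert_subset_iff]) hS.1 hS.2).resolve_left fun h => ?_).symm
    have hc : gen {opMedian, opNot} ⊆ Cont :=
      gen_subset (isClone_Pol _) (by simp [Set.insert_subset_iff])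
    have : beta opBigOr ∈ Cont := hc (h.symm ▸ (by simp : beta opBigOr ∈ borelPart Dual))
    simp at this

open Classical in
theorem classified_Dual_Cons0 : Classified (finPart (Dual ∩ Cons0)) 3 [
    (borelPart (Dual ∩ Cons0), [{relNot, relZero}], [{beta opBigOr, opXor3}, {beta opBigOr}]),
    (borelPart (Dual ∩ Lim0), [{relNot, relLimZero}], [{beta opBigAnd, opXor3}]),
    (gen (finPart (Dual ∩ Cons0)), [{relNot, relLim, relZero}], [{opMedian, opXor3}])] := by
  have hX : IsClone (Dual ∩ Cons0) := (isClone_Pol _).inter (isClone_Pol _)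
  have hg (f : Op) : f ∈ gen (finPart (Dual ∩ Cons0)) ↔ (f ∈ Dual ∧ f ∈ Cons0) ∧ f ∈ Cont :=
    mem_gen_finPart hX
  have hex : ∀ F ∈ fiber (finPart (Dual ∩ Cons0)), F = borelPart (Dual ∩ Cons0) ∨
      F = borelPart (Dual ∩ Lim0) ∨ F = gen (finPart (Dual ∩ Cons0)) := by
    intro F hF
    rw [eq_betaClone_inter_Dual hF]
    obtain ⟨t, ht, h⟩ := (classified_Cons0.2.1 _).1 (betaClone_mem_fiber (by simp) hF)
    simp only [List.mem_cons, List.not_mem_nil, or_false] at ht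
    rcases ht with rfl | rfl | rfl
    · refine .inl ?_
      ext f
      simp [← h]
      tauto
    · refine .inr (.inl ?_)
      ext f
      simp [← h]
      tauto
    · refine .inr (.inr ?_)
      ext f
      have := mem_gen_finPart (isClone_Pol _ : IsClone Cons0) (f := f)
      simp only [← h, Set.mem_inter_iff, hg]
      tauto
  have hgen (S : Set Op) (hS : S ⊆ borelPart (Dual ∩ Cons0)) (hm : opMedian ∈ gen S)
      (hx : opXor3 ∈ gen S) :=
    hex (gen S) (gen_mem_fiber_of_finPart_subset hX hS
      (finPart_Dual_Cons0_subset (isClone_gen S) hm hx))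
  refine classified_of (fun F => (decide (beta opBigOr ∈ F), decide (beta opBigAnd ∈ F))) rfl
    (fun F hF => by simpa [eq_comm] using hex F hF) (by simp [hg]) ?_
  simp only [List.forall_mem_cons, List.not_mem_nil, false_imp_iff, implies_true, and_true]
  have hbor (S : Set Op) (hS : S ⊆ borelPart (Dual ∩ Cons0)) (h : beta opBigOr ∈ gen S) :
      borelPart (Dual ∩ Cons0) = gen S := by
    have hor := beta_opOr_mem (isClone_gen _) h
    rcases hgen S hS (opMedian_mem_of_beta_opOr (isClone_gen _) hor)
      (opXor3_mem_of_beta_opOr (isClone_gen _) hor) with h' | h' | h'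
    · exact h'.symm
    · rw [h'] at h
      simp at h
    · rw [h', hg] at h
      simp at h
  refine ⟨⟨borelPart_mem_fiber hX rfl, ?_, ?_, ?_⟩, ⟨borelPart_mem_fiber
    ((isClone_Pol _).inter (isClone_Pol _)) (by simp [finPart_inter]), ?_, ?_⟩,
    gen_finPart_mem_fiber hX, ?_, ?_⟩
  · ext f
    simp
    tauto
  · exact hbor _ (by simp [Set.insert_subset_iff]) (subset_gen _ (by simp))
  · exact hbor _ (by simp) (subset_gen _ (by simp))
  · ext f
    simp
    tauto
  · have hS := subset_gen {beta opBigAnd, opXor3}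
    simp only [Set.insert_subset_iff, Set.singleton_subset_iff] at hS
    have hl : gen {beta opBigAnd, opXor3} ⊆ Lim0 :=
      gen_subset (isClone_Pol _) (by simp [Set.insert_subset_iff])
    rcases hgen _ (by simp [Set.insert_subset_iff]) (opMedian_mem_of_beta_opBigAnd
      (isClone_gen _) hS.1) hS.2 with h | h | h
    · have := hl (h.symm ▸ (by simp : beta opBigOr ∈ borelPart (Dual ∩ Cons0)))
      simp at this
    · exact h.symm
    · rw [h, hg] at hS
      simp at hS
  · ext f
    have := mem_facts f
    simp [hg]
    grind
  · have hS := subset_gen {opMedian, opXor3}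
    simp only [Set.insert_subset_iff, Set.singleton_subset_iff] at hS
    have hc : gen {opMedian, opXor3} ⊆ Cont :=
      gen_subset (isClone_Pol _) (by simp [Set.insert_subset_iff])
    rcases hgen _ (by simp [Set.insert_subset_iff]) hS.1 hS.2 with h | h | h
    · have := hc (h.symm ▸ (by simp : beta opBigAnd ∈ borelPart (Dual ∩ Cons0)))
      simp at this
    · have := hc (h.symm ▸ (by simp : beta opBigAnd ∈ borelPart (Dual ∩ Lim0)))
      simp at this
    · exact h.symm


/-! ### The self-dual monotone Borel clones -/

theorem ceil_opOr_mem_betaClone (hF : IsClone F) (hm : opMedian ∈ F) :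
    ceilOp opOr ∈ betaClone F := by
  have p (i : (Arity.fin 3).Idx) : Has F fun x : (Arity.fin 3).Idx → Bool => x i := hF.proj i
  refine (hF.median hm (hF.median hm (p 0) (p 1) (p 2)) (p 1)
    (hF.median hm (p 0) (p 1) (p 3))).congr fun x => ?_
  change _ = bif x (0 : Fin 4) then !(!x (1 : Fin 4) && (!x (2 : Fin 4) || !x (3 : Fin 4)))
    else x (1 : Fin 4) && (x (2 : Fin 4) || x (3 : Fin 4))
  cases x (0 : Fin 4) <;> cases x (1 : Fin 4) <;> cases x (2 : Fin 4) <;>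
    cases x (3 : Fin 4) <;> rfl

open Classical in
/-- The identity `β(⋀)(y₀, y₁, …) = β(⌈⋁⌉)(y₁, y₀, y₁, …)`. -/
theorem beta_opBigAnd_mem_of_ceil (hF : IsClone F) (h : ceilOp opBigOr ∈ betaClone F) :
    beta opBigAnd ∈ F := by
  have h : Has (n := .omega) F (fun x : ℕ → Bool => bif x 0 then
    !(!x 1 && decide (∃ i, (!x (i + 2)) = true)) else x 1 && decide (∃ i, x (i + 2) = true)) := h
  refine (hF.minor (m := .omega) h
    fun i : ℕ => (Nat.casesOn i 1 fun i => Nat.casesOn i 0 fun i => i + 1 : ℕ)).congr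
    fun (x : ℕ → Bool) => ?_
  change (bif x 1 then !(!x 0 && decide (∃ i, (!x (i + 1)) = true))
    else x 0 && decide (∃ i, x (i + 1) = true)) =
      bif x 0 then !decide (∀ i, (!x (i + 1)) = true) else decide (∀ i, x (i + 1) = true)
  cases h0 : x 0 <;> cases h1 : x 1 <;> rw [Bool.eq_iff_iff] <;> simp
  · exact ⟨0, h1⟩
  · exact ⟨0, h1⟩

/-- A self-dual monotone function preserving meets of decreasing sequences also preserves joins of
increasing sequences, so it is continuous. -/
theorem beta_opBigAnd_mem_of_not_Cont (hF : IsClone F) (hm : opMedian ∈ F) {f : Op} (hf : f ∈ F)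
    (hd : f ∈ Dual) (hM : f ∈ Mono) (hc : f ∉ Cont) : beta opBigAnd ∈ F := by
  refine beta_opBigAnd_mem_of_ceil hF (ceil_mem_of_Mono (isClone_betaClone hF)
    (ceil_opOr_mem_betaClone hF hm) (mem_betaClone_of_Dual hF hf hd) hM fun h => hc ?_)
  refine mem_Cont_of_Incr_of_Decr ?_ h
  rw [← deMorgan_mem_Decr, deMorgan_eq_of_Dual hd]
  exact h

open Classical in
/-- The identity `β(⌈⋁⌉)(z, x₀, x₁, …) = m(z, x₀, β(⋀)(x₀, x₁, …))`. -/
theorem ceil_mem_betaClone (hF : IsClone F) (h : beta opBigAnd ∈ F) :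
    ceilOp opBigOr ∈ betaClone F := by
  have p (i : ℕ) : Has (n := .omega) F fun x : ℕ → Bool => x i := hF.proj (n := .omega) i
  refine (hF.median (opMedian_mem_of_beta_opBigAnd hF h) (p 0) (p 1)
    (hF.beta (n := .omega) h (p 1) fun i : ℕ => p (i + 2))).congr fun (x : ℕ → Bool) => ?_
  change _ = bif x 0 then !(!x 1 && decide (∃ i, (!x (i + 2)) = true))
    else x 1 && decide (∃ i, x (i + 2) = true)
  cases h0 : x 0 <;> cases h1 : x 1 <;> rw [Bool.eq_iff_iff] <;> simp

open Classical in
/-- With `⌈⋁⌉` in place of `⋁`, a positive Borel definition of `f` turns into one of `xᵢ ∧ f`. -/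
theorem has_and_of_Mono (hF : IsClone F) (h0 : opZero ∈ F) (hI : opBigAnd ∈ F)
    (hc : ceilOp opBigOr ∈ F) {f : n.Fn} (hf : Has borelOps f) (hm : Has Mono f) (i : n.Idx) :
    Has F fun x => x i && f x := by
  have hf : Measurable f := hf
  have hand := opAnd_mem_of_opBigAnd hF hI
  have := positive_induction
    (P := fun A : Set (n.Idx → Bool) => Has F fun x => x i && decide (x ∈ A))
    ((hF.zero h0).congr fun x => by simp) ((hF.proj i).congr fun x => by simp)
    (fun j => (hF.and hand (hF.proj i) (hF.proj j)).congr fun x => by simp)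
    (fun A hA => (hF.ceilBigOr hc (hF.proj i) hA).congr fun x => by cases x i <;> simp)
    (fun A hA => (hF.and hand (hF.proj i) (hF.bigAnd hI hA)).congr fun x => by
      cases x i <;> simp)
    (hf (measurableSet_singleton true)) fun x y hxy hx =>
      Bool.le_iff_imp.1 (has_Mono.1 hm hxy) hx
  exact this.congr fun x => by simp

/-- The function `m(xᵢ, xⱼ, f)` is obtained from `xᵢ ∧ f` by symmetrization with `β`. -/
theorem has_median_of_Dual_Mono (hF : IsClone F) (h : beta opBigAnd ∈ F) {f : n.Fn}
    (hf : Has borelOps f) (hd : Has Dual f) (hm : Has Mono f) (i j : n.Idx) :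
    Has F fun x => (x i && x j) || (x i && f x) || (x j && f x) := by
  have hq : Has (betaClone F) fun x => x i && f x :=
    has_and_of_Mono (isClone_betaClone hF) (opZero_mem_betaClone hF) h (ceil_mem_betaClone hF h)
      hf hm i
  refine (hF.beta hq (hF.proj j) fun i => hF.proj i).congr fun x => ?_
  have := has_Dual.1 hd x
  simp only [this]
  cases x i <;> cases x j <;> cases f x <;> rfl

theorem exists_finset_of_Dual_Lim0 {f : n.Fn} (hd : Has Dual f) (hl : Has Lim0 f) :
    ∃ s : Finset n.Idx, ∀ x, ∃ i ∈ s, x i = f x := by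
  obtain ⟨s, hs⟩ := has_Lim0.1 hl
  refine ⟨s, fun x => ?_⟩
  by_contra! hc
  cases hf : f x
  · have := hs (fun i => !x i) fun i hi => by simpa [hf] using hc i hi
    rw [has_Dual.1 hd, hf] at this
    simp at this
  · have := hs x fun i hi => by simpa [hf] using hc i hi
    rw [hf] at this
    simp at this

theorem mem_of_Dual_Mono_Lim0 (hF : IsClone F) (h : beta opBigAnd ∈ F) {f : Op}
    (hf : f ∈ borelOps) (hd : f ∈ Dual) (hm : f ∈ Mono) (hl : f ∈ Lim0) : f ∈ F := by
  obtain ⟨n, f⟩ := f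
  obtain ⟨s, hs⟩ := exists_finset_of_Dual_Lim0 hd hl
  refine bakerPixley hF (opMedian_mem_of_beta_opBigAnd hF h) (ι := s × s)
    (fun p => has_median_of_Dual_Mono hF h hf hd hm p.1 p.2) fun x y => ?_
  obtain ⟨i, hi, hx⟩ := hs x
  obtain ⟨j, hj, hy⟩ := hs y
  refine ⟨(⟨i, hi⟩, ⟨j, hj⟩), ?_, ?_⟩
  · simp only [hx]
    cases f x <;> cases x j <;> rfl
  · simp only [hy]
    cases f y <;> cases y i <;> rfl

open Classical in
theorem has_forall_mem (hF : IsClone F) (hand : opAnd ∈ F) (h1 : opOne ∈ F) (s : Finset n.Idx) :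
    Has F fun x : n.Idx → Bool => decide (∀ i ∈ s, x i = true) := by
  induction s using Finset.induction_on with
  | empty => exact (hF.one h1).congr fun x => by simp
  | insert i s _ ih => exact (hF.and hand (hF.proj i) ih).congr fun x => by simp

open Classical in
/-- The function that is the common value of the variables in `s` if they agree, and `f`
otherwise. -/
noncomputable def unanimity (s : Finset n.Idx) (f : n.Fn) : n.Fn := fun x =>
  decide (∀ i ∈ s, x i = true) || (f x && !decide (∀ i ∈ s, (!x i) = true))

theorem unanimity_facts {s : Finset n.Idx} (hs : s.Nonempty) {f : n.Fn} (hf : Has borelOps f)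
    (hd : Has Dual f) (hm : Has Mono f) : Has borelOps (unanimity s f) ∧
      Has Dual (unanimity s f) ∧ Has Mono (unanimity s f) ∧ Has Lim0 (unanimity s f) := by
  obtain ⟨k, hk⟩ := hs
  refine ⟨?_, has_Dual.2 fun x => ?_, has_Mono.2 fun x y hxy => Bool.le_iff_imp.2 fun h => ?_,
    has_Lim0.2 ⟨s, fun x hx => ?_⟩⟩
  · have B := isClone_borelOps
    have h := has_forall_mem (n := n) B opAnd_facts.1 opOne_facts.1 s
    exact B.or opOr_facts.1 h (B.and opAnd_facts.1 hf (B.not opNot_facts.1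
      (B.comp h fun i => B.not opNot_facts.1 (B.proj i))))
  · have := has_Dual.1 hd x
    simp only [unanimity, this, Bool.not_not]
    have h : ¬(decide (∀ i ∈ s, x i = true) = true ∧ decide (∀ i ∈ s, (!x i) = true) = true) := by
      rintro ⟨h1, h2⟩
      have := of_decide_eq_true h2 k hk
      rw [of_decide_eq_true h1 k hk] at this
      simp at this
    revert h
    generalize decide (∀ i ∈ s, x i = true) = a
    generalize decide (∀ i ∈ s, (!x i) = true) = b
    cases a <;> cases b <;> cases f x <;> simp
  · have hxy' := fun i => Bool.le_iff_imp.1 (hxy i)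
    simp only [unanimity, Bool.or_eq_true, Bool.and_eq_true, Bool.not_eq_true',
      decide_eq_true_eq, decide_eq_false_iff_not] at h ⊢
    refine h.imp (fun h i hi => hxy' i (h i hi)) fun h =>
      ⟨Bool.le_iff_imp.1 (has_Mono.1 hm hxy) h.1, fun hy => h.2 fun i hi => ?_⟩
    have h1 := hxy' i
    have h2 := hy i hi
    revert h1 h2
    cases x i <;> cases y i <;> simp
  · have h1 : ¬∀ i ∈ s, x i = true := fun h => by
      have := h k hk
      rw [hx k hk] at this
      simp at this
    have h2 : ∀ i ∈ s, (!x i) = true := fun i hi => by simp [hx i hi]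
    simp only [unanimity, decide_eq_true h2, decide_eq_false h1]
    simp

theorem mem_Cons0_of_Dual_Mono {f : Op} (hd : f ∈ Dual) (hm : f ∈ Mono) : f ∈ Cons0 := by
  obtain ⟨n, f⟩ := f
  refine has_Cons0.2 ?_
  by_contra hc
  rw [Bool.not_eq_false] at hc
  have h1 := has_Dual.1 hd fun _ => false
  rw [hc, Bool.le_iff_imp.1 (has_Mono.1 hm fun _ => Bool.false_le _) hc] at h1
  simp at h1

open Classical in
/-- A function `g ∈ F` that is discontinuous at `0` is used as a limit: `f` is the value of `g` at a
sequence of functions that are continuous at `0`, and converge to `f` except at the constants. -/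
theorem mem_of_Dual_Mono (hF : IsClone F) (h : beta opBigAnd ∈ F) {g : Op} (hg : g ∈ F)
    (hgd : g ∈ Dual) (hgm : g ∈ Mono) (hgl : g ∉ Lim0) {f : Op} (hf : f ∈ borelOps)
    (hd : f ∈ Dual) (hm : f ∈ Mono) : f ∈ F := by
  obtain ⟨m, g⟩ := g
  obtain ⟨n, f⟩ := f
  have hgm' := has_Mono.1 hgm
  obtain ⟨y, k, hy, hgy⟩ := exists_seq_of_not_Lim0 hgl
  obtain ⟨t, ht, ht'⟩ := exists_exhaustion n
  let s (l : m.Idx) : Finset n.Idx := insert n.zero (t (k l))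
  have hs (l) := unanimity_facts (s := s l) ⟨_, Finset.mem_insert_self _ _⟩ hf hd hm
  have hmem : Has F fun x => g fun l => unanimity (s l) f x := hF.comp hg fun l =>
    mem_of_Dual_Mono_Lim0 hF h (hs l).1 (hs l).2.1 (hs l).2.2.1 (hs l).2.2.2
  -- the value at the points with first coordinate `0`; the others are complements of these
  have key : ∀ x, x n.zero = false → (g fun l => unanimity (s l) f x) = f x := by
    intro x hx
    have hnot : ∀ l, ¬∀ i ∈ s l, x i = true := fun l h => by
      rw [h _ (Finset.mem_insert_self _ _)] at hx
      simp at hx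
    cases hfx : f x
    · have hz : (fun l => unanimity (s l) f x) = fun _ => false := funext fun l => by
        simp [unanimity, decide_eq_false (hnot l), hfx]
      rw [hz]
      exact has_Cons0.1 (mem_Cons0_of_Dual_Mono hgd hgm)
    · obtain ⟨i, hi⟩ : ∃ i, x i = true := by
        by_contra! hc
        have hx0 : x = fun _ => false := funext fun i => by simpa using hc i
        rw [hx0, has_Cons0.1 (mem_Cons0_of_Dual_Mono hd hm)] at hfx
        simp at hfx
      obtain ⟨j, hj⟩ := ht' i
      refine Bool.le_iff_imp.1 (hgm' fun l => Bool.le_iff_imp.2 fun hl => ?_) (hgy j)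
      have hjl : j ≤ k l := by
        by_contra hjl
        rw [hy l j (by omega)] at hl
        simp at hl
      have hne : ¬∀ i ∈ s l, (!x i) = true := fun h => by
        have := h i (Finset.mem_insert_of_mem (ht hjl hj))
        rw [hi] at this
        simp at this
      simp only [unanimity, hfx, decide_eq_false hne]
      simp
  refine hmem.congr fun x => ?_
  cases hx : x n.zero
  · exact key x hx
  · have := key (fun i => !x i) (by simp [hx])
    have e : (fun l => unanimity (s l) f fun i => !x i) = fun l => !unanimity (s l) f x :=
      funext fun l => has_Dual.1 (hs l).2.1 x
    rw [e, has_Dual.1 hgd, has_Dual.1 hd] at this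
    exact Bool.not_inj this

open Classical in
theorem opLiminf_mem (hF : IsClone F) (hI : opBigAnd ∈ F) (hU : opBigOr ∈ F) : opLiminf ∈ F :=
  (hF.bigOr (m := .omega) hU fun i => hF.bigAnd hI fun j : ℕ =>
    hF.proj (n := .omega) (i + j : ℕ)).congr fun (x : ℕ → Bool) => by
    simp only [decide_eq_true_eq, decide_eq_decide]
    exact exists_congr fun i => ⟨fun h j hj => by simpa [Nat.add_sub_cancel' hj] using h (j - i),
      fun h j => h _ (Nat.le_add_right i j)⟩

open Classical in
theorem opLiminf_facts : opLiminf ∈ borelOps ∧ opLiminf ∈ Mono ∧ opLiminf ∈ Cons0 ∧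
    opLiminf ∉ Lim0 := by
  refine ⟨opLiminf_mem isClone_borelOps (by simp) (by simp),
    opLiminf_mem (isClone_Pol {relLe}) opBigAnd_facts.2.1 opBigOr_facts.2.1,
    has_Cons0.2 (decide_eq_false fun ⟨i, h⟩ => by simpa using h i le_rfl), fun h => ?_⟩
  obtain ⟨s, hs⟩ := has_Lim0.1 h
  obtain ⟨b, hb⟩ := s.bddAbove
  have := hs (fun j : ℕ => decide (b < j)) fun i hi => decide_eq_false (not_lt.2 (hb hi))
  exact of_decide_eq_false this ⟨b + 1, fun j hj => decide_eq_true hj⟩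

open Classical in
theorem beta_facts : beta opBigAnd ∈ Mono ∧ beta opLiminf ∈ Mono := by
  refine ⟨beta_mem_Mono opBigAnd_facts.2.1 fun x hx => ?_,
    beta_mem_Mono opLiminf_facts.2.1 fun x hx => ?_⟩
  · exact decide_eq_false fun h => by simpa [of_decide_eq_true hx (0 : ℕ)] using h (0 : ℕ)
  · obtain ⟨i, hi⟩ := of_decide_eq_true hx
    refine decide_eq_false fun ⟨j, hj⟩ => ?_
    have := hj (max i j) (le_max_right i j)
    simp [hi (max i j) (le_max_left i j)] at this

attribute [simp] opLiminf_facts beta_facts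

open Classical in
/-- Inserting `x, y, x, y, …` into `lim inf` yields `x ∧ y`. -/
theorem opMedian_mem_of_beta_opLiminf (hF : IsClone F) (h : beta opLiminf ∈ F) : opMedian ∈ F := by
  refine beta_opAnd ▸ (((isClone_betaClone hF).minor (n := .omega) (m := .fin 1) h
    fun i : ℕ => (if i % 2 = 0 then 0 else 1 : Fin 2)).congr fun x => ?_ : opAnd ∈ betaClone F)
  rw [Bool.eq_iff_iff, Bool.and_eq_true]
  refine decide_eq_true_iff.trans ⟨fun ⟨i, hi⟩ => ?_, fun hx => ⟨0, fun j _ => ?_⟩⟩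
  · have h0 : x (if 2 * i % 2 = 0 then 0 else 1 : Fin 2) = true := hi (2 * i) (by omega)
    have h1 : x (if (2 * i + 1) % 2 = 0 then 0 else 1 : Fin 2) = true := hi (2 * i + 1) (by omega)
    rw [if_pos (by omega)] at h0
    rw [if_neg (by omega)] at h1
    exact ⟨h0, h1⟩
  · change x (if j % 2 = 0 then 0 else 1 : Fin 2) = true
    split_ifs
    · exact hx.1
    · exact hx.2

open Classical in
theorem classified_Dual_Mono : Classified (finPart (Dual ∩ Mono)) 3 [
    (borelPart (Dual ∩ Mono), [{relNot, relLe}], [{beta opLiminf}]),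
    (borelPart (Dual ∩ Mono ∩ Lim0), [{relNot, relLe, relLimZero}], [{beta opBigAnd}]),
    (gen (finPart (Dual ∩ Mono)), [{relNot, relLe, relLim}], [{opMedian}])] := by
  have hX : IsClone (Dual ∩ Mono) := (isClone_Pol _).inter (isClone_Pol _)
  have hg (f : Op) : f ∈ gen (finPart (Dual ∩ Mono)) ↔ (f ∈ Dual ∧ f ∈ Mono) ∧ f ∈ Cont :=
    mem_gen_finPart hX
  have hex : ∀ F ∈ fiber (finPart (Dual ∩ Mono)), F = borelPart (Dual ∩ Mono) ∨
      F = borelPart (Dual ∩ Mono ∩ Lim0) ∨ F = gen (finPart (Dual ∩ Mono)) := by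
    intro F hF
    have hd : F ⊆ Dual := subset_Dual_of_mem_fiber hF
    have hm : F ⊆ Mono := subset_Mono_of_mem_fiber hF fun _ h => h.1.2
    have hmed : opMedian ∈ F := mem_of_mem_fiber hF ⟨by simp, 2, rfl⟩
    by_cases hc : F ⊆ Cont
    · exact .inr (.inr (Set.Subset.antisymm (fun f hf => (hg f).2 ⟨⟨hd hf, hm hf⟩, hc hf⟩)
        (gen_subset_of_mem_fiber hF)))
    obtain ⟨g, hgF, hgc⟩ := Set.not_subset.1 hc
    have hb := beta_opBigAnd_mem_of_not_Cont hF.1.1 hmed hgF (hd hgF) (hm hgF) hgc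
    by_cases hl : F ⊆ Lim0
    · exact .inr (.inl (Set.Subset.antisymm
        (fun f hf => ⟨⟨⟨hd hf, hm hf⟩, hl hf⟩, hF.1.2 hf⟩)
        fun f hf => mem_of_Dual_Mono_Lim0 hF.1.1 hb hf.2 hf.1.1.1 hf.1.1.2 hf.1.2))
    · obtain ⟨φ, hφ, hφl⟩ := Set.not_subset.1 hl
      exact .inl (Set.Subset.antisymm (fun f hf => ⟨⟨hd hf, hm hf⟩, hF.1.2 hf⟩) fun f hf =>
        mem_of_Dual_Mono hF.1.1 hb hφ (hd hφ) (hm hφ) hφl hf.2 hf.1.1 hf.1.2)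
  have hgen (S : Set Op) (hS : S ⊆ borelPart (Dual ∩ Mono)) (hm : opMedian ∈ gen S) :=
    hex (gen S) (gen_mem_fiber_of_finPart_subset hX hS
      (finPart_Dual_Mono_subset (isClone_gen S) hm))
  refine classified_of (fun F => (decide (beta opLiminf ∈ F), decide (beta opBigAnd ∈ F))) rfl
    (fun F hF => by simpa [eq_comm] using hex F hF) (by simp [hg]) ?_
  simp only [List.forall_mem_cons, List.not_mem_nil, false_imp_iff, implies_true, and_true]
  refine ⟨⟨borelPart_mem_fiber hX rfl, ?_, ?_⟩, ⟨borelPart_mem_fiber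
    (((isClone_Pol _).inter (isClone_Pol _)).inter (isClone_Pol _)) ?_, ?_, ?_⟩,
    gen_finPart_mem_fiber hX, ?_, ?_⟩
  · ext f
    simp
    tauto
  · have hS : beta opLiminf ∈ gen {beta opLiminf} := subset_gen _ rfl
    rcases hgen _ (by simp) (opMedian_mem_of_beta_opLiminf (isClone_gen _) hS) with h | h | h
    · exact h.symm
    · rw [h] at hS
      simp at hS
    · rw [h, hg] at hS
      simpa using mem_Lim0_of_Cont hS.2 (by simp)
  · rw [finPart_inter, finPart_Lim0]
    exact Set.inter_eq_left.2 fun f hf => ⟨mem_Cons0_of_Dual_Mono hf.1.1 hf.1.2, hf.2⟩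
  · ext f
    simp
    tauto
  · have hS : beta opBigAnd ∈ gen {beta opBigAnd} := subset_gen _ rfl
    have hl : gen {beta opBigAnd} ⊆ Lim0 := gen_subset (isClone_Pol _) (by simp)
    rcases hgen _ (by simp) (opMedian_mem_of_beta_opBigAnd (isClone_gen _) hS) with h | h | h
    · have := hl (h.symm ▸ (by simp : beta opLiminf ∈ borelPart (Dual ∩ Mono)))
      simp at this
    · exact h.symm
    · rw [h, hg] at hS
      simp at hS
  · ext f
    have := mem_facts f
    simp [hg]
    grind
  · have hS : opMedian ∈ gen {opMedian} := subset_gen _ rfl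
    have hc : gen {opMedian} ⊆ Cont := gen_subset (isClone_Pol _) (by simp)
    rcases hgen _ (by simp) hS with h | h | h
    · have := hc (h.symm ▸ (by simp : beta opBigAnd ∈ borelPart (Dual ∩ Mono)))
      simp at this
    · have := hc (h.symm ▸ (by simp : beta opBigAnd ∈ borelPart (Dual ∩ Mono ∩ Lim0)))
      simp at this
    · exact h.symm


/-! ### Uniqueness of the Borel clone over a finitary clone -/

open Classical in
theorem has_minor_opBigAnd (hF : IsClone F) (hand : opAnd ∈ F) {k : ℕ} (σ : ℕ → (Arity.fin k).Idx) :
    Has F fun x : (Arity.fin k).Idx → Bool => opBigAnd.2 fun i : ℕ => x (σ i) := by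
  refine (has_conj hF hand (σ 0) (Finset.univ.filter fun j => ∃ i, σ i = j)).congr fun x => ?_
  change _ = decide (∀ i, x (σ i) = true)
  rw [Bool.eq_iff_iff]
  simp
  intro h
  exact h 0

open Classical in
theorem has_minor_opBigOr (hF : IsClone F) (hor : opOr ∈ F) {k : ℕ} (σ : ℕ → (Arity.fin k).Idx) :
    Has F fun x : (Arity.fin k).Idx → Bool => opBigOr.2 fun i : ℕ => x (σ i) := by
  refine (has_dualSet.1 (has_minor_opBigAnd hF.dualSet
    (mem_dualSet.2 (by rwa [deMorgan_opAnd])) σ)).congr fun x => ?_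
  change (!decide (∀ i, (!x (σ i)) = true)) = decide (∃ i, x (σ i) = true)
  rw [Bool.eq_iff_iff]
  simp

/-- Over a finitary clone that is not affine there is a discontinuous Borel function all of whose
finite minors belong to the clone. -/
theorem exists_mem_maxExt_not_mem_Cont (hG : IsFinitaryClone G) (h : ¬G ⊆ Aff) :
    ∃ f ∈ maxExt G, f ∉ Cont := by
  have hF := isClone_gen G
  have hfin {k : ℕ} {f : (Arity.fin k).Fn} (hf : Has (gen G) f) : Has G f :=
    (gen_mem_fiber hG).2.subset ⟨hf, k, rfl⟩
  rcases opAnd_or_opOr_or_opMedian_mem hF fun hs => h ((subset_gen G).trans hs) with ha | ho | hm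
  · exact ⟨opBigAnd, ⟨by simp, fun k σ => hfin (has_minor_opBigAnd hF ha σ)⟩, by simp⟩
  · exact ⟨opBigOr, ⟨by simp, fun k σ => hfin (has_minor_opBigOr hF ho σ)⟩, by simp⟩
  · have hX : IsClone (Dual ∩ Mono) := (isClone_Pol _).inter (isClone_Pol _)
    have hb : beta opBigAnd ∈ Dual ∩ Mono := by simp
    exact ⟨beta opBigAnd, ⟨by simp, fun k σ => hfin (finPart_Dual_Mono_subset hF hm
      ⟨hX.minor hb σ, k, rfl⟩)⟩, by simp⟩

theorem fiber_eq_singleton (hG : IsFinitaryClone G) (h : G ⊆ Aff) : fiber G = {gen G} :=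
  Set.eq_singleton_iff_unique_mem.2 ⟨gen_mem_fiber hG, fun _ hF =>
    ((subset_maxExt_of_mem_fiber hF).trans (maxExt_subset_gen hG h)).antisymm
      (gen_subset_of_mem_fiber hF)⟩

theorem existsUnique_mem_fiber_iff (hG : IsFinitaryClone G) :
    (∃! F : Set Op, F ∈ fiber G) ↔ G ⊆ Aff := by
  refine ⟨fun hu => ?_, fun h => ⟨gen G, gen_mem_fiber hG, fun F hF => ?_⟩⟩
  · by_contra h
    obtain ⟨f, hf, hc⟩ := exists_mem_maxExt_not_mem_Cont hG h
    rw [hu.unique (maxExt_mem_fiber hG) (gen_mem_fiber hG)] at hf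
    exact hc (gen_subset (isClone_Pol _)
      ((subset_finitaryOps hG).trans finitaryOps_subset_Cont) hf)
  · exact (fiber_eq_singleton hG h).subset hF

theorem gen_eq_borelPart_pointwiseClosure (hG : IsFinitaryClone G) (h : G ⊆ Aff) :
    gen G = borelPart (pointwiseClosure (gen G)) :=
  Set.Subset.antisymm (fun _ hf => ⟨subset_closure hf, (gen_mem_fiber hG).1.2 hf⟩)
    ((borelPart_pointwiseClosure_subset_maxExt hG).trans (maxExt_subset_gen hG h))

theorem borelPart_Aff : borelPart Aff = gen (finPart Aff) := by
  ext f
  have hX : IsClone Aff := isClone_Pol _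
  rw [mem_gen_finPart hX]
  exact ⟨fun hf => ⟨hf.1, mem_Cont_of_Aff hf.1 hf.2⟩, fun hf => ⟨hf.1, Cont_subset_borelOps hf.2⟩⟩

/-! ### Coincidences among the self-dual clones -/

theorem Dual_inter_Cons0 : Dual ∩ Cons0 = Dual ∩ Cons1 :=
  Set.ext fun _ => and_congr_right mem_Cons0_of_Dual

theorem Dual_inter_Lim0 : Dual ∩ Lim0 = Dual ∩ Lim1 :=
  Set.ext fun _ => and_congr_right mem_Lim0_of_Dual

end BorelClone

theorem theorem1p1 :
    -- (a) the eight clones of the top cube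
    Classified (finPart All) 2 [
        (borelPart All, [∅], [{opBigOr, opNot}, {opBigAnd, opBigOr, opZero, opOne, opNot}]),
        (gen (finPart All), [{relLim}], [{opOr, opNot}, {opAnd, opOr, opZero, opOne, opNot}])] ∧
    Classified (finPart Cons0) 3 [
        (borelPart Cons0, [{relZero}], [{opBigOr, opNimp}, {opBigAnd, opBigOr, opZero, opNimp}]),
        (borelPart Lim0, [{relLimZero}],
          [{opBigAnd, opOr, opNimp}, {ceilOp opBigOr, opOr, opNimp},
            {opBigAnd, ceilOp opBigOr, opOr, opZero, opNimp}]),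
        (gen (finPart Cons0), [{relLim, relZero}], [{opOr, opNimp}, {opAnd, opOr, opZero, opNimp}])] ∧
    Classified (finPart Cons1) 3 [
        (borelPart Cons1, [{relOne}], [{opBigAnd, opImp}, {opBigOr, opBigAnd, opOne, opImp}]),
        (borelPart Lim1, [{relLimOne}],
          [{opBigOr, opAnd, opImp}, {floorOp opBigAnd, opAnd, opImp},
            {opBigOr, floorOp opBigAnd, opAnd, opOne, opImp}]),
        (gen (finPart Cons1), [{relLim, relOne}], [{opAnd, opImp}, {opOr, opAnd, opOne, opImp}])] ∧
    Classified (finPart (Cons0 ∩ Cons1)) 5 [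
        (borelPart (Cons0 ∩ Cons1), [{relZero, relOne}], [{opBigAnd, opBigOr, opIte}]),
        (borelPart (Cons0 ∩ Lim1), [{relZero, relLimOne}], [{opBigOr, opIte}]),
        (borelPart (Lim0 ∩ Cons1), [{relLimZero, relOne}], [{opBigAnd, opIte}]),
        (borelPart (Lim0 ∩ Lim1), [{relLimZero, relLimOne}],
          [{floorOp opBigAnd, opIte}, {ceilOp opBigOr, opIte}]),
        (gen (finPart (Cons0 ∩ Cons1)), [{relLim, relZero, relOne}], [{opIte}])] ∧
    Classified (finPart Mono) 4 [
        (borelPart Mono, [{relLe}], [{opBigAnd, opBigOr, opZero, opOne}]),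
        (borelPart Incr, [{relJoinUp}], [{opAnd, opBigOr, opZero, opOne}]),
        (borelPart Decr, [{relMeetDown}], [{opBigAnd, opOr, opZero, opOne}]),
        (gen (finPart Mono), [{relLim, relLe}], [{opAnd, opOr, opZero, opOne}])] ∧
    Classified (finPart (Mono ∩ Cons0)) 6 [
        (borelPart (Mono ∩ Cons0), [{relLe, relZero}], [{opBigAnd, opBigOr, opZero}]),
        (borelPart (Incr ∩ Cons0), [{relJoinUp, relZero}], [{opAnd, opBigOr, opZero}]),
        (borelPart (Mono ∩ Lim0), [{relLe, relLimZero}],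
          [{opBigAnd, ceilOp opBigOr, opOr, opZero}]),
        (borelPart (Incr ∩ Lim0), [{relJoinUp, relLimZero}], [{ceilOp opBigOr, opOr, opZero}]),
        (borelPart (Decr ∩ Cons0), [{relMeetDown, relZero}, {relMeetDown, relLimZero}],
          [{opBigAnd, opOr, opZero}]),
        (gen (finPart (Mono ∩ Cons0)), [{relLe, relLim, relZero}], [{opAnd, opOr, opZero}])] ∧
    Classified (finPart (Mono ∩ Cons1)) 6 [
        (borelPart (Mono ∩ Cons1), [{relLe, relOne}], [{opBigOr, opBigAnd, opOne}]),
        (borelPart (Decr ∩ Cons1), [{relMeetDown, relOne}], [{opOr, opBigAnd, opOne}]),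
        (borelPart (Mono ∩ Lim1), [{relLe, relLimOne}],
          [{opBigOr, floorOp opBigAnd, opAnd, opOne}]),
        (borelPart (Decr ∩ Lim1), [{relMeetDown, relLimOne}], [{floorOp opBigAnd, opAnd, opOne}]),
        (borelPart (Incr ∩ Cons1), [{relJoinUp, relOne}, {relJoinUp, relLimOne}],
          [{opBigOr, opAnd, opOne}]),
        (gen (finPart (Mono ∩ Cons1)), [{relLe, relLim, relOne}], [{opOr, opAnd, opOne}])] ∧
    Classified (finPart (Mono ∩ Cons0 ∩ Cons1)) 9 [
        (borelPart (Mono ∩ Cons0 ∩ Cons1), [{relLe, relZero, relOne}], [{opBigAnd, opBigOr}]),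
        (borelPart (Mono ∩ Cons0 ∩ Lim1), [{relLe, relZero, relLimOne}],
          [{floorOp opBigAnd, opAnd, opBigOr}]),
        (borelPart (Incr ∩ Cons0 ∩ Cons1), [{relJoinUp, relZero, relOne}], [{opAnd, opBigOr}]),
        (borelPart (Mono ∩ Lim0 ∩ Cons1), [{relLe, relLimZero, relOne}],
          [{opBigAnd, ceilOp opBigOr, opOr}]),
        (borelPart (Decr ∩ Cons0 ∩ Cons1), [{relMeetDown, relZero, relOne}], [{opBigAnd, opOr}]),
        (borelPart (Mono ∩ Lim0 ∩ Lim1), [{relLe, relLimZero, relLimOne}],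
          [{floorOp opBigAnd, ceilOp opBigOr}]),
        (borelPart (Incr ∩ Lim0 ∩ Cons1), [{relJoinUp, relLimZero, relOne}],
          [{ceilOp opBigOr, opOr}]),
        (borelPart (Decr ∩ Cons0 ∩ Lim1), [{relMeetDown, relZero, relLimOne}],
          [{floorOp opBigAnd, opAnd}]),
        (gen (finPart (Mono ∩ Cons0 ∩ Cons1)), [{relLe, relLim, relZero, relOne}], [{opAnd, opOr}])] ∧
    -- (b) the self-dual clones
    Classified (finPart Dual) 2 [
        (borelPart Dual, [{relNot}], [{beta opBigOr, opNot}, {beta opBigAnd, opNot}]),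
        (gen (finPart Dual), [{relLim, relNot}], [{opMedian, opNot}])] ∧
    Classified (finPart (Dual ∩ Cons0)) 3 [
        (borelPart (Dual ∩ Cons0), [{relNot, relZero}], [{beta opBigOr, opXor3}, {beta opBigOr}]),
        (borelPart (Dual ∩ Lim0), [{relNot, relLimZero}], [{beta opBigAnd, opXor3}]),
        (gen (finPart (Dual ∩ Cons0)), [{relNot, relLim, relZero}], [{opMedian, opXor3}])] ∧
    finPart (Dual ∩ Cons0) = finPart (Dual ∩ Cons1) ∧
    borelPart (Dual ∩ Cons0) = borelPart (Dual ∩ Cons1) ∧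
    borelPart (Dual ∩ Lim0) = borelPart (Dual ∩ Lim1) ∧
    gen (finPart (Dual ∩ Cons0)) = gen (finPart (Dual ∩ Cons1)) ∧
    Classified (finPart (Dual ∩ Mono)) 3 [
        (borelPart (Dual ∩ Mono), [{relNot, relLe}], [{beta opLiminf}]),
        (borelPart (Dual ∩ Mono ∩ Lim0), [{relNot, relLe, relLimZero}], [{beta opBigAnd}]),
        (gen (finPart (Dual ∩ Mono)), [{relNot, relLe, relLim}], [{opMedian}])] ∧
    borelPart (Dual ∩ Mono ∩ Lim0) = borelPart (Dual ∩ Mono ∩ Lim1) ∧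
    -- (c) unique extension exactly below the affine functions, and automatic continuity
    ((∀ G : Set Op, IsFinitaryClone G → ((∃! F : Set Op, F ∈ fiber G) ↔ G ⊆ Aff)) ∧
      (∀ G : Set Op, IsFinitaryClone G → G ⊆ Aff →
        fiber G = {gen G} ∧ gen G = borelPart (pointwiseClosure (gen G))) ∧
      borelPart Aff = gen (finPart Aff) ∧
      (∀ f ∈ borelPart Aff, Continuous f.2)) := by
  refine ⟨classified_All, classified_Cons0, classified_Cons1, classified_Cons0_Cons1,
    classified_Mono, classified_Mono_Cons0, classified_Mono_Cons1, classified_Mono_Cons0_Cons1,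
    classified_Dual, classified_Dual_Cons0, by rw [Dual_inter_Cons0], by rw [Dual_inter_Cons0],
    by rw [Dual_inter_Lim0], by rw [Dual_inter_Cons0], classified_Dual_Mono, ?_,
    fun _ hG => existsUnique_mem_fiber_iff hG,
    fun _ hG h => ⟨fiber_eq_singleton hG h, gen_eq_borelPart_pointwiseClosure hG h⟩,
    borelPart_Aff, fun _ hf => has_Cont_iff_continuous.1 (mem_Cont_of_Aff hf.1 hf.2)⟩
  rw [Set.inter_right_comm, Dual_inter_Lim0, Set.inter_right_comm]
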